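/- All digraphs are finite and simple (no loops, no multiple arcs). A digraph $T$ is *semi-complete* if for any two distinct vertices $u,v$ at least one of the arcs $(u,v)$, $(v,u)$ is present. The size of a digraph $H$ is $|H|=|V(H)|+|E(H)|$. An *immersion* of $H$ into $T$ maps distinct vertices of $H$ to distinct vertices of $T$, and each arc $(u,v)$ of $H$ to a directed path of $T$ leading from the image of $u$ to the image of $v$, such that the paths assigned to distinct arcs of $H$ are arc-disjoint; $H$ *immerses* into $T$ if such an immersion exists. **Theorem.** There is a single algorithm which, given a semi-complete digraph $T$ and a digraph $H$ (both by their numbers of vertices and their adjacency matrices), decides whether $H$ immerses into $T$, and which, if $V(T)\neq\emptyset$, does so in time $O\bigl(2^{O(k^2\log k)}\,|V(T)|^2\bigr)$, where $k=|H|$. That is, there are absolute constants $c,C$ such that for all such $T$ and $H$ with $V(T)\neq\emptyset$ the algorithm makes at most $C\cdot 2^{c\,k^2\log_2 k}\cdot|V(T)|^2$ steps (with $k^2\log_2 k$ read as $0$ for $k=0$). The machine model is the word RAM: a fixed program over finitely many registers and arrays of $w$-bit words (initially $0$ outside the input), with unit-cost reads, writes, tests, comparisons, addition, truncated subtraction,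 multiplication, and integer division with remainder. There is an absolute constant $c'$ such that the above holds for every word length $w\ge c'\,(k^2\log_2 k+\log_2 |V(T)|+1)$ (with $\log_2 0$ read as $0$), and no value that occurs during the run exceeds a word. -/

import Mathlib

/-! ### Digraphs, semi-completeness, immersions -/

namespace DigraphImmersion

variable {V W : Type*}

/-- A digraph is simple if it has no loops (multiple arcs cannot occur in `Digraph`). -/
def IsSimple (G : Digraph V) : Prop :=
  ∀ v, ¬ G.Adj v v

/-- A digraph is semi-complete if it is simple and any two distinct vertices are joined by at least
one of the two possible arcs. -/
def IsSemicomplete (G : Digraph V) : Prop :=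
  IsSimple G ∧ ∀ u v, u ≠ v → G.Adj u v ∨ G.Adj v u

/-- The size `|G| = |V(G)| + |E(G)|` of a (finite) digraph. -/
noncomputable def size (G : Digraph V) : ℕ :=
  Nat.card V + Nat.card {e : V × V // G.Adj e.1 e.2}

/-- The list of vertices `l` is a directed path of `G` leading from `u` to `v`. -/
def IsDiPath (G : Digraph V) (u v : V) (l : List V) : Prop :=
  l.IsChain G.Adj ∧ l.Nodup ∧ l.head? = some u ∧ l.getLast? = some v

/-- The arcs traversed by a list of vertices: the pairs of consecutive entries. -/
def pathArcs (l : List V) : List (V × V) :=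
  l.zip l.tail

/-- A (weak) immersion of `H` into `G`: distinct vertices of `H` are mapped to distinct vertices
of `G`, every arc `(u, v)` of `H` is mapped to a directed path of `G` from the image of `u` to the
image of `v`, and the paths of distinct arcs of `H` have no arc in common. -/
structure Immersion (H : Digraph V) (G : Digraph W) where
  onVert : V → W
  injective : Function.Injective onVert
  onArc : {e : V × V // H.Adj e.1 e.2} → List W
  isDiPath : ∀ e, IsDiPath G (onVert e.1.1) (onVert e.1.2) (onArc e)
  arcDisjoint : ∀ e f, e ≠ f → (pathArcs (onArc e)).Disjoint (pathArcs (onArc f))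

/-- `H` immerses into `G`. -/
def ImmersesInto (H : Digraph V) (G : Digraph W) : Prop :=
  Nonempty (Immersion H G)

end DigraphImmersion

/-! ### Word RAM with unit-cost operations

Programs are structured programs over finitely many registers and arrays.  Registers and array cells
contain words of `w` bits, i.e. natural numbers below `2 ^ w`, where `w` is a parameter of the
semantics which the program does not know. -/

namespace WordRAM

/-- The binary operations of the machine. -/
inductive Op
  | add | sub | mul | div | mod | eq | lt

/-- Meaning of the operations: truncated subtraction, quotient and remainder of natural numbers;
the two comparisons return `1` for true and `0` for false. -/
def Op.apply : Op → ℕ → ℕ → ℕ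
  | .add, a, b => a + b
  | .sub, a, b => a - b
  | .mul, a, b => a * b
  | .div, a, b => a / b
  | .mod, a, b => a % b
  | .eq, a, b => if a = b then 1 else 0
  | .lt, a, b => if a < b then 1 else 0

/-- A memory state: `reg x` is the content of register `x`, and `arr a i` is the content of cell `i`
of array `a`. -/
structure State where
  reg : ℕ → ℕ
  arr : ℕ → ℕ → ℕ

/-- Expressions: constants, registers, array cells whose index is computed, binary operations. -/
inductive Expr
  | const (c : ℕ)
  | reg (x : ℕ)
  | cell (a : ℕ) (i : Expr)
  | bin (o : Op) (e f : Expr)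

/-- The value of an expression in a state. -/
def Expr.val (s : State) : Expr → ℕ
  | .const c => c
  | .reg x => s.reg x
  | .cell a i => s.arr a (i.val s)
  | .bin o e f => o.apply (e.val s) (f.val s)

/-- All values that occur in the evaluation of an expression fit into words of `w` bits. -/
def Expr.Fits (w : ℕ) (s : State) : Expr → Prop
  | .const c => c < 2 ^ w
  | .reg x => s.reg x < 2 ^ w
  | .cell a i => i.Fits w s ∧ s.arr a (i.val s) < 2 ^ w
  | .bin o e f => e.Fits w s ∧ f.Fits w s ∧ o.apply (e.val s) (f.val s) < 2 ^ w

/-- The number of elementary operations (constants, reads, binary operations) in the evaluation of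
an expression. -/
def Expr.cost : Expr → ℕ
  | .const _ => 1
  | .reg _ => 1
  | .cell _ i => i.cost + 1
  | .bin _ e f => e.cost + f.cost + 1

/-- Programs: `assign x e` writes the value of `e` into register `x`; `store a i e` writes the value
of `e` into the cell of array `a` whose index is the value of `i`; a test succeeds if the value of
the expression is not `0`. -/
inductive Prog
  | skip
  | assign (x : ℕ) (e : Expr)
  | store (a : ℕ) (i e : Expr)
  | seq (p q : Prog)
  | branch (e : Expr) (p q : Prog)
  | loop (e : Expr) (p : Prog)

/-- The state after writing `v` into register `x`. -/
def State.setReg (s : State) (x v : ℕ) : State :=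
  { s with reg := Function.update s.reg x v }

/-- The state after writing `v` into cell `i` of array `a`. -/
def State.setCell (s : State) (a i v : ℕ) : State :=
  { s with arr := Function.update s.arr a (Function.update (s.arr a) i v) }

/-- `Exec w p s t s'`: on words of `w` bits, program `p` started in state `s` halts after exactly
`t` steps in state `s'`.  Every elementary operation, write and test is one step.  There is no rule
for a step in which a value does not fit into a word: such a run does not halt. -/
inductive Exec (w : ℕ) : Prog → State → ℕ → State → Prop
  | skip (s : State) : Exec w .skip s 1 s
  | assign {x : ℕ} {e : Expr} {s : State} (he : e.Fits w s) :
      Exec w (.assign x e) s (e.cost + 1) (s.setReg x (e.val s))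
  | store {a : ℕ} {i e : Expr} {s : State} (hi : i.Fits w s) (he : e.Fits w s) :
      Exec w (.store a i e) s (i.cost + e.cost + 1) (s.setCell a (i.val s) (e.val s))
  | seq {p q : Prog} {s s' s'' : State} {t t' : ℕ} (hp : Exec w p s t s')
      (hq : Exec w q s' t' s'') : Exec w (.seq p q) s (t + t') s''
  | branch_true {e : Expr} {p q : Prog} {s s' : State} {t : ℕ} (he : e.Fits w s)
      (hv : e.val s ≠ 0) (hp : Exec w p s t s') :
      Exec w (.branch e p q) s (e.cost + 1 + t) s'
  | branch_false {e : Expr} {p q : Prog} {s s' : State} {t : ℕ} (he : e.Fits w s)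
      (hv : e.val s = 0) (hq : Exec w q s t s') :
      Exec w (.branch e p q) s (e.cost + 1 + t) s'
  | loop_false {e : Expr} {p : Prog} {s : State} (he : e.Fits w s) (hv : e.val s = 0) :
      Exec w (.loop e p) s (e.cost + 1) s
  | loop_true {e : Expr} {p : Prog} {s s' s'' : State} {t t' : ℕ} (he : e.Fits w s)
      (hv : e.val s ≠ 0) (hp : Exec w p s t s') (hl : Exec w (.loop e p) s' t' s'') :
      Exec w (.loop e p) s (e.cost + 1 + t + t') s''

/-- The machine is deterministic, so the result and the number of steps of a halting run are
determined by the program and its input. -/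
theorem Exec.deterministic {w : ℕ} {p : Prog} {s s₁ s₂ : State} {t₁ t₂ : ℕ}
    (h₁ : Exec w p s t₁ s₁) (h₂ : Exec w p s t₂ s₂) : t₁ = t₂ ∧ s₁ = s₂ := by
  induction h₁ generalizing t₂ s₂ with
  | skip => cases h₂; exact ⟨rfl, rfl⟩
  | assign _ => cases h₂; exact ⟨rfl, rfl⟩
  | store _ _ => cases h₂; exact ⟨rfl, rfl⟩
  | seq _ _ ihp ihq =>
    cases h₂ with
    | seq hp hq =>
      obtain ⟨rfl, rfl⟩ := ihp hp
      obtain ⟨rfl, rfl⟩ := ihq hq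
      exact ⟨rfl, rfl⟩
  | branch_true _ hv _ ih =>
    cases h₂ with
    | branch_true _ _ hp => obtain ⟨rfl, rfl⟩ := ih hp; exact ⟨rfl, rfl⟩
    | branch_false _ hv' _ => exact absurd hv' hv
  | branch_false _ hv _ ih =>
    cases h₂ with
    | branch_true _ hv' _ => exact absurd hv hv'
    | branch_false _ _ hq => obtain ⟨rfl, rfl⟩ := ih hq; exact ⟨rfl, rfl⟩
  | loop_false _ hv =>
    cases h₂ with
    | loop_false => exact ⟨rfl, rfl⟩
    | loop_true _ hv' => exact absurd hv hv'
  | loop_true _ hv _ _ ihp ihl =>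
    cases h₂ with
    | loop_false _ hv' => exact absurd hv' hv
    | loop_true _ _ hp hl =>
      obtain ⟨rfl, rfl⟩ := ihp hp
      obtain ⟨rfl, rfl⟩ := ihl hl
      exact ⟨rfl, rfl⟩

open Classical in
/-- The truth value of a proposition as a bit. -/
noncomputable def bit (p : Prop) : ℕ :=
  if p then 1 else 0

/-- The adjacency matrix of a digraph on `{0, …, n - 1}`, stored row by row: cell `u * n + v`
contains `1` if `(u, v)` is an arc; all other cells contain `0`. -/
noncomputable def adjacencyArray {n : ℕ} (G : Digraph (Fin n)) : ℕ → ℕ :=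
  fun i => bit (∃ u v : Fin n, G.Adj u v ∧ i = (u : ℕ) * n + (v : ℕ))

/-- The initial state for the input `(T, H)`: registers `0` and `1` contain the numbers of vertices
of `T` and `H`, arrays `0` and `1` contain their adjacency matrices; everything else is `0`. -/
noncomputable def inputState {n h : ℕ} (T : Digraph (Fin n)) (H : Digraph (Fin h)) : State where
  reg := fun x => if x = 0 then n else if x = 1 then h else 0
  arr := fun a => if a = 0 then adjacencyArray T else if a = 1 then adjacencyArray H else fun _ => 0

end WordRAM

/-! Let `k = |H|` and `m = 40000 k²`, and order the vertices of `T` by decreasing outdegree. Every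
cut of this order splits the vertices into an initial and a final segment; an arc from the final to
the initial one is called backward. There are two cases.

If some cut has more than `m` backward arcs, then `H` immerses (`immersesInto_of_backward_arcs`).
The backward arcs contain a large star or a large matching, and semi-completeness together with the
order of the outdegrees yields `k` vertices any two of which stay joined by at most four arcs after
the deletion of any `4k` arcs (`linked_outStar`, `linked_inStar`, `linked_matching`). The arcs of
`H` can then be routed greedily between these vertices.

Otherwise all cuts have at most `m` backward arcs, and dynamic programming along the order decides.
An immersion is the same as a labelling of arcs of `T` by arcs of `H` in which every label is a unit
flow (`exists_isFlow`, `immersesInto_of_isFlow`); superfluous cycles do no harm. A unit flow crosses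
a cut forward at most once more than backward, so at most `2m + k` used arcs cross any cut
(`IsFlow.card_crossing_le`).

A state at a cut must describe these arcs without spending `log n` bits on each. A backward arc is
described by its tail, a vertex incident with a backward arc over the cut; there are at most `2m`
such special vertices, and a rank names them. For a forward arc, let `a` be its tail. Either `a` is
special, or no arc from behind the cut enters `a`. In the latter case `a` is generic: by
semi-completeness it sends arcs to all vertices behind the cut, and its identity no longer matters.
All that has to be remembered is which pending forward arcs share their tail, so that no arc is used
twice. Hence a state consists of `O(k²)` digits bounded by a polynomial in `k`, and there are
`2^{O(k² log k)}` states. Sweeps through such states give flows (`Sweep.exists_isFlow`) and flows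
give sweeps (`exists_plan`, `Plan.sweep`, `Plan.exists_mark`).

For the machine, all tables (outdegrees, order, prefix sums of the adjacency matrix, ranks,
reachable states) are given by terms of a small language with bounded sums. A term is compiled once
and for all, with a bound for time and for all intermediate values (`Tm.comp_exec`). The time of a
term depends only on the bounds of its sums; in the transition condition these bounds depend on `H`
alone, so each row of the table of reachable states takes time independent of `n`. The quadratic
term comes from the tables for `T`. -/

namespace WordRAM

/-! ### A term language with bounded sums, compiled to programs -/

/-- Terms over variables and arrays; `sum x y e` is the sum of `e` over all values of the variable
`x` below the value of the variable `y`. -/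
inductive Tm
  | const (c : ℕ)
  | var (x : ℕ)
  | cell (a : ℕ) (i : Tm)
  | bin (o : Op) (e f : Tm)
  | sum (x y : ℕ) (e : Tm)

/-- The value of a term. -/
def Tm.eval (A : ℕ → ℕ → ℕ) : Tm → (ℕ → ℕ) → ℕ
  | .const c, _ => c
  | .var x, v => v x
  | .cell a i, v => A a (i.eval A v)
  | .bin o e f, v => o.apply (e.eval A v) (f.eval A v)
  | .sum x y e, v => ∑ j ∈ Finset.range (v y), e.eval A (Function.update v x j)

/-- If variables, constants and array cells are at most `X`, then the term is at most
`X ^ deg`. -/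
def Tm.deg : Tm → ℕ
  | .const _ => 1
  | .var _ => 1
  | .cell _ i => i.deg + 1
  | .bin _ e f => e.deg + f.deg
  | .sum _ _ e => e.deg + 1

/-- The nesting depth of sums. -/
def Tm.depth : Tm → ℕ
  | .const _ => 0
  | .var _ => 0
  | .cell _ i => i.depth
  | .bin _ e f => max e.depth f.depth
  | .sum _ _ e => e.depth + 1

/-- A weight proportional to the number of instructions of the compiled term. -/
def Tm.size : Tm → ℕ
  | .const _ => 2
  | .var _ => 2
  | .cell _ i => i.size + 3
  | .bin _ e f => e.size + f.size + 4
  | .sum _ _ e => e.size + 20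

/-- The largest constant of a term. -/
def Tm.cmax : Tm → ℕ
  | .const c => c
  | .var _ => 0
  | .cell _ i => i.cmax
  | .bin _ e f => max e.cmax f.cmax
  | .sum _ _ e => e.cmax

/-- All sums of the term are bounded by variables of the list `G`, which are never rebound. -/
def Tm.bounds (G : List ℕ) : Tm → Bool
  | .const _ => true
  | .var _ => true
  | .cell _ i => i.bounds G
  | .bin _ e f => e.bounds G && f.bounds G
  | .sum x y e => G.contains y && !G.contains x && e.bounds G

/-- Code for a term: `ρ` assigns registers to variables, the value is written into register `r`, and
registers below `r` are not changed. -/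
def Tm.comp : Tm → (ℕ → ℕ) → ℕ → Prog
  | .const c, _, r => .assign r (.const c)
  | .var x, ρ, r => .assign r (.reg (ρ x))
  | .cell a i, ρ, r => .seq (i.comp ρ r) (.assign r (.cell a (.reg r)))
  | .bin o e f, ρ, r =>
    .seq (e.comp ρ r) (.seq (f.comp ρ (r + 1)) (.assign r (.bin o (.reg r) (.reg (r + 1)))))
  | .sum x y e, ρ, r =>
    .seq (.assign r (.const 0)) (.seq (.assign (r + 1) (.const 0))
      (.loop (.bin .lt (.reg (r + 1)) (.reg (ρ y)))
        (.seq (e.comp (Function.update ρ x (r + 1)) (r + 2))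
          (.seq (.assign r (.bin .add (.reg r) (.reg (r + 2))))
            (.assign (r + 1) (.bin .add (.reg (r + 1)) (.const 1)))))))

theorem Tm.one_le_deg (q : Tm) : 1 ≤ q.deg := by
  induction q <;> simp only [Tm.deg] <;> omega

/-- Since `X ≥ 2` and the exponents are positive, both powers are at least 2, so their product
bounds even their sum; the other operations do not exceed an operand or 1. -/
theorem Op.apply_le_pow {X a b m n : ℕ} (hX : 2 ≤ X) (hm : 1 ≤ m) (hn : 1 ≤ n) (ha : a ≤ X ^ m)
    (hb : b ≤ X ^ n) (o : Op) : o.apply a b ≤ X ^ (m + n) := by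
  have h1 : X ≤ X ^ m := Nat.le_self_pow (by omega) X
  have h2 : X ≤ X ^ n := Nat.le_self_pow (by omega) X
  have h3 : X ^ m ≤ X ^ m * X ^ n := Nat.le_mul_of_pos_right _ (by omega)
  have h4 : a * b ≤ X ^ m * X ^ n := Nat.mul_le_mul ha hb
  have h5 : X ^ m + X ^ n ≤ X ^ m * X ^ n := Nat.add_le_mul (by omega) (by omega)
  rw [pow_add]
  cases o <;> simp only [Op.apply]
  · omega
  · omega
  · exact h4
  · exact (Nat.div_le_self _ _).trans (by omega)
  · exact (Nat.mod_le _ _).trans (by omega)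
  · split <;> omega
  · split <;> omega

theorem Tm.eval_le {A : ℕ → ℕ → ℕ} {X : ℕ} (hX : 2 ≤ X) (hA : ∀ a i, A a i ≤ X) (q : Tm) :
    ∀ v : ℕ → ℕ, (∀ x, v x ≤ X) → q.cmax ≤ X → q.eval A v ≤ X ^ q.deg := by
  induction q with
  | const c => intro v hv hc; simpa [Tm.eval, Tm.deg, Tm.cmax] using hc
  | var x => intro v hv hc; simpa [Tm.eval, Tm.deg] using hv x
  | cell a i ih =>
    intro v hv hc
    exact (hA _ _).trans (Nat.le_self_pow (by simp [Tm.deg]) X)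
  | bin o e f ihe ihf =>
    intro v hv hc
    simp only [Tm.cmax, max_le_iff] at hc
    exact Op.apply_le_pow hX e.one_le_deg f.one_le_deg (ihe v hv hc.1) (ihf v hv hc.2) o
  | sum x y e ih =>
    intro v hv hc
    simp only [Tm.eval, Tm.deg]
    calc _ ≤ ∑ j ∈ Finset.range (v y), X ^ e.deg := by
          refine Finset.sum_le_sum fun j hj => ih _ (fun z => ?_) hc
          by_cases hz : z = x
          · subst hz
            simpa using (Finset.mem_range.1 hj).le.trans (hv y)
          · simpa [hz] using hv z
      _ = v y * X ^ e.deg := by simp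
      _ ≤ X * X ^ e.deg := Nat.mul_le_mul_right _ (hv y)
      _ = X ^ (e.deg + 1) := by ring

/-- A loop with `N` iterations, each of at most `T` steps. -/
theorem exec_loop {w N T : ℕ} {e : Expr} {p : Prog} (I : ℕ → State → Prop)
    (hstep : ∀ i < N, ∀ s, I i s → e.Fits w s ∧ e.val s ≠ 0 ∧
      ∃ t ≤ T, ∃ s', Exec w p s t s' ∧ I (i + 1) s')
    (hend : ∀ s, I N s → e.Fits w s ∧ e.val s = 0) {s : State} (hs : I 0 s) :
    ∃ t ≤ N * (T + e.cost + 1) + e.cost + 1, ∃ s', Exec w (.loop e p) s t s' ∧ I N s' := by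
  -- Induction on the number `d` of remaining iterations, because the rule for loops peels off the
  -- first iteration.
  suffices h : ∀ d i s, i + d = N → I i s →
      ∃ t ≤ d * (T + e.cost + 1) + e.cost + 1, ∃ s', Exec w (.loop e p) s t s' ∧ I N s' from
    h N 0 s (by omega) hs
  intro d
  induction d with
  | zero =>
    intro i s hi h
    obtain rfl : i = N := by omega
    obtain ⟨h1, h2⟩ := hend s h
    exact ⟨_, by omega, s, .loop_false h1 h2, h⟩
  | succ d ih =>
    intro i s hi h
    obtain ⟨h1, h2, t, ht, s', hs', hI⟩ := hstep i (by omega) s h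
    obtain ⟨t', ht', s'', hs'', hI'⟩ := ih (i + 1) s' (by omega) hI
    refine ⟨_, ?_, s'', .loop_true h1 h2 hs' hs'', hI'⟩
    have : (d + 1) * (T + e.cost + 1) = d * (T + e.cost + 1) + (T + e.cost + 1) := by ring
    omega

/-- Correctness, time and absence of overflow come from one induction on the term. Registers from
`r` on are scratch space, and `ρ x < r` keeps the variables out of it. The bound `X` controls the
word length, while `M` bounds only the variables in `G`, which limit the sums; since `bounds`
forbids rebinding them, `M` remains valid below binders and alone determines the time. -/
theorem Tm.comp_exec {w : ℕ} {A : ℕ → ℕ → ℕ} {X M : ℕ} {G : List ℕ} (hX : 2 ≤ X)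
    (hA : ∀ a i, A a i ≤ X) (q : Tm) : ∀ (ρ : ℕ → ℕ) (r : ℕ) (s : State) (v : ℕ → ℕ),
    (∀ x, ρ x < r) → (∀ x, s.reg (ρ x) = v x) → s.arr = A → (∀ x, v x ≤ X) → q.cmax ≤ X →
    X ^ q.deg < 2 ^ w → q.bounds G = true → (∀ y ∈ G, v y ≤ M) →
    ∃ t ≤ q.size * (M + 1) ^ q.depth, ∃ s', Exec w (q.comp ρ r) s t s' ∧ s'.arr = A ∧
      s'.reg r = q.eval A v ∧ ∀ x < r, s'.reg x = s.reg x := by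
  induction q with
  | const c =>
    intro ρ r s v hρ hs hsA hv hc hw hG hM
    simp only [Tm.deg, pow_one, Tm.cmax] at hw hc
    refine ⟨2, by simp [Tm.size, Tm.depth], _, .assign (e := .const c) ?_, hsA, ?_, ?_⟩
    · simp only [Expr.Fits]; omega
    · simp [State.setReg, Tm.eval, Expr.val]
    · intro x hx
      simp [State.setReg, hx.ne]
  | var y =>
    intro ρ r s v hρ hs hsA hv hc hw hG hM
    simp only [Tm.deg, pow_one] at hw
    refine ⟨2, by simp [Tm.size, Tm.depth], _, .assign (e := .reg (ρ y)) ?_, hsA, ?_, ?_⟩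
    · simp only [Expr.Fits, hs]
      have := hv y
      omega
    · simp [State.setReg, Tm.eval, Expr.val, hs]
    · intro x hx
      simp [State.setReg, hx.ne]
  | cell a i ih =>
    intro ρ r s v hρ hs hsA hv hc hw hG hM
    have hlt : X ^ i.deg < 2 ^ w := lt_of_le_of_lt
      (Nat.pow_le_pow_right (by omega) (by simp [Tm.deg])) hw
    have hX1 : X < 2 ^ w := lt_of_le_of_lt (Nat.le_self_pow (by simp [Tm.deg]) X) hw
    obtain ⟨t, ht, s1, h1, h1A, h1r, h1x⟩ := ih ρ r s v hρ hs hsA hv hc hlt hG hM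
    refine ⟨t + 3, ?_, _, .seq h1 (.assign (e := .cell a (.reg r)) ?_), h1A, ?_, ?_⟩
    · simp only [Tm.size, Tm.depth, add_mul]
      have : 0 < (M + 1) ^ i.depth := by positivity
      omega
    · have h2 := hA a (s1.reg r)
      have h3 := Tm.eval_le hX hA i v hv hc
      simp only [Expr.Fits, Expr.val, h1r, h1A] at h2 ⊢
      omega
    · simp [State.setReg, Tm.eval, Expr.val, h1r, h1A]
    · intro x hx
      simp [State.setReg, hx.ne, h1x x hx]
  | bin o e f ihe ihf =>
    intro ρ r s v hρ hs hsA hv hc hw hG hM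
    have hlte : X ^ e.deg < 2 ^ w := lt_of_le_of_lt
      (Nat.pow_le_pow_right (by omega) (by simp [Tm.deg])) hw
    have hltf : X ^ f.deg < 2 ^ w := lt_of_le_of_lt
      (Nat.pow_le_pow_right (by omega) (by simp [Tm.deg])) hw
    simp only [Tm.cmax, max_le_iff] at hc
    simp only [Tm.bounds, Bool.and_eq_true] at hG
    obtain ⟨t, ht, s1, h1, h1A, h1r, h1x⟩ := ihe ρ r s v hρ hs hsA hv hc.1 hlte hG.1 hM
    obtain ⟨t', ht', s2, h2, h2A, h2r, h2x⟩ := ihf ρ (r + 1) s1 v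
      (fun x => (hρ x).trans (by omega)) (fun x => by rw [h1x _ (hρ x), hs]) h1A hv hc.2 hltf hG.2
      hM
    have he := Tm.eval_le hX hA e v hv hc.1
    have hf := Tm.eval_le hX hA f v hv hc.2
    have h2r' : s2.reg r = e.eval A v := by rw [h2x r (by omega), h1r]
    refine ⟨t + (t' + 4), ?_, _,
      .seq h1 (.seq h2 (.assign (e := .bin o (.reg r) (.reg (r + 1))) ?_)), h2A, ?_, ?_⟩
    · simp only [Tm.size, Tm.depth]
      have h3 : (M + 1) ^ e.depth ≤ (M + 1) ^ max e.depth f.depth :=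
        Nat.pow_le_pow_right (by omega) (le_max_left _ _)
      have h4 : (M + 1) ^ f.depth ≤ (M + 1) ^ max e.depth f.depth :=
        Nat.pow_le_pow_right (by omega) (le_max_right _ _)
      have h5 := Nat.mul_le_mul_left e.size h3
      have h6 := Nat.mul_le_mul_left f.size h4
      have h7 : 0 < (M + 1) ^ max e.depth f.depth := by positivity
      simp only [add_mul]
      omega
    · simp only [Expr.Fits, Expr.val, h2r, h2r']
      refine ⟨by omega, by omega, lt_of_le_of_lt ?_ hw⟩
      exact Op.apply_le_pow hX e.one_le_deg f.one_le_deg he hf o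
    · simp [State.setReg, Tm.eval, Expr.val, h2r, h2r']
    · intro x hx
      simp [State.setReg, hx.ne, h2x x (by omega), h1x x hx]
  | sum x y e ih =>
    intro ρ r s v hρ hs hsA hv hc hw hG hM
    have hlte : X ^ e.deg < 2 ^ w := lt_of_le_of_lt
      (Nat.pow_le_pow_right (by omega) (by simp [Tm.deg])) hw
    have hX1 : X < 2 ^ w := lt_of_le_of_lt (Nat.le_self_pow (by simp [Tm.deg]) X) hw
    have hwle := Tm.eval_le hX hA (.sum x y e) v hv hc
    simp only [Tm.bounds, Bool.and_eq_true, List.contains_iff_mem, Bool.not_eq_true',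
      ← Bool.not_eq_true] at hG
    obtain ⟨⟨hyG, hxG⟩, heG⟩ := hG
    -- The accumulator only grows, so every partial sum fits because the value of the whole term
    -- does.
    have hpart : ∀ i ≤ v y, ∑ j ∈ Finset.range i, e.eval A (Function.update v x j) < 2 ^ w := by
      intro i hi
      refine lt_of_le_of_lt ((Finset.sum_le_sum_of_subset ?_).trans hwle) hw
      exact Finset.range_mono hi
    let I : ℕ → State → Prop := fun i s' => i ≤ v y ∧ s'.arr = A ∧ s'.reg (r + 1) = i ∧
      s'.reg r = ∑ j ∈ Finset.range i, e.eval A (Function.update v x j) ∧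
      ∀ z < r, s'.reg z = s.reg z
    have hvy := hv y
    have hfit : ∀ i s', I i s' → (Expr.bin .lt (.reg (r + 1)) (.reg (ρ y))).Fits w s' := by
      rintro i s' ⟨hi, hA', hi', hr, hz⟩
      simp only [Expr.Fits, Expr.val, hi', hz _ (hρ y), hs, Op.apply]
      refine ⟨by omega, by omega, ?_⟩
      split <;> omega
    have hval : ∀ i s', I i s' → ((Expr.bin .lt (.reg (r + 1)) (.reg (ρ y))).val s' =
        if i < v y then 1 else 0) := by
      rintro i s' ⟨hi, hA', hi', hr, hz⟩
      simp only [Expr.val, hi', hz _ (hρ y), hs, Op.apply]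
    -- The summand 8 pays for the two additions after the body, of four steps each.
    have hloop := exec_loop (w := w) (N := v y) (T := e.size * (M + 1) ^ e.depth + 8)
      (e := .bin .lt (.reg (r + 1)) (.reg (ρ y)))
      (p := .seq (e.comp (Function.update ρ x (r + 1)) (r + 2))
          (.seq (.assign r (.bin .add (.reg r) (.reg (r + 2))))
            (.assign (r + 1) (.bin .add (.reg (r + 1)) (.const 1))))) I (by
        intro i hi s' hI
        refine ⟨hfit i s' hI, by rw [hval i s' hI, if_pos hi]; simp, ?_⟩
        obtain ⟨_, hA', hi', hr, hz⟩ := hI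
        obtain ⟨t, ht, s1, h1, h1A, h1r, h1x⟩ := ih (Function.update ρ x (r + 1)) (r + 2) s'
          (Function.update v x i) (by
            intro z
            by_cases hzx : z = x
            · subst hzx; simp
            · simp only [Function.update_of_ne hzx]; have := hρ z; omega)
          (by
            intro z
            by_cases hzx : z = x
            · subst hzx; simpa using hi'
            · simp only [Function.update_of_ne hzx]; rw [hz _ (hρ z), hs])
          hA' (by
            intro z
            by_cases hzx : z = x
            · subst hzx; simpa using hi.le.trans hvy
            · simpa only [Function.update_of_ne hzx] using hv z)
          hc hlte heG (by
            intro z hz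
            have hzx : z ≠ x := by rintro rfl; exact hxG hz
            simpa only [Function.update_of_ne hzx] using hM z hz)
        have h1i : s1.reg (r + 1) = i := by rw [h1x _ (by omega), hi']
        have h1s : s1.reg r = ∑ j ∈ Finset.range i, e.eval A (Function.update v x j) := by
          rw [h1x _ (by omega), hr]
        have hp1 := hpart i hi.le
        have hp2 := hpart (i + 1) hi
        rw [Finset.sum_range_succ] at hp2
        refine ⟨t + (4 + 4), by omega, _, .seq h1 (.seq
          (.assign (e := .bin .add (.reg r) (.reg (r + 2))) ?_)
          (.assign (e := .bin .add (.reg (r + 1)) (.const 1)) ?_)), hi, h1A, ?_, ?_, ?_⟩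
        · simp only [Expr.Fits, Expr.val, Op.apply, h1s, h1r]
          omega
        · simp only [Expr.Fits, Expr.val, Op.apply, State.setReg,
            Function.update_of_ne (show r + 1 ≠ r by omega), h1i]
          omega
        · simp [State.setReg, Expr.val, Op.apply, h1i]
        · simp [State.setReg, Expr.val, Op.apply, h1s, h1r, Finset.sum_range_succ]
        · intro z hzr
          simp [State.setReg, hzr.ne, (show z ≠ r + 1 by omega), h1x z (by omega), hz z hzr])
      (by
        intro s' hI
        exact ⟨hfit _ s' hI, by rw [hval _ s' hI, if_neg (lt_irrefl _)]⟩)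
      (s := ((s.setReg r 0).setReg (r + 1) 0))
      ⟨Nat.zero_le _, hsA, by simp [State.setReg], by simp [State.setReg], by
        intro z hzr
        simp [State.setReg, hzr.ne, (show z ≠ r + 1 by omega)]⟩
    obtain ⟨t, ht, s1, h1, _, h1A, _, h1r, h1z⟩ := hloop
    refine ⟨2 + (2 + t), ?_, s1, .seq (.assign (e := .const 0) ?_)
      (.seq (.assign (e := .const 0) ?_) h1), h1A, h1r, h1z⟩
    · simp only [Expr.cost] at ht
      simp only [Tm.size, Tm.depth]
      have h3 : v y ≤ M := hM y hyG
      have h4 := Nat.mul_le_mul_right (e.size * (M + 1) ^ e.depth + 8 + (1 + 1 + 1) + 1) h3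
      have h5 : 1 ≤ (M + 1) ^ e.depth := Nat.one_le_pow _ _ (by omega)
      have h6 : M ≤ M * (M + 1) ^ e.depth := Nat.le_mul_of_pos_right _ h5
      have h7 : (e.size + 20) * (M + 1) ^ (e.depth + 1) = M * (e.size * (M + 1) ^ e.depth) +
        e.size * (M + 1) ^ e.depth + 20 * (M * (M + 1) ^ e.depth) + 20 * (M + 1) ^ e.depth := by
        ring
      have h8 : M * (e.size * (M + 1) ^ e.depth + 8 + (1 + 1 + 1) + 1) =
        M * (e.size * (M + 1) ^ e.depth) + 12 * M := by ring
      omega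
    · simp only [Expr.Fits]; omega
    · simp only [Expr.Fits]; omega

end WordRAM

/-! ### Commands for setting variables and filling tables -/

namespace WordRAM

/-- The registers of the variables outside of sums. -/
def homeReg (x : ℕ) : ℕ := if x < 64 then x else 0

/-- The state `s` has the array contents `A` and the values `v` of the variables. -/
def Agrees (s : State) (v : ℕ → ℕ) (A : ℕ → ℕ → ℕ) : Prop :=
  (∀ x, s.reg (homeReg x) = v x) ∧ s.arr = A

/-- From `(v, A)` the program `p` leads to `(v', A')` in at most `T` steps. -/
def Reach (w : ℕ) (p : Prog) (v : ℕ → ℕ) (A : ℕ → ℕ → ℕ) (T : ℕ) (v' : ℕ → ℕ)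
    (A' : ℕ → ℕ → ℕ) : Prop :=
  ∀ s, Agrees s v A → ∃ t ≤ T, ∃ s', Exec w p s t s' ∧ Agrees s' v' A'

theorem Reach.seq {w : ℕ} {p p' : Prog} {v v' v'' : ℕ → ℕ} {A A' A'' : ℕ → ℕ → ℕ} {T T' : ℕ}
    (h : Reach w p v A T v' A') (h' : Reach w p' v' A' T' v'' A'') :
    Reach w (.seq p p') v A (T + T') v'' A'' := by
  intro s hs
  obtain ⟨t, ht, s', hs', hs''⟩ := h s hs
  obtain ⟨t', ht', s₂, h2, h3⟩ := h' s' hs''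
  exact ⟨t + t', by omega, s₂, .seq hs' h2, h3⟩

/-- Write the value of a term into a variable. -/
def setVar (y : ℕ) (e : Tm) : Prog := .seq (e.comp homeReg 64) (.assign y (.reg 64))

/-- Fill the cells of an array whose indices are smaller than the variable `y`, one after the other;
variable `63` is the index. -/
def fill (a y : ℕ) (e : Tm) : Prog :=
  .seq (.loop (.bin .lt (.reg 63) (.reg (homeReg y)))
    (.seq (e.comp homeReg 64) (.seq (.store a (.reg 63) (.reg 64))
      (.assign 63 (.bin .add (.reg 63) (.const 1)))))) (.assign 63 (.const 0))

/-- An upper bound for the running time of a term. -/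
def Tm.cost (M : ℕ) (e : Tm) : ℕ := e.size * (M + 1) ^ e.depth

theorem homeReg_lt (x : ℕ) : homeReg x < 64 := by
  unfold homeReg; split <;> omega

/-- Variables from 64 on are aliases of variable 0, so that every variable has a register below the
scratch space. This is why register 0 is excluded here. -/
theorem homeReg_eq_iff {x y : ℕ} (hy : y ≠ 0) (hy' : y < 64) : homeReg x = y ↔ x = y := by
  unfold homeReg; split <;> omega

/-- The conditions under which a term can be evaluated. -/
structure Tm.Runs (w X : ℕ) (G : List ℕ) (e : Tm) : Prop where
  cmax_le : e.cmax ≤ X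
  pow_lt : X ^ e.deg < 2 ^ w
  bounds : e.bounds G = true

theorem reach_setVar {w X M : ℕ} {G : List ℕ} {e : Tm} {v : ℕ → ℕ} {A : ℕ → ℕ → ℕ} {y : ℕ}
    (hX : 2 ≤ X) (he : e.Runs w X G) (hA : ∀ a i, A a i ≤ X) (hv : ∀ x, v x ≤ X)
    (hM : ∀ y ∈ G, v y ≤ M) (hy : y ≠ 0) (hy' : y < 64) :
    Reach w (setVar y e) v A (e.cost M + 2) (Function.update v y (e.eval A v)) A := by
  rintro s ⟨hs, hsA⟩
  obtain ⟨t, ht, s', h1, h1A, h1r, h1x⟩ := Tm.comp_exec hX hA e homeReg 64 s v homeReg_lt hs hsA hv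
    he.cmax_le he.pow_lt he.bounds hM
  have hle := Tm.eval_le hX hA e v hv he.cmax_le
  refine ⟨t + 2, by unfold Tm.cost; omega, _, .seq h1 (.assign (e := .reg 64) ?_), ?_, h1A⟩
  · simp only [Expr.Fits, h1r]
    exact lt_of_le_of_lt hle he.pow_lt
  · intro x
    by_cases hx : x = y
    · subst hx
      simp [State.setReg, Expr.val, (homeReg_eq_iff hy hy').2, h1r]
    · have : homeReg x ≠ y := fun h => hx ((homeReg_eq_iff hy hy').1 h)
      simp [State.setReg, this, hx, h1x _ (homeReg_lt x), hs]

/-- The final command of a program: the answer is written into register `0`. -/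
theorem exec_answer {w X M : ℕ} {G : List ℕ} {e : Tm} {v : ℕ → ℕ} {A : ℕ → ℕ → ℕ} {s : State}
    (hX : 2 ≤ X) (he : e.Runs w X G) (hA : ∀ a i, A a i ≤ X) (hv : ∀ x, v x ≤ X)
    (hM : ∀ y ∈ G, v y ≤ M) (hs : Agrees s v A) :
    ∃ t ≤ e.cost M + 2, ∃ s', Exec w (setVar 0 e) s t s' ∧ s'.reg 0 = e.eval A v := by
  obtain ⟨t, ht, s', h1, h1A, h1r, h1x⟩ := Tm.comp_exec hX hA e homeReg 64 s v homeReg_lt hs.1 hs.2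
    hv he.cmax_le he.pow_lt he.bounds hM
  have hle := Tm.eval_le hX hA e v hv he.cmax_le
  refine ⟨t + 2, by unfold Tm.cost; omega, _, .seq h1 (.assign (e := .reg 64) ?_), ?_⟩
  · simp only [Expr.Fits, h1r]
    exact lt_of_le_of_lt hle he.pow_lt
  · simp [State.setReg, Expr.val, h1r]

/-- In `hstep` the term is evaluated while the array holds the cells below `j` and zeros elsewhere.
It may therefore read earlier cells, which makes recursively defined tables possible. As `f`
vanishes from the bound on, the final array is `f` itself and not just an initial part of it. -/
theorem reach_fill {w X M : ℕ} {G : List ℕ} {e : Tm} {v : ℕ → ℕ} {A : ℕ → ℕ → ℕ} {a y : ℕ}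
    {f : ℕ → ℕ} (hX : 2 ≤ X) (he : e.Runs w X G) (hA : ∀ a i, A a i ≤ X) (hv : ∀ x, v x ≤ X)
    (hM : ∀ y ∈ G, v y ≤ M) (hG : 63 ∉ G) (hy : y ≠ 63) (hv63 : v 63 = 0) (hAa : A a = fun _ => 0)
    (hf : ∀ i, f i ≤ X) (hf0 : ∀ i, v y ≤ i → f i = 0)
    (hstep : ∀ j < v y, e.eval (Function.update A a (fun i => if i < j then f i else 0))
      (Function.update v 63 j) = f j) :
    Reach w (fill a y e) v A (v y * (e.cost M + 12) + 6) v (Function.update A a f) := by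
  rintro s ⟨hs, hsA⟩
  have hX1 : X < 2 ^ w := lt_of_le_of_lt
    (Nat.le_self_pow (by have := e.one_le_deg; omega) X) he.pow_lt
  have hvy := hv y
  let F : ℕ → ℕ → ℕ → ℕ := fun j => Function.update A a (fun i => if i < j then f i else 0)
  have hFX : ∀ j b i, F j b i ≤ X := by
    intro j b i
    simp only [F]
    by_cases hb : b = a
    · subst hb
      simp only [Function.update_self]
      split
      · exact hf i
      · omega
    · simp only [Function.update_of_ne hb]
      exact hA b i
  let I : ℕ → State → Prop := fun j s' => j ≤ v y ∧ Agrees s' (Function.update v 63 j) (F j)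
  have hy63 : ∀ j, Function.update v 63 j y = v y := fun j => Function.update_of_ne hy _ _
  have hreg63 : ∀ j s', I j s' → s'.reg 63 = j := by
    intro j s' h
    have := h.2.1 63
    simpa [homeReg] using this
  have hfit : ∀ j s', I j s' → (Expr.bin .lt (.reg 63) (.reg (homeReg y))).Fits w s' := by
    intro j s' h
    have h1 := hreg63 j s' h
    have h2 := h.2.1 y
    rw [hy63] at h2
    have h3 := h.1
    simp only [Expr.Fits, Expr.val, h1, h2, Op.apply]
    refine ⟨by omega, by omega, ?_⟩
    split <;> omega
  have hval : ∀ j s', I j s' → ((Expr.bin .lt (.reg 63) (.reg (homeReg y))).val s' =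
      if j < v y then 1 else 0) := by
    intro j s' h
    have h1 := hreg63 j s' h
    have h2 := h.2.1 y
    rw [hy63] at h2
    simp only [Expr.val, h1, h2, Op.apply]
  obtain ⟨t, ht, s1, h1, h1I⟩ := exec_loop (w := w) (N := v y) (T := e.cost M + 7)
    (e := .bin .lt (.reg 63) (.reg (homeReg y)))
    (p := .seq (e.comp homeReg 64) (.seq (.store a (.reg 63) (.reg 64))
      (.assign 63 (.bin .add (.reg 63) (.const 1))))) I (by
      intro j hj s' hI
      refine ⟨hfit j s' hI, by rw [hval j s' hI, if_pos hj]; simp, ?_⟩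
      obtain ⟨t, ht, s2, h2, h2A, h2r, h2x⟩ := Tm.comp_exec hX (hFX j) e homeReg 64 s'
        (Function.update v 63 j) homeReg_lt hI.2.1 hI.2.2 (by
          intro x
          by_cases hx : x = 63
          · subst hx; simpa using hj.le.trans hvy
          · simpa only [Function.update_of_ne hx] using hv x)
        he.cmax_le he.pow_lt he.bounds (M := M) (by
          intro z hz
          have : z ≠ 63 := by rintro rfl; exact hG hz
          simpa only [Function.update_of_ne this] using hM z hz)
      have h63 : s2.reg 63 = j := by rw [h2x 63 (by omega), hreg63 j s' hI]
      rw [hstep j hj] at h2r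
      have hfj := hf j
      refine ⟨t + (3 + 4), by unfold Tm.cost; omega, _, .seq h2 (.seq
          (.store (i := .reg 63) (e := .reg 64) ?_ ?_)
          (.assign (e := .bin .add (.reg 63) (.const 1)) ?_)), hj, ?_, ?_⟩
      · simp only [Expr.Fits, h63]; omega
      · simp only [Expr.Fits, h2r]; omega
      · simp only [Expr.Fits, Expr.val, State.setCell, h63, Op.apply]; omega
      · intro x
        have hIx := hI.2.1 x
        by_cases hx : x = 63
        · subst hx
          simp [State.setReg, State.setCell, Expr.val, Op.apply, homeReg, h63]
        · have : homeReg x ≠ 63 := fun h => hx ((homeReg_eq_iff (by omega) (by omega)).1 h)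
          simp only [Function.update_of_ne hx] at hIx ⊢
          simp [State.setReg, State.setCell, this, h2x _ (homeReg_lt x), hIx]
      · simp only [State.setReg, State.setCell, Expr.val, h63, h2r, h2A]
        funext b i
        simp only [F]
        by_cases hb : b = a
        · subst hb
          simp only [Function.update_self]
          by_cases hi : i = j
          · subst hi; simp
          · simp only [Function.update_of_ne hi]
            have : i < j ↔ i < j + 1 := by omega
            simp [this]
        · simp [Function.update_of_ne hb])
    (by
      intro s' hI
      exact ⟨hfit _ s' hI, by rw [hval _ s' hI, if_neg (lt_irrefl _)]⟩)
    (s := s) ⟨Nat.zero_le _, by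
      intro x
      rw [hs x, ← hv63, Function.update_eq_self], by
      rw [hsA]
      simp only [F, Nat.not_lt_zero, if_false]
      rw [← hAa, Function.update_eq_self]⟩
  refine ⟨t + 2, ?_, _, .seq h1 (.assign (e := .const 0) ?_), ?_, ?_⟩
  · simp only [Expr.cost] at ht
    have : v y * (e.cost M + 7 + (1 + 1 + 1) + 1) ≤ v y * (e.cost M + 12) :=
      Nat.mul_le_mul_left _ (by omega)
    omega
  · simp only [Expr.Fits]; omega
  · intro x
    have hIx := h1I.2.1 x
    by_cases hx : x = 63
    · subst hx
      simp [State.setReg, Expr.val, homeReg, hv63]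
    · have : homeReg x ≠ 63 := fun h => hx ((homeReg_eq_iff (by omega) (by omega)).1 h)
      simp only [Function.update_of_ne hx] at hIx
      simp [State.setReg, this, hIx]
  · have := h1I.2.2
    simp only [State.setReg, this]
    funext b i
    simp only [F]
    by_cases hb : b = a
    · subst hb
      simp only [Function.update_self]
      split
      · rfl
      · rw [hf0 i (by omega)]
    · simp [Function.update_of_ne hb]

end WordRAM

namespace DigraphImmersion

/-! ### Immersions from disjoint arc sets -/

section Paths

variable {V W : Type*}

/-- Induction from the front: if the new first vertex already lies on the path, everything before
its occurrence is cut off. -/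
theorem exists_nodup_chain {r : V → V → Prop} {a b : V} (h : Relation.ReflTransGen r a b) :
    ∃ l : List V, l.IsChain r ∧ l.Nodup ∧ l.head? = some a ∧ l.getLast? = some b := by
  induction h using Relation.ReflTransGen.head_induction_on with
  | refl => exact ⟨[b], by simp⟩
  | head hac _ ih =>
    rename_i a c _
    obtain ⟨l, h1, h2, h3, h4⟩ := ih
    by_cases ha : a ∈ l
    · obtain ⟨l₁, l₂, rfl⟩ := List.append_of_mem ha
      refine ⟨a :: l₂, h1.suffix (List.suffix_append _ _), h2.of_append_right, by simp, ?_⟩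
      rw [List.getLast?_append] at h4
      simpa [List.getLast?_cons] using h4
    · refine ⟨a :: l, ?_, List.nodup_cons.2 ⟨ha, h2⟩, by simp, ?_⟩
      · rw [List.isChain_cons]
        refine ⟨fun y hy => ?_, h1⟩
        rw [h3] at hy
        obtain rfl : c = y := by simpa using hy
        exact hac
      · cases l with
        | nil => simp at h3
        | cons d l => simpa using h4

theorem of_mem_pathArcs {r : V → V → Prop} {l : List V} (h : l.IsChain r) :
    ∀ p ∈ pathArcs l, r p.1 p.2 := by
  induction l with
  | nil => simp [pathArcs]
  | cons a l ih =>
    cases l with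
    | nil => simp [pathArcs]
    | cons b l =>
      rw [List.isChain_cons_cons] at h
      intro p hp
      have hp' : p = (a, b) ∨ p ∈ pathArcs (b :: l) := by simpa [pathArcs] using hp
      rcases hp' with rfl | hp'
      · exact h.1
      · exact ih h.2 p hp'

/-- Paths inside disjoint arc sets are arc-disjoint whatever they are, so it is enough to know that
each set contains some connection. -/
theorem immersesInto_of_arcSets {H : Digraph V} {G : Digraph W} (f : V → W)
    (hf : Function.Injective f) (S : {e : V × V // H.Adj e.1 e.2} → Set (W × W))
    (hS : ∀ e, ∀ p ∈ S e, G.Adj p.1 p.2) (hd : ∀ e e', e ≠ e' → Disjoint (S e) (S e'))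
    (hr : ∀ e, Relation.ReflTransGen (fun a b => (a, b) ∈ S e) (f e.1.1) (f e.1.2)) :
    ImmersesInto H G := by
  choose l h1 h2 h3 h4 using fun e => exists_nodup_chain (hr e)
  refine ⟨⟨f, hf, l, fun e => ⟨(h1 e).imp fun a b hab => hS e _ hab, h2 e, h3 e, h4 e⟩, ?_⟩⟩
  intro e e' hee p hp hp'
  exact Set.disjoint_left.1 (hd e e' hee) (of_mem_pathArcs (h1 e) p hp)
    (of_mem_pathArcs (h1 e') p hp')

end Paths

/-! ### Robustly linked vertices -/

section Linked

variable {U V : Type*} {G : Digraph V} {N c c' : ℕ} {a b d : V}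

/-- Whichever `N` arcs are deleted, there is a connection from `a` to `b` with at most `c` arcs. -/
def Linked (G : Digraph V) (N c : ℕ) (a b : V) : Prop :=
  ∀ F : Finset (V × V), F.card ≤ N → ∃ S : Finset (V × V), S.card ≤ c ∧
    (∀ p ∈ S, G.Adj p.1 p.2) ∧ Disjoint S F ∧ Relation.ReflTransGen (fun x y => (x, y) ∈ S) a b

theorem Linked.mono (h : Linked G N c a b) (hc : c ≤ c') : Linked G N c' a b := by
  intro F hF
  obtain ⟨S, h1, h2⟩ := h F hF
  exact ⟨S, h1.trans hc, h2⟩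

variable [DecidableEq V]

theorem Linked.trans (h : Linked G N c a b) (h' : Linked G N c' b d) :
    Linked G N (c + c') a d := by
  intro F hF
  obtain ⟨S, h1, h2, h3, h4⟩ := h F hF
  obtain ⟨S', h1', h2', h3', h4'⟩ := h' F hF
  refine ⟨S ∪ S', (Finset.card_union_le _ _).trans (by omega), ?_, ?_, ?_⟩
  · intro p hp
    rcases Finset.mem_union.1 hp with hp | hp
    exacts [h2 p hp, h2' p hp]
  · exact Finset.disjoint_union_left.2 ⟨h3, h3'⟩
  · exact (Relation.ReflTransGen.mono (fun x y hxy => Finset.mem_union_left _ hxy) _ _ h4).trans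
      (Relation.ReflTransGen.mono (fun x y hxy => Finset.mem_union_right _ hxy) _ _ h4')

/-- The deleted arcs have at most `N` heads and `N` tails, so some middle vertex is neither. -/
theorem linked_of_middle {Z : Finset V} (hZ : 2 * N < Z.card) (h1 : ∀ z ∈ Z, G.Adj a z)
    (h2 : ∀ z ∈ Z, G.Adj z b) : Linked G N 2 a b := by
  intro F hF
  have hcard : (F.image Prod.snd ∪ F.image Prod.fst).card < Z.card := by
    have := Finset.card_union_le (F.image Prod.snd) (F.image Prod.fst)
    have h3 : (F.image Prod.snd).card ≤ F.card := Finset.card_image_le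
    have h4 : (F.image Prod.fst).card ≤ F.card := Finset.card_image_le
    omega
  obtain ⟨z, hz, hzF⟩ := Finset.exists_mem_notMem_of_card_lt_card hcard
  simp only [Finset.mem_union, Finset.mem_image, not_or, not_exists, not_and] at hzF
  refine ⟨{(a, z), (z, b)}, Finset.card_le_two, ?_, ?_, ?_⟩
  · intro p hp
    rcases Finset.mem_insert.1 hp with rfl | hp
    · exact h1 z hz
    · rw [Finset.mem_singleton.1 hp]
      exact h2 z hz
  · rw [Finset.disjoint_left]
    intro p hp hpF
    rcases Finset.mem_insert.1 hp with rfl | hp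
    · exact hzF.1 _ hpF rfl
    · rw [Finset.mem_singleton.1 hp] at hpF
      exact hzF.2 _ hpF rfl
  · exact (Relation.ReflTransGen.single (by simp)).tail (b := z) (by simp)

/-- A middle arc `z` is safe if `z.1` is not a head, and `z.2` neither a head nor a tail, of a
deleted arc. As the members of `Z` have distinct tails and distinct heads, each of these three
conditions excludes at most `N` of them. -/
theorem linked_of_middle_arcs {Z : Finset (V × V)} (hZ : 3 * N < Z.card)
    (hi₁ : Set.InjOn Prod.fst (Z : Set (V × V))) (hi₂ : Set.InjOn Prod.snd (Z : Set (V × V)))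
    (h1 : ∀ z ∈ Z, G.Adj a z.1) (h2 : ∀ z ∈ Z, G.Adj z.1 z.2) (h3 : ∀ z ∈ Z, G.Adj z.2 b) :
    Linked G N 3 a b := by
  intro F hF
  have key : ∃ z ∈ Z, z.1 ∉ F.image Prod.snd ∧ z.2 ∉ F.image Prod.snd ∧
      z.2 ∉ F.image Prod.fst := by
    by_contra! hcon
    have hsub : Z ⊆ (Z.filter (fun z => z.1 ∈ F.image Prod.snd) ∪
        Z.filter (fun z => z.2 ∈ F.image Prod.snd)) ∪
        Z.filter (fun z => z.2 ∈ F.image Prod.fst) := by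
      intro z hz
      have := hcon z hz
      simp only [Finset.mem_union, Finset.mem_filter, hz, true_and]
      tauto
    have e1 : (Z.filter (fun z => z.1 ∈ F.image Prod.snd)).card ≤ F.card := by
      refine (Finset.card_le_card_of_injOn Prod.fst (t := F.image Prod.snd) ?_ ?_).trans
        Finset.card_image_le
      · intro z hz
        exact (Finset.mem_filter.1 hz).2
      · exact hi₁.mono (by intro z hz; exact (Finset.mem_filter.1 hz).1)
    have e2 : (Z.filter (fun z => z.2 ∈ F.image Prod.snd)).card ≤ F.card := by
      refine (Finset.card_le_card_of_injOn Prod.snd (t := F.image Prod.snd) ?_ ?_).trans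
        Finset.card_image_le
      · intro z hz
        exact (Finset.mem_filter.1 hz).2
      · exact hi₂.mono (by intro z hz; exact (Finset.mem_filter.1 hz).1)
    have e3 : (Z.filter (fun z => z.2 ∈ F.image Prod.fst)).card ≤ F.card := by
      refine (Finset.card_le_card_of_injOn Prod.snd (t := F.image Prod.fst) ?_ ?_).trans
        Finset.card_image_le
      · intro z hz
        exact (Finset.mem_filter.1 hz).2
      · exact hi₂.mono (by intro z hz; exact (Finset.mem_filter.1 hz).1)
    have := (Finset.card_le_card hsub).trans ((Finset.card_union_le _ _).trans
      (Nat.add_le_add_right (Finset.card_union_le _ _) _))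
    omega
  obtain ⟨z, hz, hz1, hz2, hz3⟩ := key
  simp only [Finset.mem_image, not_exists, not_and] at hz1 hz2 hz3
  refine ⟨{(a, z.1), (z.1, z.2), (z.2, b)}, Finset.card_le_three, ?_, ?_, ?_⟩
  · intro p hp
    simp only [Finset.mem_insert, Finset.mem_singleton] at hp
    rcases hp with rfl | rfl | rfl
    exacts [h1 z hz, h2 z hz, h3 z hz]
  · rw [Finset.disjoint_left]
    intro p hp hpF
    simp only [Finset.mem_insert, Finset.mem_singleton] at hp
    rcases hp with rfl | rfl | rfl
    exacts [hz1 _ hpF rfl, hz2 _ hpF rfl, hz3 _ hpF rfl]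
  · exact ((Relation.ReflTransGen.single (by simp)).tail (b := z.1) (by simp)).tail (b := z.2)
      (by simp)

/-- Greedy routing: at most `k` connections of at most four arcs each are ever present, so deleting
the arcs in use stays within the allowance `4 * k`. Arcs not yet routed have empty sets, which keeps
disjointness a statement about all pairs. -/
theorem exists_disjoint_connections {H : Digraph U} {k : ℕ} (hH : IsSimple H) (f : U → V)
    (hf : ∀ u v, u ≠ v → Linked G (4 * k) 4 (f u) (f v))
    (s : Finset {e : U × U // H.Adj e.1 e.2}) (hs : s.card ≤ k) :
    ∃ S : {e : U × U // H.Adj e.1 e.2} → Finset (V × V),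
      (∀ e, (S e).card ≤ 4) ∧ (∀ e, ∀ p ∈ S e, G.Adj p.1 p.2) ∧
      (∀ e e', e ≠ e' → Disjoint (S e) (S e')) ∧
      (∀ e ∉ s, S e = ∅) ∧
      ∀ e ∈ s, Relation.ReflTransGen (fun x y => (x, y) ∈ S e) (f e.1.1) (f e.1.2) := by
  classical
  induction s using Finset.induction_on with
  | empty => exact ⟨fun _ => ∅, by simp⟩
  | insert e s he ih =>
    rw [Finset.card_insert_of_notMem he] at hs
    obtain ⟨S, h1, h2, h3, h4, h5⟩ := ih (by omega)
    have hF : (s.biUnion S).card ≤ 4 * k :=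
      (Finset.card_biUnion_le_card_mul _ _ 4 fun e _ => h1 e).trans (by nlinarith)
    have hne : e.1.1 ≠ e.1.2 := by
      intro h
      have := e.2
      rw [h] at this
      exact hH _ this
    obtain ⟨Q, q1, q2, q3, q4⟩ := hf _ _ hne _ hF
    have hQ : ∀ e', e' ≠ e → Disjoint Q (S e') := by
      intro e' hee
      by_cases hes : e' ∈ s
      · exact q3.mono_right (Finset.subset_biUnion_of_mem S hes)
      · rw [h4 e' hes]
        exact Finset.disjoint_empty_right _
    refine ⟨Function.update S e Q, ?_, ?_, ?_, ?_, ?_⟩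
    · intro e'
      by_cases h : e' = e
      · subst h; simpa using q1
      · simpa [h] using h1 e'
    · intro e'
      by_cases h : e' = e
      · subst h; simpa using q2
      · simpa [h] using h2 e'
    · intro e' e'' hee
      by_cases h : e' = e
      · subst h
        simpa [Ne.symm hee] using hQ e'' (Ne.symm hee)
      · by_cases h' : e'' = e
        · subst h'
          simpa [h] using (hQ e' h).symm
        · simpa [h, h'] using h3 e' e'' hee
    · intro e' he'
      have h6 : e' ≠ e := by rintro rfl; exact he' (Finset.mem_insert_self _ _)
      simpa [h6] using h4 e' fun h => he' (Finset.mem_insert_of_mem h)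
    · intro e' he'
      by_cases h : e' = e
      · subst h; simpa using q4
      · simpa [h] using h5 e' ((Finset.mem_insert.1 he').resolve_left h)

/-- Any injection of the vertices of `H` into `Q` works, since all pairs in `Q` are linked. -/
theorem immersesInto_of_linked [Finite U] {H : Digraph U} {k : ℕ} (hH : IsSimple H)
    (hk : size H ≤ k) (Q : Finset V) (hQ : Nat.card U ≤ Q.card)
    (hl : ∀ u ∈ Q, ∀ v ∈ Q, u ≠ v → Linked G (4 * k) 4 u v) : ImmersesInto H G := by
  classical
  have := Fintype.ofFinite U
  rw [Nat.card_eq_fintype_card] at hQ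
  obtain ⟨f⟩ := Function.Embedding.nonempty_of_card_le (α := U) (β := Q) (by simpa using hQ)
  have hcard : (Finset.univ : Finset {e : U × U // H.Adj e.1 e.2}).card ≤ k := by
    rw [Finset.card_univ, ← Nat.card_eq_fintype_card]
    unfold size at hk
    omega
  obtain ⟨S, -, h2, h3, -, h4⟩ := exists_disjoint_connections hH (fun u => (f u : V))
    (fun u v huv => hl _ (f u).2 _ (f v).2 fun h => huv (f.injective (Subtype.ext h)))
    Finset.univ hcard
  refine immersesInto_of_arcSets (fun u => (f u : V))
    (fun u v h => f.injective (Subtype.ext h)) (fun e => (S e : Set (V × V))) h2 ?_ ?_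
  · intro e e' hee
    exact_mod_cast h3 e e' hee
  · intro e
    simpa using h4 e (Finset.mem_univ _)

end Linked

end DigraphImmersion

namespace DigraphImmersion

/-! ### A cut with many backward arcs forces immersions -/

section Structure

variable {V : Type*} [DecidableEq V]

/-- There are `|S| (|S| - 1)` ordered pairs, each related in one direction or the other, and at most
`|S| d` related pairs. The lemma bounds the number of vertices of small degree; the general `r`
covers outdegrees too. -/
theorem card_le_of_indegree_le {r : V → V → Prop} [DecidableRel r] {S : Finset V} {d : ℕ}
    (hr : ∀ u ∈ S, ∀ v ∈ S, u ≠ v → r u v ∨ r v u)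
    (hd : ∀ v ∈ S, (S.filter (fun u => r u v)).card ≤ d) : S.card ≤ 2 * d + 1 := by
  set E := (S ×ˢ S).filter (fun p => r p.1 p.2) with hE
  have h1 : S.offDiag ⊆ E ∪ E.image Prod.swap := by
    rintro ⟨u, v⟩ huv
    obtain ⟨hu, hv, hne⟩ := Finset.mem_offDiag.1 huv
    rcases hr u hu v hv hne with h | h
    · exact Finset.mem_union_left _ (by simpa [hE] using ⟨⟨hu, hv⟩, h⟩)
    · exact Finset.mem_union_right _ (by simpa [hE] using ⟨⟨hv, hu⟩, h⟩)
  have h2 : E.card ≤ S.card * d := by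
    have : E ⊆ S.biUnion fun v => (S.filter (fun u => r u v)).image fun u => (u, v) := by
      rintro ⟨u, v⟩ huv
      have : (u ∈ S ∧ v ∈ S) ∧ r u v := by simpa [hE] using huv
      simp only [Finset.mem_biUnion, Finset.mem_image, Finset.mem_filter]
      exact ⟨v, this.1.2, u, ⟨this.1.1, this.2⟩, rfl⟩
    refine (Finset.card_le_card this).trans (Finset.card_biUnion_le_card_mul _ _ _ ?_)
    intro v hv
    exact Finset.card_image_le.trans (hd v hv)
  have h3 := (Finset.card_le_card h1).trans (Finset.card_union_le _ _)
  have h4 : (E.image Prod.swap).card ≤ E.card := Finset.card_image_le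
  rw [Finset.offDiag_card] at h3
  have h5 : S.card * S.card ≤ S.card * (2 * d + 1) := by
    have : S.card * (2 * d + 1) = S.card * d + S.card * d + S.card := by ring
    omega
  rcases Nat.eq_zero_or_pos S.card with h | h
  · omega
  · exact Nat.le_of_mul_le_mul_left h5 h

/-- Greedy choice: every chosen arc rules out at most `2 * s` arcs sharing its tail or its head. -/
theorem exists_matching {E : Finset (V × V)} {s : ℕ}
    (h1 : ∀ y, (E.filter (fun e => e.1 = y)).card ≤ s)
    (h2 : ∀ x, (E.filter (fun e => e.2 = x)).card ≤ s) (r : ℕ) (hr : 2 * r * s < E.card) :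
    ∃ M ⊆ E, M.card = r ∧ Set.InjOn Prod.fst (M : Set (V × V)) ∧
      Set.InjOn Prod.snd (M : Set (V × V)) := by
  induction r with
  | zero => exact ⟨∅, by simp⟩
  | succ r ih =>
    obtain ⟨M, hM, hMr, i1, i2⟩ := ih (lt_of_le_of_lt (Nat.mul_le_mul_right _ (by omega)) hr)
    have hlt : (M.biUnion fun m => E.filter (fun e => e.1 = m.1) ∪
        E.filter (fun e => e.2 = m.2)).card < E.card := by
      refine lt_of_le_of_lt (Finset.card_biUnion_le_card_mul _ _ (2 * s) fun m _ => ?_)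
        (lt_of_le_of_lt ?_ hr)
      · refine (Finset.card_union_le _ _).trans ?_
        have := h1 m.1
        have := h2 m.2
        omega
      · rw [hMr]; nlinarith
    obtain ⟨e, he, heM⟩ := Finset.exists_mem_notMem_of_card_lt_card hlt
    simp only [Finset.mem_biUnion, Finset.mem_union, Finset.mem_filter, he, true_and, not_exists,
      not_and, not_or] at heM
    have heM' : e ∉ M := fun h => (heM e h).1 rfl
    refine ⟨insert e M, Finset.insert_subset he hM, by simp [heM', hMr], ?_, ?_⟩
    · rw [Finset.coe_insert, Set.injOn_insert (by simpa using heM')]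
      refine ⟨i1, ?_⟩
      rintro ⟨m, hm, hme⟩
      exact (heM m hm).1 hme.symm
    · rw [Finset.coe_insert, Set.injOn_insert (by simpa using heM')]
      refine ⟨i2, ?_⟩
      rintro ⟨m, hm, hme⟩
      exact (heM m hm).2 hme.symm

variable [Fintype V] {G : Digraph V} [DecidableRel G.Adj]

/-- The set of out-neighbours. -/
def outNbr (G : Digraph V) [DecidableRel G.Adj] (v : V) : Finset V := Finset.univ.filter (G.Adj v)

theorem mem_outNbr {u v : V} : v ∈ outNbr G u ↔ G.Adj u v := by simp [outNbr]

/-- An out-neighbour `w ≠ v` of `u` that is not an out-neighbour of `v` sends an arc to `v`, hence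
is the middle of a path from `u` to `v`. Few such paths mean that the out-neighbourhood of `u` is
almost contained in that of `v`. -/
theorem card_outNbr_sdiff_le {u v : V} {q : ℕ} (hG : IsSemicomplete G)
    (hz : ((outNbr G u).filter (fun z => G.Adj z v)).card < q) :
    (outNbr G u \ outNbr G v).card ≤ q := by
  have hsub : outNbr G u \ outNbr G v ⊆ insert v ((outNbr G u).filter (fun z => G.Adj z v)) := by
    intro w hw
    rw [Finset.mem_sdiff, mem_outNbr, mem_outNbr] at hw
    rw [Finset.mem_insert, Finset.mem_filter, mem_outNbr]
    by_cases hwv : w = v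
    · exact Or.inl hwv
    · exact Or.inr ⟨hw.1, (hG.2 v w (Ne.symm hwv)).resolve_left hw.2⟩
  have := (Finset.card_le_card hsub).trans (Finset.card_insert_le _ _)
  omega

/-- `Q` consists of the members of `S` with at least `2 * q` in-neighbours in `S`. Let `u, v ∈ Q`.
If there are `q` paths of length two from `u` to `y`, one can go from `u` to `y` and on through `S`
to `v`. Otherwise almost all out-neighbours of `u` are out-neighbours of `y`; as `u` has at least
the outdegree of `y`, the converse holds as well, so `u` misses at most `q` members of `S`, and the
remaining in-neighbours of `v` in `S` are middles of paths from `u` to `v`. -/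
theorem linked_outStar {k q : ℕ} (hG : IsSemicomplete G) (hq : 12 * k < q) {y : V} {S : Finset V}
    (hS : ∀ v ∈ S, G.Adj y v) (hdeg : ∀ v ∈ S, (outNbr G y).card ≤ (outNbr G v).card)
    (hcard : 4 * q + k ≤ S.card) :
    ∃ Q : Finset V, k ≤ Q.card ∧ ∀ u ∈ Q, ∀ v ∈ Q, u ≠ v → Linked G (4 * k) 4 u v := by
  refine ⟨S.filter (fun v => 2 * q ≤ (S.filter (fun u => G.Adj u v)).card), ?_, ?_⟩
  · have h1 := Finset.card_filter_add_card_filter_not (s := S)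
      (fun v => 2 * q ≤ (S.filter (fun u => G.Adj u v)).card)
    have h2 : (S.filter (fun v => ¬ 2 * q ≤ (S.filter (fun u => G.Adj u v)).card)).card ≤
        2 * (2 * q - 1) + 1 := by
      refine card_le_of_indegree_le (r := G.Adj) (fun u _ v _ huv => hG.2 u v huv) ?_
      intro v hv
      have h3 := (Finset.mem_filter.1 hv).2
      have h4 : ((S.filter (fun v => ¬ 2 * q ≤ (S.filter (fun u => G.Adj u v)).card)).filter
          (fun u => G.Adj u v)).card ≤ (S.filter (fun u => G.Adj u v)).card :=
        Finset.card_le_card (Finset.filter_subset_filter _ (Finset.filter_subset _ _))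
      omega
    omega
  · intro u hu v hv _
    rw [Finset.mem_filter] at hu hv
    by_cases hz : ((outNbr G u).filter (fun z => G.Adj z y)).card < q
    · have h1 := card_outNbr_sdiff_le hG hz
      have h2 : (outNbr G y \ outNbr G u).card ≤ q :=
        (Finset.card_sdiff_le_card_sdiff_iff.2 (hdeg u hu.1)).trans h1
      have h3 := Finset.card_filter_add_card_filter_not (s := S.filter (fun u => G.Adj u v))
        (fun z => G.Adj u z)
      have h4 : ((S.filter (fun u => G.Adj u v)).filter (fun z => ¬ G.Adj u z)).card ≤ q := by
        refine (Finset.card_le_card ?_).trans h2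
        intro z hz
        simp only [Finset.mem_filter] at hz
        simp only [Finset.mem_sdiff, mem_outNbr]
        exact ⟨hS z hz.1.1, hz.2⟩
      refine (linked_of_middle (N := 4 * k)
        (Z := (S.filter (fun u => G.Adj u v)).filter (fun z => G.Adj u z)) (by omega) ?_ ?_).mono
        (by omega)
      · intro z hz
        exact (Finset.mem_filter.1 hz).2
      · intro z hz
        exact (Finset.mem_filter.1 (Finset.mem_filter.1 hz).1).2
    · refine (Linked.trans (linked_of_middle (N := 4 * k) (a := u) (b := y)
        (Z := (outNbr G u).filter (fun z => G.Adj z y)) (by omega) ?_ ?_)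
        (linked_of_middle (Z := S.filter (fun u => G.Adj u v)) (by omega) ?_ ?_)).mono le_rfl
      · intro z hz
        exact mem_outNbr.1 (Finset.mem_filter.1 hz).1
      · intro z hz
        exact (Finset.mem_filter.1 hz).2
      · intro z hz
        exact hS z (Finset.mem_filter.1 hz).1
      · intro z hz
        exact (Finset.mem_filter.1 hz).2

/-- All connections pass through `x`: the first half needs `q` out-neighbours of `u` in `S`, the
second half `q` paths of length two from `x` to `v`. Few vertices fail the first condition. Those
failing only the second form `B`. Inside the out-neighbourhood of `x` they have small indegree among
themselves. Outside it they have small outdegree among themselves: the out-neighbourhood of `x` is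
almost contained in theirs, and since their outdegrees are not larger, theirs is almost contained in
that of `x`. -/
theorem linked_inStar {k q : ℕ} (hG : IsSemicomplete G) (hq : 12 * k < q) {x : V} {S : Finset V}
    (hS : ∀ v ∈ S, G.Adj v x) (hdeg : ∀ v ∈ S, (outNbr G v).card ≤ (outNbr G x).card)
    (hcard : 6 * q + 2 + k ≤ S.card) :
    ∃ Q : Finset V, k ≤ Q.card ∧ ∀ u ∈ Q, ∀ v ∈ Q, u ≠ v → Linked G (4 * k) 4 u v := by
  set S₁ := S.filter (fun v => q ≤ (S.filter (G.Adj v)).card) with hS₁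
  set Q := S₁.filter (fun v => q ≤ ((outNbr G x).filter (fun z => G.Adj z v)).card) with hQ
  set B := S₁.filter (fun v => ¬ q ≤ ((outNbr G x).filter (fun z => G.Adj z v)).card) with hB
  have hBS : B ⊆ S := (Finset.filter_subset _ _).trans (Finset.filter_subset _ _)
  have htot : ∀ u ∈ S, ∀ v ∈ S, u ≠ v → G.Adj v u ∨ G.Adj u v := fun u _ v _ huv =>
    (hG.2 u v huv).symm
  refine ⟨Q, ?_, ?_⟩
  · have h1 : S₁.card + _ = S.card := Finset.card_filter_add_card_filter_not _
    have h2 : Q.card + B.card = S₁.card := Finset.card_filter_add_card_filter_not _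
    have h3 := Finset.card_filter_add_card_filter_not (s := B) (fun v => v ∈ outNbr G x)
    have e1 : (S.filter (fun v => ¬ q ≤ (S.filter (G.Adj v)).card)).card ≤ 2 * (q - 1) + 1 := by
      refine card_le_of_indegree_le (r := fun u v => G.Adj v u)
        (fun u hu v hv => htot u (Finset.mem_filter.1 hu).1 v (Finset.mem_filter.1 hv).1) ?_
      intro v hv
      have h4 := (Finset.mem_filter.1 hv).2
      have h5 : ((S.filter (fun v => ¬ q ≤ (S.filter (G.Adj v)).card)).filter
          (fun u => G.Adj v u)).card ≤ (S.filter (G.Adj v)).card :=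
        Finset.card_le_card (Finset.filter_subset_filter _ (Finset.filter_subset _ _))
      omega
    have e2 : (B.filter (fun v => v ∈ outNbr G x)).card ≤ 2 * (q - 1) + 1 := by
      refine card_le_of_indegree_le (r := G.Adj) (fun u _ v _ huv => hG.2 u v huv) ?_
      intro v hv
      have h4 := (Finset.mem_filter.1 (Finset.mem_filter.1 hv).1).2
      have h5 : ((B.filter (fun v => v ∈ outNbr G x)).filter (fun u => G.Adj u v)).card ≤
          ((outNbr G x).filter (fun z => G.Adj z v)).card := by
        refine Finset.card_le_card (Finset.filter_subset_filter _ ?_)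
        intro z hz
        exact (Finset.mem_filter.1 hz).2
      omega
    have e3 : (B.filter (fun v => ¬ v ∈ outNbr G x)).card ≤ 2 * q + 1 := by
      refine card_le_of_indegree_le (r := fun u v => G.Adj v u)
        (fun u hu v hv => htot u (hBS (Finset.mem_filter.1 hu).1) v
          (hBS (Finset.mem_filter.1 hv).1)) ?_
      intro v hv
      have h4 := (Finset.mem_filter.1 (Finset.mem_filter.1 hv).1).2
      have h5 := card_outNbr_sdiff_le hG (not_le.1 h4)
      have h6 := Finset.card_sdiff_le_card_sdiff_iff.2 (hdeg v (hBS (Finset.mem_filter.1 hv).1))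
      refine (Finset.card_le_card ?_).trans (h6.trans h5)
      intro z hz
      simp only [Finset.mem_filter] at hz
      simp only [Finset.mem_sdiff, mem_outNbr] at hz ⊢
      exact ⟨hz.2, hz.1.2⟩
    omega
  · intro u hu v hv _
    have hu1 := (Finset.mem_filter.1 (Finset.mem_filter.1 hu).1).2
    have hv1 := (Finset.mem_filter.1 hv).2
    refine (Linked.trans (linked_of_middle (N := 4 * k) (a := u) (b := x)
      (Z := S.filter (G.Adj u)) (by omega) ?_ ?_)
      (linked_of_middle (Z := (outNbr G x).filter (fun z => G.Adj z v)) (by omega) ?_ ?_)).mono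
      le_rfl
    · intro z hz
      exact (Finset.mem_filter.1 hz).2
    · intro z hz
      exact hS z (Finset.mem_filter.1 hz).1
    · intro z hz
      exact mem_outNbr.1 (Finset.mem_filter.1 hz).1
    · intro z hz
      exact (Finset.mem_filter.1 hz).2

/-- The vertices are heads of matching arcs. From `u` one goes to the tail of a matching arc whose
head sends an arc to `v`. The arc from `u` to that tail is present unless there is a backward arc
from the tail to `u`, which happens at most `s` times. -/
theorem linked_matching {k q s : ℕ} (hG : IsSemicomplete G) (hq : 12 * k < q) {X : Finset V}
    {E M : Finset (V × V)} (hE : ∀ e, e ∈ E ↔ e.1 ∉ X ∧ e.2 ∈ X ∧ G.Adj e.1 e.2)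
    (hs : ∀ x, (E.filter (fun e => e.2 = x)).card ≤ s) (hM : M ⊆ E)
    (i₁ : Set.InjOn Prod.fst (M : Set (V × V))) (i₂ : Set.InjOn Prod.snd (M : Set (V × V)))
    (hcard : 2 * (s + q) + k ≤ M.card) :
    ∃ Q : Finset V, k ≤ Q.card ∧ ∀ u ∈ Q, ∀ v ∈ Q, u ≠ v → Linked G (4 * k) 4 u v := by
  set A := M.image Prod.snd with hA
  have hAc : A.card = M.card := Finset.card_image_of_injOn i₂
  refine ⟨A.filter (fun v => s + q ≤ (A.filter (fun u => G.Adj u v)).card), ?_, ?_⟩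
  · have h1 := Finset.card_filter_add_card_filter_not (s := A)
      (fun v => s + q ≤ (A.filter (fun u => G.Adj u v)).card)
    have h2 : (A.filter (fun v => ¬ s + q ≤ (A.filter (fun u => G.Adj u v)).card)).card ≤
        2 * (s + q - 1) + 1 := by
      refine card_le_of_indegree_le (r := G.Adj) (fun u _ v _ huv => hG.2 u v huv) ?_
      intro v hv
      have h3 := (Finset.mem_filter.1 hv).2
      have h4 : ((A.filter (fun v => ¬ s + q ≤ (A.filter (fun u => G.Adj u v)).card)).filter
          (fun u => G.Adj u v)).card ≤ (A.filter (fun u => G.Adj u v)).card :=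
        Finset.card_le_card (Finset.filter_subset_filter _ (Finset.filter_subset _ _))
      omega
    omega
  · intro u hu v hv _
    have huX : u ∈ X := by
      obtain ⟨e, he, rfl⟩ := Finset.mem_image.1 (Finset.mem_filter.1 hu).1
      exact ((hE e).1 (hM he)).2.1
    have hv1 := (Finset.mem_filter.1 hv).2
    set Z₀ := M.filter (fun e => G.Adj e.2 v) with hZ₀
    have h1 : s + q ≤ Z₀.card := by
      refine hv1.trans ?_
      have : A.filter (fun u => G.Adj u v) ⊆ Z₀.image Prod.snd := by
        intro z hz
        rw [Finset.mem_filter] at hz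
        obtain ⟨e, he, rfl⟩ := Finset.mem_image.1 hz.1
        exact Finset.mem_image_of_mem _ (Finset.mem_filter.2 ⟨he, hz.2⟩)
      exact (Finset.card_le_card this).trans Finset.card_image_le
    have h2 := Finset.card_filter_add_card_filter_not (s := Z₀) (fun e => G.Adj u e.1)
    have h3 : (Z₀.filter (fun e => ¬ G.Adj u e.1)).card ≤ s := by
      refine (Finset.card_le_card_of_injOn (fun e => (e.1, u)) ?_ ?_).trans (hs u)
      · intro e he
        have he' := Finset.mem_filter.1 he
        have heX := (hE e).1 (hM (Finset.mem_filter.1 he'.1).1)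
        have hne : u ≠ e.1 := fun h => heX.1 (h ▸ huX)
        rw [Finset.mem_coe, Finset.mem_filter, hE]
        exact ⟨⟨heX.1, huX, (hG.2 _ _ hne).resolve_left he'.2⟩, rfl⟩
      · intro e he e' he' hee
        have he₁ := (Finset.mem_filter.1 (Finset.mem_filter.1 he).1).1
        have he₂ := (Finset.mem_filter.1 (Finset.mem_filter.1 he').1).1
        exact i₁ he₁ he₂ (Prod.ext_iff.1 hee).1
    have hZM : ((Z₀.filter (fun e => G.Adj u e.1) : Finset (V × V)) : Set (V × V)) ⊆ M := by
      intro e he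
      exact (Finset.mem_filter.1 (Finset.mem_filter.1 he).1).1
    refine (linked_of_middle_arcs (N := 4 * k) (Z := Z₀.filter (fun e => G.Adj u e.1)) (by omega)
      (i₁.mono hZM) (i₂.mono hZM) ?_ ?_ ?_).mono (by omega)
    · intro z hz
      exact (Finset.mem_filter.1 hz).2
    · intro z hz
      exact ((hE z).1 (hM (hZM hz))).2.2
    · intro z hz
      exact (Finset.mem_filter.1 (Finset.mem_filter.1 hz).1).2

/-- If a cut of a semi-complete digraph, with all outdegrees on the first side at least those on the
second side, has many backward arcs, then all small digraphs immerse. -/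
theorem immersesInto_of_backward_arcs {U : Type*} [Finite U] {H : Digraph U} {k : ℕ}
    (hG : IsSemicomplete G) (hH : IsSimple H) (hk : size H ≤ k) (X : Finset V)
    (hX : ∀ x ∈ X, ∀ y ∉ X, (outNbr G y).card ≤ (outNbr G x).card)
    (hE : 40000 * k * k < (Finset.univ.filter
      (fun e : V × V => e.1 ∉ X ∧ e.2 ∈ X ∧ G.Adj e.1 e.2)).card) : ImmersesInto H G := by
  set E := Finset.univ.filter (fun e : V × V => e.1 ∉ X ∧ e.2 ∈ X ∧ G.Adj e.1 e.2) with hEdef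
  have hmem : ∀ e, e ∈ E ↔ e.1 ∉ X ∧ e.2 ∈ X ∧ G.Adj e.1 e.2 := by simp [hEdef]
  have hUk : Nat.card U ≤ k := by unfold size at hk; omega
  -- The case `k = 0` is separate because `q = 13 * k` has to exceed `12 * k`.
  rcases Nat.eq_zero_or_pos k with rfl | hk0
  · exact immersesInto_of_linked hH hk ∅ (by simpa using hUk) (by simp)
  suffices h : ∃ Q : Finset V, k ≤ Q.card ∧
      ∀ u ∈ Q, ∀ v ∈ Q, u ≠ v → Linked G (4 * k) 4 u v by
    obtain ⟨Q, h1, h2⟩ := h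
    exact immersesInto_of_linked hH hk Q (hUk.trans h1) h2
  -- With `q = 13 * k` the stars need `4 * q + k = 53 * k` and `6 * q + 2 + k = 79 * k + 2` arcs, so
  -- more than `82 * k` suffice in both cases.
  by_cases h1 : ∃ y, 82 * k < (E.filter (fun e => e.1 = y)).card
  · obtain ⟨y, hy⟩ := h1
    have hS : ∀ v ∈ (E.filter (fun e => e.1 = y)).image Prod.snd, y ∉ X ∧ v ∈ X ∧ G.Adj y v := by
      intro v hv
      obtain ⟨e, he, rfl⟩ := Finset.mem_image.1 hv
      rw [Finset.mem_filter] at he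
      obtain ⟨he, rfl⟩ := he
      exact (hmem e).1 he
    have hc : ((E.filter (fun e => e.1 = y)).image Prod.snd).card =
        (E.filter (fun e => e.1 = y)).card := by
      refine Finset.card_image_of_injOn ?_
      intro e he e' he' hee
      exact Prod.ext ((Finset.mem_filter.1 he).2.trans (Finset.mem_filter.1 he').2.symm) hee
    generalize (E.filter (fun e => e.1 = y)).image Prod.snd = S at hS hc
    exact linked_outStar (q := 13 * k) hG (by omega) (fun v hv => (hS v hv).2.2)
      (fun v hv => hX v (hS v hv).2.1 y (hS v hv).1) (by omega)
  by_cases h2 : ∃ x, 82 * k < (E.filter (fun e => e.2 = x)).card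
  · obtain ⟨x, hx⟩ := h2
    have hS : ∀ v ∈ (E.filter (fun e => e.2 = x)).image Prod.fst, v ∉ X ∧ x ∈ X ∧ G.Adj v x := by
      intro v hv
      obtain ⟨e, he, rfl⟩ := Finset.mem_image.1 hv
      rw [Finset.mem_filter] at he
      obtain ⟨he, rfl⟩ := he
      exact (hmem e).1 he
    have hc : ((E.filter (fun e => e.2 = x)).image Prod.fst).card =
        (E.filter (fun e => e.2 = x)).card := by
      refine Finset.card_image_of_injOn ?_
      intro e he e' he' hee
      exact Prod.ext hee ((Finset.mem_filter.1 he).2.trans (Finset.mem_filter.1 he').2.symm)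
    generalize (E.filter (fun e => e.2 = x)).image Prod.fst = S at hS hc
    exact linked_inStar (q := 13 * k) hG (by omega) (fun v hv => (hS v hv).2.2)
      (fun v hv => hX x (hS v hv).2.1 v (hS v hv).1) (by omega)
  push Not at h1 h2
  -- No vertex has more than `s = 82 * k` of the arcs at either side, and a matching of `2 * (s + q)
  -- + k = 191 * k` arcs is needed.
  have harith : 2 * (191 * k) * (82 * k) ≤ 40000 * k * k := by
    rw [mul_assoc 40000, show 2 * (191 * k) * (82 * k) = 31324 * (k * k) by ring]
    exact Nat.mul_le_mul_right _ (by norm_num)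
  obtain ⟨M, hM, hMc, i₁, i₂⟩ := exists_matching h1 h2 (191 * k)
    (lt_of_le_of_lt harith hE)
  exact linked_matching hG (q := 13 * k) (by omega) hmem h2 hM i₁ i₂ (by omega)

end Structure

end DigraphImmersion

namespace DigraphImmersion

/-! ### Immersions as labelled flows -/

section PathCount

variable {V : Type*}

theorem map_fst_pathArcs (l : List V) : (pathArcs l).map Prod.fst = l.dropLast := by
  induction l with
  | nil => rfl
  | cons a l ih =>
    cases l with
    | nil => rfl
    | cons b l => simpa [pathArcs] using ih

theorem map_snd_pathArcs (l : List V) : (pathArcs l).map Prod.snd = l.tail := by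
  induction l with
  | nil => rfl
  | cons a l ih =>
    cases l with
    | nil => rfl
    | cons b l => simpa [pathArcs] using ih

variable [DecidableEq V] [Fintype V]

theorem card_filter_mem_snd {P : List (V × V)} (hP : P.Nodup) (x : V) :
    (Finset.univ.filter (fun c => (c, x) ∈ P)).card = (P.map Prod.snd).count x := by
  induction P with
  | nil => simp
  | cons p P ih =>
    obtain ⟨a, b⟩ := p
    rw [List.nodup_cons] at hP
    have ih := ih hP.2
    by_cases hb : b = x
    · subst hb
      have : Finset.univ.filter (fun c => (c, b) ∈ (a, b) :: P) =
          insert a (Finset.univ.filter (fun c => (c, b) ∈ P)) := by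
        ext c; simp
      rw [this, Finset.card_insert_of_notMem (by simpa using hP.1), ih]
      simp
    · have : Finset.univ.filter (fun c => (c, x) ∈ (a, b) :: P) =
          Finset.univ.filter (fun c => (c, x) ∈ P) := by
        ext c; simp [Ne.symm hb]
      rw [this, ih]
      simp [hb]

theorem card_filter_mem_fst {P : List (V × V)} (hP : P.Nodup) (x : V) :
    (Finset.univ.filter (fun c => (x, c) ∈ P)).card = (P.map Prod.fst).count x := by
  have h := card_filter_mem_snd (hP.map Prod.swap_injective) x
  rw [List.map_map] at h
  rw [show (Prod.fst : V × V → V) = Prod.snd ∘ Prod.swap from rfl, ← h]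
  congr 1
  ext c
  simp

/-- The heads of the arcs are the vertices except the first one, the tails those except the last
one; both lists are compared with the whole path. -/
theorem pathArcs_balance {l : List V} (hl : l.Nodup) {s t : V} (hs : l.head? = some s)
    (ht : l.getLast? = some t) (x : V) :
    (Finset.univ.filter (fun c => (c, x) ∈ pathArcs l)).card + (if s = x then 1 else 0) =
      (Finset.univ.filter (fun c => (x, c) ∈ pathArcs l)).card + (if t = x then 1 else 0) := by
  have hP : (pathArcs l).Nodup := by
    refine List.Nodup.of_map Prod.fst ?_
    rw [map_fst_pathArcs]
    exact hl.sublist (List.dropLast_sublist l)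
  rw [card_filter_mem_snd hP, card_filter_mem_fst hP, map_fst_pathArcs, map_snd_pathArcs]
  have h1 : l.count x = l.tail.count x + if s = x then 1 else 0 := by
    cases l with
    | nil => simp at hs
    | cons a l =>
      obtain rfl : a = s := by simpa using hs
      simp [List.count_cons]
  have h2 : l.count x = l.dropLast.count x + if t = x then 1 else 0 := by
    obtain ⟨l', rfl⟩ := List.getLast?_eq_some_iff.1 ht
    simp [List.count_append, List.count_singleton]
  omega

end PathCount

/-- A placement `φ` of the vertices and a labelling `lam` of the arcs of a digraph `A` on
`{0, …, n - 1}`, such that for each label `l` of an arc of `R`, the arcs with that label are a unit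
flow from `φ (l / h)` to `φ (l % h)`.  The value `0` of `lam` means that the arc is unused, the
value `l + 1` that it has label `l`. -/
structure IsFlow (n h : ℕ) (A : ℕ → ℕ → Prop) (R : ℕ → Prop) (φ : ℕ → ℕ) (lam : ℕ → ℕ → ℕ) :
    Prop where
  lt : ∀ u < h, φ u < n
  inj : ∀ u < h, ∀ v < h, φ u = φ v → u = v
  arc : ∀ a b, lam a b ≠ 0 → A a b ∧ ∃ l < h * h, R l ∧ lam a b = l + 1
  balance : ∀ x < n, ∀ l < h * h, R l →
    ((Finset.range n).filter (fun a => lam a x = l + 1)).card + (if φ (l / h) = x then 1 else 0) =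
    ((Finset.range n).filter (fun b => lam x b = l + 1)).card + (if φ (l % h) = x then 1 else 0)

/-- The digraph `T` on natural numbers, after renaming the vertices by `σ`. -/
def natAdj {n : ℕ} (T : Digraph (Fin n)) (σ : Fin n ≃ Fin n) (i j : ℕ) : Prop :=
  ∃ (hi : i < n) (hj : j < n), T.Adj (σ ⟨i, hi⟩) (σ ⟨j, hj⟩)

/-- The set of codes `u * h + v` of arcs `(u, v)` of `H`. -/
def arcCode {h : ℕ} (H : Digraph (Fin h)) (l : ℕ) : Prop :=
  ∃ u v : Fin h, H.Adj u v ∧ l = (u : ℕ) * h + (v : ℕ)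

theorem code_div {h : ℕ} (u v : Fin h) : ((u : ℕ) * h + v) / h = u := by
  rw [Nat.mul_comm, Nat.mul_add_div (u.pos), Nat.div_eq_of_lt v.2, add_zero]

theorem code_mod {h : ℕ} (u v : Fin h) : ((u : ℕ) * h + v) % h = v := by
  rw [Nat.mul_comm, Nat.mul_add_mod, Nat.mod_eq_of_lt v.2]

theorem code_lt {h : ℕ} (u v : Fin h) : (u : ℕ) * h + v < h * h := by
  have hu := u.2
  have hv := v.2
  nlinarith

theorem code_inj {h : ℕ} {u v u' v' : Fin h} (he : (u : ℕ) * h + v = (u' : ℕ) * h + v') :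
    u = u' ∧ v = v' :=
  ⟨Fin.ext (by rw [← code_div u v, he, code_div]), Fin.ext (by rw [← code_mod u v, he, code_mod])⟩

/-- Sum the balance over the set `Q` reachable from the source by arcs of this label. No such arc
leaves `Q`, so at least as many end in `Q` as start there; if the target were outside `Q`, the
source would contribute an excess of one on the entering side, a contradiction. -/
theorem IsFlow.reflTransGen {n h : ℕ} {A : ℕ → ℕ → Prop} {R : ℕ → Prop} {φ : ℕ → ℕ}
    {lam : ℕ → ℕ → ℕ} (hF : IsFlow n h A R φ lam) {l : ℕ}
    (hl : l < h * h) (hR : R l) :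
    Relation.ReflTransGen (fun a b => lam a b = l + 1) (φ (l / h)) (φ (l % h)) := by
  classical
  have hh : 0 < h := by
    rcases Nat.eq_zero_or_pos h with rfl | h0
    · simp at hl
    · exact h0
  by_contra hcon
  set s := φ (l / h)
  set t := φ (l % h)
  set Q := (Finset.range n).filter (fun x => Relation.ReflTransGen (fun a b => lam a b = l + 1) s x)
    with hQ
  have hs : s ∈ Q := Finset.mem_filter.2
    ⟨Finset.mem_range.2 (hF.lt _ (Nat.div_lt_of_lt_mul hl)), Relation.ReflTransGen.refl⟩
  have ht : t ∉ Q := fun h => hcon (Finset.mem_filter.1 h).2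
  have h1 : ∑ x ∈ Q, (((Finset.range n).filter (fun a => lam a x = l + 1)).card +
      (if s = x then 1 else 0)) = ∑ x ∈ Q, (((Finset.range n).filter
      (fun b => lam x b = l + 1)).card + (if t = x then 1 else 0)) := by
    refine Finset.sum_congr rfl fun x hx => ?_
    exact hF.balance x (Finset.mem_range.1 (Finset.mem_filter.1 hx).1) l hl hR
  simp only [Finset.sum_add_distrib, Finset.sum_ite_eq, hs, ht, if_true, if_false] at h1
  have h2 : ∑ x ∈ Q, ((Finset.range n).filter (fun b => lam x b = l + 1)).card =
      ∑ x ∈ Q, (Q.filter (fun b => lam x b = l + 1)).card := by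
    refine Finset.sum_congr rfl fun x hx => congrArg _ ?_
    ext b
    simp only [Finset.mem_filter, hQ]
    constructor
    · rintro ⟨hb, hxb⟩
      exact ⟨⟨hb, (Finset.mem_filter.1 hx).2.tail hxb⟩, hxb⟩
    · rintro ⟨⟨hb, _⟩, hxb⟩
      exact ⟨hb, hxb⟩
  have h3 : ∑ x ∈ Q, (Q.filter (fun b => lam x b = l + 1)).card =
      ∑ x ∈ Q, (Q.filter (fun a => lam a x = l + 1)).card := by
    simp only [Finset.card_filter]
    exact Finset.sum_comm
  have h4 : ∑ x ∈ Q, (Q.filter (fun a => lam a x = l + 1)).card ≤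
      ∑ x ∈ Q, ((Finset.range n).filter (fun a => lam a x = l + 1)).card :=
    Finset.sum_le_sum fun x _ => Finset.card_le_card
      (Finset.filter_subset_filter _ (Finset.filter_subset _ _))
  omega

/-- The label classes are disjoint arc sets, and each contains a connection by
`IsFlow.reflTransGen`; cycles of the flow are never looked at. -/
theorem immersesInto_of_isFlow {n h : ℕ} {T : Digraph (Fin n)} {H : Digraph (Fin h)}
    {σ : Fin n ≃ Fin n} {φ : ℕ → ℕ} {lam : ℕ → ℕ → ℕ}
    (hF : IsFlow n h (natAdj T σ) (arcCode H) φ lam) : ImmersesInto H T := by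
  have hA : ∀ a b, natAdj T σ a b → a < n ∧ b < n := fun a b ⟨ha, hb, _⟩ => ⟨ha, hb⟩
  refine immersesInto_of_arcSets (fun u => σ ⟨φ u, hF.lt u u.2⟩) ?_
    (fun e => {p | lam (σ.symm p.1) (σ.symm p.2) = (e.1.1 : ℕ) * h + e.1.2 + 1}) ?_ ?_ ?_
  · intro u v huv
    have := σ.injective huv
    exact Fin.ext (hF.inj u u.2 v v.2 (Fin.mk.inj_iff.1 this))
  · intro e p hp
    have hp' : lam (σ.symm p.1) (σ.symm p.2) = (e.1.1 : ℕ) * h + e.1.2 + 1 := hp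
    obtain ⟨⟨_, _, hadj⟩, _⟩ := hF.arc (σ.symm p.1) (σ.symm p.2) (by omega)
    simpa using hadj
  · intro e e' hee
    rw [Set.disjoint_left]
    intro p hp hp'
    have h1 : lam (σ.symm p.1) (σ.symm p.2) = (e.1.1 : ℕ) * h + e.1.2 + 1 := hp
    have h2 : lam (σ.symm p.1) (σ.symm p.2) = (e'.1.1 : ℕ) * h + e'.1.2 + 1 := hp'
    have h3 := code_inj (u := e.1.1) (v := e.1.2) (u' := e'.1.1) (v' := e'.1.2) (by omega)
    exact hee (Subtype.ext (Prod.ext h3.1 h3.2))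
  · intro e
    have h1 := hF.reflTransGen (code_lt e.1.1 e.1.2) ⟨e.1.1, e.1.2, e.2, rfl⟩
    rw [code_div, code_mod] at h1
    have key : ∀ x y : ℕ, Relation.ReflTransGen
        (fun a b => lam a b = (e.1.1 : ℕ) * h + e.1.2 + 1) x y → ∀ (hx : x < n) (hy : y < n),
        Relation.ReflTransGen (fun a b => lam (σ.symm a) (σ.symm b) =
          (e.1.1 : ℕ) * h + e.1.2 + 1) (σ ⟨x, hx⟩) (σ ⟨y, hy⟩) := by
      intro x y hxy
      induction hxy with
      | refl => intro _ _; exact Relation.ReflTransGen.refl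
      | tail _ hbc ih =>
        intro hx hy
        rename_i b c _
        have hb := (hA _ _ (hF.arc b c (by omega)).1).1
        exact (ih hx hb).tail (by simpa using hbc)
    exact key _ _ h1 _ _

/-- Each arc gets the code of the arc of `H` whose path uses it; arc-disjointness makes this well
defined. -/
theorem exists_isFlow {n h : ℕ} {T : Digraph (Fin n)} {H : Digraph (Fin h)}
    (σ : Fin n ≃ Fin n) (hI : ImmersesInto H T) :
    ∃ φ lam, IsFlow n h (natAdj T σ) (arcCode H) φ lam := by
  classical
  obtain ⟨I⟩ := hI
  let φ : ℕ → ℕ := fun u => if hu : u < h then σ.symm (I.onVert ⟨u, hu⟩) else 0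
  have hφ : ∀ u : Fin h, φ u = σ.symm (I.onVert u) := fun u => by simp [φ]
  let P : ℕ → ℕ → ℕ → Prop := fun a b l => ∃ (e : {e : Fin h × Fin h // H.Adj e.1 e.2})
    (ha : a < n) (hb : b < n), (σ ⟨a, ha⟩, σ ⟨b, hb⟩) ∈ pathArcs (I.onArc e) ∧
      l = (e.1.1 : ℕ) * h + e.1.2
  have hPuniq : ∀ a b l l', P a b l → P a b l' → l = l' := by
    rintro a b l l' ⟨e, ha, hb, he, rfl⟩ ⟨e', _, _, he', rfl⟩
    by_cases hee : e = e'
    · rw [hee]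
    · exact absurd he' (I.arcDisjoint e e' hee he)
  let lam : ℕ → ℕ → ℕ := fun a b => if hab : ∃ l, P a b l then hab.choose + 1 else 0
  have hlam : ∀ a b l, lam a b = l + 1 ↔ P a b l := by
    intro a b l
    by_cases hab : ∃ l, P a b l
    · have h1 : lam a b = hab.choose + 1 := by simp only [lam, dif_pos hab]
      rw [h1]
      constructor
      · intro h2
        obtain rfl : hab.choose = l := by omega
        exact hab.choose_spec
      · intro h2
        rw [hPuniq _ _ _ _ h2 hab.choose_spec]
    · have h1 : lam a b = 0 := by simp only [lam, dif_neg hab]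
      rw [h1]
      constructor
      · intro h2; omega
      · intro h2; exact absurd ⟨l, h2⟩ hab
  refine ⟨φ, lam, ?_, ?_, ?_, ?_⟩
  · intro u hu
    rw [hφ ⟨u, hu⟩]
    exact (σ.symm _).2
  · intro u hu v hv huv
    rw [hφ ⟨u, hu⟩, hφ ⟨v, hv⟩] at huv
    have := I.injective (σ.symm.injective (Fin.ext huv))
    exact Fin.mk.inj_iff.1 this
  · intro a b hab
    obtain ⟨l, hl⟩ := Nat.exists_eq_succ_of_ne_zero hab
    have hP := (hlam a b l).1 hl
    obtain ⟨e, ha, hb, he, rfl⟩ := hP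
    exact ⟨⟨ha, hb, of_mem_pathArcs (I.isDiPath e).1 _ he⟩, _, code_lt _ _,
      ⟨e.1.1, e.1.2, e.2, rfl⟩, hl⟩
  · rintro x hx _ - ⟨u, v, huv, rfl⟩
    rw [code_div, code_mod, hφ, hφ]
    set e : {e : Fin h × Fin h // H.Adj e.1 e.2} := ⟨(u, v), huv⟩ with he
    have hp := I.isDiPath e
    have hbal := pathArcs_balance hp.2.1 hp.2.2.1 hp.2.2.2 (σ ⟨x, hx⟩)
    have hPe : ∀ a b, P a b ((u : ℕ) * h + v) ↔ ∃ (ha : a < n) (hb : b < n),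
        (σ ⟨a, ha⟩, σ ⟨b, hb⟩) ∈ pathArcs (I.onArc e) := by
      intro a b
      constructor
      · rintro ⟨e', ha, hb, h1, h2⟩
        obtain ⟨h3, h4⟩ := code_inj h2
        have : e' = e := Subtype.ext (Prod.ext h3.symm h4.symm)
        subst this
        exact ⟨ha, hb, h1⟩
      · rintro ⟨ha, hb, h1⟩
        exact ⟨e, ha, hb, h1, rfl⟩
    have e1 : ((Finset.range n).filter (fun a => lam a x = (u : ℕ) * h + v + 1)).card =
        (Finset.univ.filter (fun c => (c, σ ⟨x, hx⟩) ∈ pathArcs (I.onArc e))).card := by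
      refine (Finset.card_bij' (fun c _ => (σ.symm c : ℕ))
        (fun a ha => σ ⟨a, Finset.mem_range.1 (Finset.mem_filter.1 ha).1⟩) ?_ ?_ ?_ ?_).symm
      · intro c hc
        rw [Finset.mem_filter] at hc ⊢
        refine ⟨Finset.mem_range.2 (σ.symm c).2, (hlam _ _ _).2 ((hPe _ _).2
          ⟨(σ.symm c).2, hx, by simpa using hc.2⟩)⟩
      · intro a ha
        rw [Finset.mem_filter] at ha ⊢
        obtain ⟨_, _, h3⟩ := (hPe _ _).1 ((hlam _ _ _).1 ha.2)
        exact ⟨Finset.mem_univ _, h3⟩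
      · intro c _; simp
      · intro a _; simp
    have e2 : ((Finset.range n).filter (fun a => lam x a = (u : ℕ) * h + v + 1)).card =
        (Finset.univ.filter (fun c => (σ ⟨x, hx⟩, c) ∈ pathArcs (I.onArc e))).card := by
      refine (Finset.card_bij' (fun c _ => (σ.symm c : ℕ))
        (fun a ha => σ ⟨a, Finset.mem_range.1 (Finset.mem_filter.1 ha).1⟩) ?_ ?_ ?_ ?_).symm
      · intro c hc
        rw [Finset.mem_filter] at hc ⊢
        refine ⟨Finset.mem_range.2 (σ.symm c).2, (hlam _ _ _).2 ((hPe _ _).2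
          ⟨hx, (σ.symm c).2, by simpa using hc.2⟩)⟩
      · intro a ha
        rw [Finset.mem_filter] at ha ⊢
        obtain ⟨_, _, h3⟩ := (hPe _ _).1 ((hlam _ _ _).1 ha.2)
        exact ⟨Finset.mem_univ _, h3⟩
      · intro c _; simp
      · intro a _; simp
    have e3 : ∀ y : Fin n, ((σ.symm y : ℕ) = x) ↔ y = σ ⟨x, hx⟩ := by
      intro y
      rw [← Equiv.symm_apply_eq, Fin.ext_iff]
    rw [e1, e2]
    simp only [e3]
    exact hbal

end DigraphImmersion

namespace DigraphImmersion

/-! ### Sweeping over the vertices -/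

/-- A bijection given as a relation, used for matching arcs at a vertex with slots that change
there. -/
theorem card_eq_of_rel {α β : Type*} {S : Finset α} {T : Finset β} (r : α → β → Prop)
    (h1 : ∀ a ∈ S, ∃ b ∈ T, r a b) (h2 : ∀ b ∈ T, ∃ a ∈ S, r a b)
    (u1 : ∀ a ∈ S, ∀ b b', r a b → r a b' → b = b')
    (u2 : ∀ a ∈ S, ∀ a' ∈ S, ∀ b, r a b → r a' b → a = a') : S.card = T.card := by
  choose f hf using h1
  refine Finset.card_bij f (fun a ha => (hf a ha).1) ?_ ?_
  · intro a ha a' ha' h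
    exact u2 a ha a' ha' (f a ha) (hf a ha).2 (h ▸ (hf a' ha').2)
  · intro b hb
    obtain ⟨a, ha, hab⟩ := h2 b hb
    exact ⟨a, ha, u1 a ha _ _ (hf a ha).2 hab⟩

/-- The information about a flow at a cut of the linear order of the vertices.  `pl u` tells whether
the vertex `u` of `H` has been placed before the cut.  There are slots for the used arcs which cross
the cut: `kd t` is `0` if slot `t` is empty, `1` for a forward and `2` for a backward arc; `lb t` is
the label of the arc, and `nm t` a name of its tail. -/
@[ext]
structure SweepState where
  pl : ℕ → ℕ
  kd : ℕ → ℕ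
  lb : ℕ → ℕ
  nm : ℕ → ℕ

/-- The data of the sweep: the numbers of vertices of both digraphs, of slots, and of names for
special vertices; the arcs of both digraphs; and the special vertex with a given name at a given
cut. -/
structure SweepData where
  n : ℕ
  h : ℕ
  K : ℕ
  M : ℕ
  A : ℕ → ℕ → Prop
  R : ℕ → Prop
  SP : ℕ → ℕ → ℕ

namespace SweepData

variable (D : SweepData)

/-- No backward arc enters `v` from the vertices from `i` on. -/
def Generic (i v : ℕ) : Prop := ∀ b, i ≤ b → ¬ D.A b v

/-- What may happen to slot `t` when the sweep passes the vertex `x`. -/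
def SlotStep (x : ℕ) (c c' : SweepState) (t : ℕ) : Prop :=
  (c.kd t = 0 ∧ c'.kd t = 0) ∨
  (c.kd t = 1 ∧ c'.kd t = 1 ∧ c'.lb t = c.lb t ∧
    ((c.nm t < D.M ∧ c'.nm t < D.M ∧ D.SP x (c.nm t) = D.SP (x + 1) (c'.nm t)) ∨
     (c.nm t < D.M ∧ D.M ≤ c'.nm t ∧ D.Generic (x + 1) (D.SP x (c.nm t))) ∨
     (D.M ≤ c.nm t ∧ D.M ≤ c'.nm t))) ∨
  (c.kd t = 2 ∧ c'.kd t = 2 ∧ c'.lb t = c.lb t ∧ D.SP x (c.nm t) = D.SP (x + 1) (c'.nm t) ∧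
    D.SP x (c.nm t) ≠ x) ∨
  (c.kd t = 1 ∧ c'.kd t = 0 ∧ (D.M ≤ c.nm t ∨ D.A (D.SP x (c.nm t)) x)) ∨
  (c.kd t = 2 ∧ c'.kd t = 0 ∧ D.SP x (c.nm t) = x) ∨
  (c.kd t = 0 ∧ c'.kd t = 1 ∧ c'.lb t < D.h * D.h ∧ D.R (c'.lb t) ∧
    ((c'.nm t < D.M ∧ D.SP (x + 1) (c'.nm t) = x) ∨ (D.M ≤ c'.nm t ∧ D.Generic (x + 1) x))) ∨
  (c.kd t = 0 ∧ c'.kd t = 2 ∧ c'.lb t < D.h * D.h ∧ D.R (c'.lb t) ∧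
    D.A (D.SP (x + 1) (c'.nm t)) x ∧ x < D.SP (x + 1) (c'.nm t))

/-- Slots `t` and `t'` are treated consistently when the sweep passes the vertex `x`. -/
def PairStep (x : ℕ) (c c' : SweepState) (t t' : ℕ) : Prop :=
  (c'.kd t = 1 → c'.kd t' = 1 → (c'.nm t = c'.nm t' ↔
    (c.kd t = 1 ∧ c.kd t' = 1 ∧ c.nm t = c.nm t') ∨ (c.kd t = 0 ∧ c.kd t' = 0))) ∧
  (t ≠ t' → c.kd t = 1 → c'.kd t = 0 → c.kd t' = 1 → c'.kd t' = 0 → c.nm t ≠ c.nm t') ∧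
  (t ≠ t' → c.kd t = 0 → c'.kd t = 2 → c.kd t' = 0 → c'.kd t' = 2 →
    D.SP (x + 1) (c'.nm t) ≠ D.SP (x + 1) (c'.nm t'))

/-- The number of slots which change from kind `k` to kind `k'` and, when filled, have label `l`. -/
def changes (c c' : SweepState) (k k' : ℕ) (lb : ℕ → ℕ) (l : ℕ) : ℕ :=
  ((Finset.range D.K).filter (fun t => c.kd t = k ∧ c'.kd t = k' ∧ lb t = l)).card

/-- The sweep may pass the vertex `x` with state `c` before and state `c'` after it. -/
structure Step (x : ℕ) (c c' : SweepState) : Prop where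
  pl_le : ∀ u < D.h, c.pl u ≤ c'.pl u ∧ c'.pl u ≤ 1
  pl_card : ((Finset.range D.h).filter (fun u => c.pl u ≠ c'.pl u)).card ≤ 1
  slot : ∀ t < D.K, D.SlotStep x c c' t
  pair : ∀ t < D.K, ∀ t' < D.K, D.PairStep x c c' t t'
  balance : ∀ l < D.h * D.h, D.R l →
    D.changes c c' 1 0 c.lb l + D.changes c c' 0 2 c'.lb l +
      (if c.pl (l / D.h) ≠ c'.pl (l / D.h) then 1 else 0) =
    D.changes c c' 2 0 c.lb l + D.changes c c' 0 1 c'.lb l +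
      (if c.pl (l % D.h) ≠ c'.pl (l % D.h) then 1 else 0)

/-- A complete sweep. -/
structure Sweep (s : ℕ → SweepState) : Prop where
  pl_zero : ∀ u < D.h, (s 0).pl u = 0
  kd_zero : ∀ t < D.K, (s 0).kd t = 0
  step : ∀ x < D.n, D.Step x (s x) (s (x + 1))
  pl_end : ∀ u < D.h, (s D.n).pl u = 1
  kd_end : ∀ t < D.K, (s D.n).kd t = 0

/-- Slot `t` is filled with an arc of kind `k` exactly between the vertices `x` and `y`. -/
structure Life (s : ℕ → SweepState) (t k x y : ℕ) : Prop where
  lt : x < y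
  y_lt : y < D.n
  fst : (s x).kd t = 0
  mid : ∀ z, x < z → z ≤ y → (s z).kd t = k
  lst : (s (y + 1)).kd t = 0

variable {D} {s : ℕ → SweepState}

theorem Sweep.kd_step (hs : D.Sweep s) {t x : ℕ} (ht : t < D.K) (hx : x < D.n) :
    (s (x + 1)).kd t = (s x).kd t ∨ (s (x + 1)).kd t = 0 ∨ (s x).kd t = 0 := by
  have := (hs.step x hx).slot t ht
  unfold SlotStep at this
  omega

/-- The life ends where the slot is next empty, which happens since all slots are empty at the last
cut. Before that the kind cannot change, as `SlotStep` has no direct change from one arc to another.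
-/
theorem Sweep.exists_life_of_start (hs : D.Sweep s) {t x k : ℕ} (ht : t < D.K) (hx : x < D.n) (hk : k ≠ 0)
    (h0 : (s x).kd t = 0) (h1 : (s (x + 1)).kd t = k) : ∃ y, D.Life s t k x y := by
  classical
  have hex : ∃ y, x < y ∧ (s (y + 1)).kd t = 0 := by
    by_cases hxn : x + 1 = D.n
    · rw [hxn, hs.kd_end t ht] at h1; omega
    · refine ⟨D.n - 1, by omega, ?_⟩
      rw [show D.n - 1 + 1 = D.n by omega]
      exact hs.kd_end t ht
  have hmin : ∀ z, x < z → z < Nat.find hex → (s (z + 1)).kd t ≠ 0 := fun z hz hz' h =>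
    Nat.find_min hex hz' ⟨hz, h⟩
  have hle : Nat.find hex < D.n := by
    by_contra hcon
    have hxn : x + 1 ≠ D.n := by
      intro hxn
      rw [hxn, hs.kd_end t ht] at h1
      omega
    refine hmin (D.n - 1) (by omega) (by omega) ?_
    rw [show D.n - 1 + 1 = D.n by omega]
    exact hs.kd_end t ht
  refine ⟨Nat.find hex, (Nat.find_spec hex).1, hle, h0, ?_, (Nat.find_spec hex).2⟩
  intro z hz
  induction z, hz using Nat.le_induction with
  | base => intro _; exact h1
  | succ z hz ih =>
    intro hzy
    have h2 := ih (by omega)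
    rcases hs.kd_step ht (show z < D.n by omega) with h | h | h
    · rw [h, h2]
    · exact absurd h (hmin z hz (by omega))
    · omega

theorem Sweep.exists_life_of_end (hs : D.Sweep s) {t y k : ℕ} (ht : t < D.K) (hy : y < D.n) (hk : k ≠ 0)
    (h0 : (s (y + 1)).kd t = 0) (h1 : (s y).kd t = k) : ∃ x, D.Life s t k x y := by
  have key : ∀ y, y ≤ D.n → (s y).kd t = k → ∃ x < y, (s x).kd t = 0 ∧
      ∀ z, x < z → z ≤ y → (s z).kd t = k := by
    intro y
    induction y with
    | zero => intro _ h; rw [hs.kd_zero t ht] at h; omega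
    | succ y ih =>
      intro hy h
      rcases hs.kd_step ht (show y < D.n by omega) with h2 | h2 | h2
      · obtain ⟨x, hx, hx0, hxz⟩ := ih (by omega) (h2 ▸ h)
        refine ⟨x, by omega, hx0, fun z hz hz' => ?_⟩
        rcases Nat.lt_or_ge z (y + 1) with h3 | h3
        · exact hxz z hz (by omega)
        · obtain rfl : z = y + 1 := by omega
          exact h
      · omega
      · refine ⟨y, by omega, h2, fun z hz hz' => ?_⟩
        obtain rfl : z = y + 1 := by omega
        exact h
  obtain ⟨x, hx, hx0, hxz⟩ := key y hy.le h1
  exact ⟨x, hx, hy, hx0, hxz, h0⟩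

theorem Life.left_unique {t k k' x x' y : ℕ} (h : D.Life s t k x y) (h' : D.Life s t k' x' y)
    (hk : k ≠ 0) (hk' : k' ≠ 0) : x = x' := by
  have h1 := h.fst
  have h2 := h'.fst
  rcases lt_trichotomy x x' with hlt | heq | hgt
  · have := h.mid x' hlt h'.lt.le; omega
  · exact heq
  · have := h'.mid x hgt h.lt.le; omega

theorem Life.right_unique {t k k' x y y' : ℕ} (h : D.Life s t k x y) (h' : D.Life s t k' x y')
    (hk : k ≠ 0) (hk' : k' ≠ 0) : y = y' := by
  have h1 := h.lst
  have h2 := h'.lst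
  have h3 := h.lt
  have h4 := h'.lt
  rcases lt_trichotomy y y' with hlt | heq | hgt
  · have := h'.mid (y + 1) (by omega) hlt; omega
  · exact heq
  · have := h.mid (y' + 1) (by omega) hgt; omega

theorem Sweep.life_label (hs : D.Sweep s) {t k x y : ℕ} (ht : t < D.K) (hk : k ≠ 0)
    (hl : D.Life s t k x y) : ∀ z, x < z → z ≤ y → (s z).lb t = (s (x + 1)).lb t := by
  intro z hz
  induction z, hz using Nat.le_induction with
  | base => intro _; rfl
  | succ z hz ih =>
    intro hzy
    have h1 := ih (by omega)
    have h2 := hl.mid z hz (by omega)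
    have h3 := hl.mid (z + 1) (by omega) hzy
    have h4 := hl.y_lt
    have h5 := (hs.step z (by omega)).slot t ht
    unfold SlotStep at h5
    omega

theorem Sweep.life_code (hs : D.Sweep s) {t k x y : ℕ} (ht : t < D.K) (hk : k ≠ 0)
    (hl : D.Life s t k x y) : (s y).lb t < D.h * D.h ∧ D.R ((s y).lb t) := by
  rw [hs.life_label ht hk hl y hl.lt le_rfl]
  have h1 := hl.fst
  have h2 := hl.mid (x + 1) (by omega) hl.lt
  have h3 := hl.lt
  have h4 := hl.y_lt
  have h5 := (hs.step x (by omega)).slot t ht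
  unfold SlotStep at h5
  rcases h5 with h5 | h5 | h5 | h5 | h5 | h5 | h5
  · omega
  · omega
  · omega
  · omega
  · omega
  · exact ⟨h5.2.2.1, h5.2.2.2.1⟩
  · exact ⟨h5.2.2.1, h5.2.2.2.1⟩

theorem Generic.mono {i j v : ℕ} (h : D.Generic i v) (hij : i ≤ j) : D.Generic j v :=
  fun b hb => h b (hij.trans hb)

/-- The invariant that makes names meaningful: a name below `M` denotes the tail, a name from `M` on
only certifies that the tail is generic. Genericity persists to later cuts, so a tail never has to
be identified again. -/
theorem Sweep.life_forward (hs : D.Sweep s) {t x y : ℕ} (ht : t < D.K)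
    (hl : D.Life s t 1 x y) : ∀ z, x < z → z ≤ y →
    ((s z).nm t < D.M ∧ D.SP z ((s z).nm t) = x) ∨ (D.M ≤ (s z).nm t ∧ D.Generic z x) := by
  intro z hz
  have h4 := hl.y_lt
  have h6 := hl.lt
  induction z, hz using Nat.le_induction with
  | base =>
    intro _
    have h1 := hl.fst
    have h2 := hl.mid (x + 1) (by omega) (by omega)
    have h5 := (hs.step x (by omega)).slot t ht
    unfold SlotStep at h5
    rcases h5 with h5 | h5 | h5 | h5 | h5 | h5 | h5
    · omega
    · omega
    · omega
    · omega
    · omega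
    · exact h5.2.2.2.2
    · omega
  | succ z hz ih =>
    intro hzy
    have h1 := ih (by omega)
    have h2 := hl.mid z hz (by omega)
    have h3 := hl.mid (z + 1) (by omega) hzy
    have h5 := (hs.step z (by omega)).slot t ht
    unfold SlotStep at h5
    rcases h5 with h5 | h5 | h5 | h5 | h5 | h5 | h5
    · omega
    · rcases h5.2.2.2 with h7 | h7 | h7
      · left
        rcases h1 with h1 | h1
        · exact ⟨h7.2.1, by rw [← h7.2.2, h1.2]⟩
        · omega
      · right
        rcases h1 with h1 | h1
        · exact ⟨h7.2.1, h1.2 ▸ h7.2.2⟩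
        · omega
      · right
        rcases h1 with h1 | h1
        · omega
        · exact ⟨h7.2, h1.2.mono (by omega)⟩
    · omega
    · omega
    · omega
    · omega
    · omega

/-- The vertex denoted by the name stays constant during the life, and the slot can be emptied only
at that vertex. So the tail guessed at the start, where the arc is tested, is the vertex at which
the life ends. -/
theorem Sweep.life_backward (hs : D.Sweep s) {t x y : ℕ} (ht : t < D.K)
    (hl : D.Life s t 2 x y) : D.A y x ∧ D.SP (x + 1) ((s (x + 1)).nm t) = y := by
  have h4 := hl.y_lt
  have h6 := hl.lt
  have key : ∀ z, x < z → z ≤ y →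
      D.SP z ((s z).nm t) = D.SP (x + 1) ((s (x + 1)).nm t) := by
    intro z hz
    induction z, hz using Nat.le_induction with
    | base => intro _; rfl
    | succ z hz ih =>
      intro hzy
      have h1 := ih (by omega)
      have h2 := hl.mid z hz (by omega)
      have h3 := hl.mid (z + 1) (by omega) hzy
      have h5 := (hs.step z (by omega)).slot t ht
      unfold SlotStep at h5
      rcases h5 with h5 | h5 | h5 | h5 | h5 | h5 | h5
      · omega
      · omega
      · rw [← h5.2.2.2.1, h1]
      · omega
      · omega
      · omega
      · omega
  have hy : D.SP (x + 1) ((s (x + 1)).nm t) = y := by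
    rw [← key y h6 le_rfl]
    have h2 := hl.mid y h6 le_rfl
    have h3 := hl.lst
    have h5 := (hs.step y (by omega)).slot t ht
    unfold SlotStep at h5
    rcases h5 with h5 | h5 | h5 | h5 | h5 | h5 | h5
    · omega
    · omega
    · omega
    · omega
    · exact h5.2.2
    · omega
    · omega
  refine ⟨?_, hy⟩
  have h1 := hl.fst
  have h2 := hl.mid (x + 1) (by omega) (by omega)
  have h5 := (hs.step x (by omega)).slot t ht
  unfold SlotStep at h5
  rcases h5 with h5 | h5 | h5 | h5 | h5 | h5 | h5
  · omega
  · omega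
  · omega
  · omega
  · omega
  · omega
  · exact hy ▸ h5.2.2.2.2.1

/-- Names are chosen anew at each cut, and those from `M` on denote no vertex. What survives is
equality: `PairStep` lets two names agree exactly if they agreed before or both arcs have just
started at the vertex passed. -/
theorem Sweep.name_eq_iff (hs : D.Sweep s) {t t' x x' y y' : ℕ} (ht : t < D.K) (ht' : t' < D.K)
    (hl : D.Life s t 1 x y) (hl' : D.Life s t' 1 x' y') : ∀ z, x < z → x' < z → z ≤ y → z ≤ y' →
    ((s z).nm t = (s z).nm t' ↔ x = x') := by
  intro z
  induction z with
  | zero => intro h; omega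
  | succ z ih =>
    intro h1 h2 h3 h4
    have h5 := hl.y_lt
    have e := ((hs.step z (by omega)).pair t ht t' ht').1 (hl.mid _ h1 h3) (hl'.mid _ h2 h4)
    rw [e]
    by_cases hx : x = z
    · subst hx
      have := hl.fst
      by_cases hx' : x' = x
      · subst hx'
        have := hl'.fst
        simp_all
      · have := hl'.mid x (by omega) (by omega)
        have hxx : x ≠ x' := Ne.symm hx'
        simp_all
    · have h6 := hl.mid z (by omega) (by omega)
      by_cases hx' : x' = z
      · subst hx'
        have := hl'.fst
        simp_all
      · have h7 := hl'.mid z (by omega) (by omega)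
        rw [← ih (by omega) (by omega) (by omega) (by omega)]
        simp [h6, h7]

/-- Lives of two slots with the same tail and the same head coincide. -/
theorem Sweep.forward_inj (hs : D.Sweep s) {t t' x y : ℕ} (ht : t < D.K) (ht' : t' < D.K)
    (hl : D.Life s t 1 x y) (hl' : D.Life s t' 1 x y) : t = t' := by
  by_contra hne
  have h1 := (hs.name_eq_iff ht ht' hl hl' y hl.lt hl.lt le_rfl le_rfl).2 rfl
  exact ((hs.step y hl.y_lt).pair t ht t' ht').2.1 hne (hl.mid y hl.lt le_rfl) hl.lst
    (hl'.mid y hl.lt le_rfl) hl'.lst h1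

theorem Sweep.backward_inj (hs : D.Sweep s) {t t' x y : ℕ} (ht : t < D.K) (ht' : t' < D.K)
    (hl : D.Life s t 2 x y) (hl' : D.Life s t' 2 x y) : t = t' := by
  by_contra hne
  have h0 := hl.lt
  refine ((hs.step x (h0.trans hl.y_lt)).pair t ht t' ht').2.2 hne hl.fst
    (hl.mid _ (by omega) (by omega)) hl'.fst (hl'.mid _ (by omega) (by omega)) ?_
  rw [(hs.life_backward ht hl).2, (hs.life_backward ht' hl').2]

end SweepData
end DigraphImmersion

namespace DigraphImmersion

theorem exists_labelling {P : ℕ → ℕ → ℕ → Prop}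
    (hP : ∀ a b l l', P a b l → P a b l' → l = l') :
    ∃ lam : ℕ → ℕ → ℕ, ∀ a b l, lam a b = l + 1 ↔ P a b l := by
  classical
  refine ⟨fun a b => if hab : ∃ l, P a b l then hab.choose + 1 else 0, fun a b l => ?_⟩
  by_cases hab : ∃ l, P a b l
  · simp only [dif_pos hab, Nat.add_right_cancel_iff]
    constructor
    · rintro rfl
      exact hab.choose_spec
    · intro h
      exact hP _ _ _ _ hab.choose_spec h
  · simp only [dif_neg hab]
    constructor
    · intro h; omega
    · intro h; exact absurd ⟨l, h⟩ hab

namespace SweepData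

variable {D : SweepData} {s : ℕ → SweepState}

theorem Sweep.life_inj (hs : D.Sweep s) {k t t' x y : ℕ} (hk : k = 1 ∨ k = 2) (ht : t < D.K)
    (ht' : t' < D.K) (hl : D.Life s t k x y) (hl' : D.Life s t' k x y) : t = t' := by
  rcases hk with rfl | rfl
  exacts [hs.forward_inj ht ht' hl hl', hs.backward_inj ht ht' hl hl']

/-- Kinds `(1, 2)` count the arcs into `x`: forward arcs ending at `x` and backward arcs starting
their life there. Kinds `(2, 1)` count the arcs out of `x`. The label is read at `max a x`, the last
cut of the life. -/
theorem Sweep.card_eq_changes (hs : D.Sweep s) {k k' x l : ℕ} (hk : k = 1 ∨ k = 2)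
    (hk' : k' = 1 ∨ k' = 2) (hx : x < D.n) {S : Finset ℕ}
    (hS : ∀ a, a ∈ S ↔ ∃ t < D.K, (D.Life s t k a x ∨ D.Life s t k' x a) ∧
      (s (max a x)).lb t = l) :
    S.card = D.changes (s x) (s (x + 1)) k 0 (s x).lb l +
      D.changes (s x) (s (x + 1)) 0 k' (s (x + 1)).lb l := by
  have hk0 : k ≠ 0 := by omega
  have hk0' : k' ≠ 0 := by omega
  unfold changes
  rw [← Finset.card_union_of_disjoint]
  swap
  · rw [Finset.disjoint_left]
    intro t h1 h2
    have h1 := (Finset.mem_filter.1 h1).2.1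
    have h2 := (Finset.mem_filter.1 h2).2.1
    omega
  symm
  refine card_eq_of_rel (fun t a => D.Life s t k a x ∨ D.Life s t k' x a) ?_ ?_ ?_ ?_
  · intro t ht
    rw [Finset.mem_union, Finset.mem_filter, Finset.mem_filter, Finset.mem_range] at ht
    rcases ht with ⟨ht, h1, h2, h3⟩ | ⟨ht, h1, h2, h3⟩
    · obtain ⟨a, ha⟩ := hs.exists_life_of_end ht hx hk0 h2 h1
      exact ⟨a, (hS a).2 ⟨t, ht, Or.inl ha, by rwa [max_eq_right ha.lt.le]⟩, Or.inl ha⟩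
    · obtain ⟨a, ha⟩ := hs.exists_life_of_start ht hx hk0' h1 h2
      refine ⟨a, (hS a).2 ⟨t, ht, Or.inr ha, ?_⟩, Or.inr ha⟩
      rw [max_eq_left ha.lt.le, hs.life_label ht hk0' ha a ha.lt le_rfl, h3]
  · intro a ha
    obtain ⟨t, ht, h1, h2⟩ := (hS a).1 ha
    refine ⟨t, ?_, h1⟩
    rw [Finset.mem_union, Finset.mem_filter, Finset.mem_filter, Finset.mem_range]
    rcases h1 with h1 | h1
    · rw [max_eq_right h1.lt.le] at h2
      exact Or.inl ⟨ht, h1.mid x h1.lt le_rfl, h1.lst, h2⟩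
    · rw [max_eq_left h1.lt.le, hs.life_label ht hk0' h1 a h1.lt le_rfl] at h2
      exact Or.inr ⟨ht, h1.fst, h1.mid _ (by omega) h1.lt, h2⟩
  · rintro t - a a' (h1 | h1) (h2 | h2)
    · exact h1.left_unique h2 hk0 hk0
    · have := h1.mid x h1.lt le_rfl
      have := h2.fst
      omega
    · have := h2.mid x h2.lt le_rfl
      have := h1.fst
      omega
    · exact h1.right_unique h2 hk0' hk0'
  · have hlt : ∀ t ∈ Finset.filter (fun t => (s x).kd t = k ∧ (s (x + 1)).kd t = 0 ∧
        (s x).lb t = l) (Finset.range D.K) ∪ Finset.filter (fun t => (s x).kd t = 0 ∧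
        (s (x + 1)).kd t = k' ∧ (s (x + 1)).lb t = l) (Finset.range D.K), t < D.K := by
      intro t ht
      rw [Finset.mem_union, Finset.mem_filter, Finset.mem_filter, Finset.mem_range] at ht
      omega
    rintro t ht t' ht' a (h1 | h1) (h2 | h2)
    · exact hs.life_inj hk (hlt t ht) (hlt t' ht') h1 h2
    · have := h1.lt
      have := h2.lt
      omega
    · have := h1.lt
      have := h2.lt
      omega
    · exact hs.life_inj hk' (hlt t ht) (hlt t' ht') h1 h2

/-- Lives of slots are the used arcs. A vertex of `H` is placed where its bit `pl` switches, which
happens once because the bits are monotone. The counts of changes turn the balance of the sweep into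
that of a flow. -/
theorem Sweep.exists_isFlow (hs : D.Sweep s)
    (hT : ∀ a < D.n, ∀ b < D.n, a ≠ b → D.A a b ∨ D.A b a) :
    ∃ φ lam, IsFlow D.n D.h D.A D.R φ lam := by
  classical
  obtain ⟨lam, hlam⟩ := exists_labelling (P := fun a b l => ∃ t < D.K,
      (D.Life s t 1 a b ∨ D.Life s t 2 b a) ∧ (s (max a b)).lb t = l) (by
    rintro a b l l' ⟨t, ht, h1, rfl⟩ ⟨t', ht', h2, rfl⟩
    suffices h : t = t' by rw [h]
    rcases h1 with h1 | h1 <;> rcases h2 with h2 | h2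
    · exact hs.forward_inj ht ht' h1 h2
    · have := h1.lt
      have := h2.lt
      omega
    · have := h1.lt
      have := h2.lt
      omega
    · exact hs.backward_inj ht ht' h1 h2)
  have hplle : ∀ u < D.h, ∀ x y, x ≤ y → y ≤ D.n → (s x).pl u ≤ (s y).pl u := by
    intro u hu x y hxy
    induction y, hxy using Nat.le_induction with
    | base => intro _; exact le_rfl
    | succ y hxy ih => intro hy; exact (ih (by omega)).trans ((hs.step y hy).pl_le u hu).1
  have hpl1 : ∀ u < D.h, ∀ x ≤ D.n, (s x).pl u ≤ 1 := by
    intro u hu x hx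
    exact (hplle u hu x D.n hx le_rfl).trans (hs.pl_end u hu).le
  have hplace : ∀ u < D.h, ∃ x < D.n, (s x).pl u ≠ (s (x + 1)).pl u := by
    intro u hu
    by_contra! hcon
    have : ∀ x ≤ D.n, (s x).pl u = 0 := by
      intro x
      induction x with
      | zero => intro _; exact hs.pl_zero u hu
      | succ x ih => intro hx; rw [← hcon x hx, ih (by omega)]
    have := this D.n le_rfl
    rw [hs.pl_end u hu] at this
    omega
  have hplace1 : ∀ u < D.h, ∀ x < D.n, ∀ y < D.n, (s x).pl u ≠ (s (x + 1)).pl u →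
      (s y).pl u ≠ (s (y + 1)).pl u → x ≤ y := by
    intro u hu x hx y hy hxu hyu
    by_contra hcon
    have h1 := hplle u hu (y + 1) x (by omega) hx.le
    have h2 := hplle u hu y (y + 1) (by omega) hy
    have h3 := hplle u hu x (x + 1) (by omega) hx
    have h4 := hpl1 u hu (x + 1) hx
    omega
  choose! φ hφ1 hφ2 using hplace
  have hφ : ∀ u < D.h, ∀ x < D.n, φ u = x ↔ (s x).pl u ≠ (s (x + 1)).pl u := by
    intro u hu x hx
    constructor
    · rintro rfl; exact hφ2 u hu
    · intro h
      exact le_antisymm (hplace1 u hu _ (hφ1 u hu) _ hx (hφ2 u hu) h)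
        (hplace1 u hu _ hx _ (hφ1 u hu) h (hφ2 u hu))
  refine ⟨φ, lam, hφ1, ?_, ?_, ?_⟩
  · intro u hu v hv huv
    have h1 := (hs.step _ (hφ1 u hu)).pl_card
    refine Finset.card_le_one.1 h1 u ?_ v ?_
    · exact Finset.mem_filter.2 ⟨Finset.mem_range.2 hu, hφ2 u hu⟩
    · exact Finset.mem_filter.2 ⟨Finset.mem_range.2 hv, huv ▸ hφ2 v hv⟩
  · intro a b hab
    obtain ⟨l, hl⟩ := Nat.exists_eq_succ_of_ne_zero hab
    obtain ⟨t, ht, h1, h2⟩ := (hlam a b l).1 hl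
    refine ⟨?_, l, ?_⟩
    · rcases h1 with h1 | h1
      · have h3 := (hs.step b h1.y_lt).slot t ht
        have h4 := h1.mid b h1.lt le_rfl
        have h5 := h1.lst
        have h6 := hs.life_forward ht h1 b h1.lt le_rfl
        have h7 : D.M ≤ (s b).nm t ∨ D.A (D.SP b ((s b).nm t)) b := by
          unfold SlotStep at h3
          rcases h3 with h3 | h3 | h3 | h3 | h3 | h3 | h3
          · omega
          · omega
          · omega
          · exact h3.2.2
          · omega
          · omega
          · omega
        rcases h6 with h6 | h6
        · rcases h7 with h7 | h7
          · omega
          · rwa [h6.2] at h7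
        -- The only place where an arc has not been tested: the tail is generic, so `b` sends no arc
        -- to it, and semi-completeness supplies the forward arc.
        · exact (hT a (h1.lt.trans h1.y_lt) b h1.y_lt h1.lt.ne).resolve_right (h6.2 b le_rfl)
      · exact (hs.life_backward ht h1).1
    · rcases h1 with h1 | h1
      · rw [max_eq_right h1.lt.le] at h2
        have := hs.life_code ht one_ne_zero h1
        rw [h2] at this
        exact ⟨this.1, this.2, hl⟩
      · rw [max_eq_left h1.lt.le] at h2
        have := hs.life_code ht two_ne_zero h1
        rw [h2] at this
        exact ⟨this.1, this.2, hl⟩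
  · intro x hx l hl hR
    have hlt : ∀ t k a b, D.Life s t k a b → a < D.n ∧ b < D.n := fun t k a b h =>
      ⟨h.lt.trans h.y_lt, h.y_lt⟩
    have e1 := hs.card_eq_changes (k := 1) (k' := 2) (l := l) (by omega) (by omega) hx
      (S := (Finset.range D.n).filter (fun a => lam a x = l + 1)) (by
        intro a
        rw [Finset.mem_filter, hlam, Finset.mem_range]
        refine and_iff_right_of_imp ?_
        rintro ⟨t, ht, h1 | h1, -⟩
        exacts [(hlt _ _ _ _ h1).1, (hlt _ _ _ _ h1).2])
    have e2 := hs.card_eq_changes (k := 2) (k' := 1) (l := l) (by omega) (by omega) hx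
      (S := (Finset.range D.n).filter (fun b => lam x b = l + 1)) (by
        intro a
        rw [Finset.mem_filter, hlam, Finset.mem_range]
        rw [max_comm a x]
        constructor
        · rintro ⟨_, t, ht, h1, h2⟩
          exact ⟨t, ht, h1.symm, h2⟩
        · rintro ⟨t, ht, h1 | h1, h2⟩
          exacts [⟨(hlt _ _ _ _ h1).1, t, ht, Or.inr h1, h2⟩,
            ⟨(hlt _ _ _ _ h1).2, t, ht, Or.inl h1, h2⟩])
    have hh : 0 < D.h := by
      rcases Nat.eq_zero_or_pos D.h with h0 | h0
      · simp [h0] at hl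
      · exact h0
    rw [e1, e2]
    simp only [hφ _ (Nat.div_lt_of_lt_mul hl) x hx, hφ _ (Nat.mod_lt l hh) x hx]
    exact (hs.step x hx).balance l hl hR

end SweepData
end DigraphImmersion

/-! ### Slots for the used arcs: interval colouring and the crossing bound -/

namespace DigraphImmersion

/-- Intervals of which at most `K` meet in a point can be coloured with `K` colours. -/
theorem exists_interval_colouring {α : Type*} [DecidableEq α] (lo hi : α → ℕ) (K : ℕ)
    (E : Finset α) (hlh : ∀ e ∈ E, lo e ≤ hi e)
    (hK : ∀ x, (E.filter (fun e => lo e ≤ x ∧ x ≤ hi e)).card ≤ K) :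
    ∃ sl : α → ℕ, (∀ e ∈ E, sl e < K) ∧ ∀ e ∈ E, ∀ e' ∈ E, ∀ x, lo e ≤ x → x ≤ hi e →
      lo e' ≤ x → x ≤ hi e' → sl e = sl e' → e = e' := by
  induction E using Finset.induction_on_max_value lo with
  | empty => exact ⟨fun _ => 0, by simp⟩
  | insert a E ha hmax ih =>
    obtain ⟨sl, h1, h2⟩ := ih (fun e he => hlh e (Finset.mem_insert_of_mem he)) (fun x =>
      (Finset.card_le_card (Finset.filter_subset_filter _ (Finset.subset_insert _ _))).trans (hK x))
    -- The interval `a` starts last, so all intervals that meet it contain its left end. There are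
    -- fewer than `K` of them besides `a`, which leaves a colour.
    have hlt : ((E.filter (fun e => lo e ≤ lo a ∧ lo a ≤ hi e)).image sl).card <
        (Finset.range K).card := by
      have h3 := hK (lo a)
      rw [Finset.filter_insert, if_pos ⟨le_rfl, hlh a (Finset.mem_insert_self _ _)⟩,
        Finset.card_insert_of_notMem (by simp [ha])] at h3
      have h4 : ((E.filter (fun e => lo e ≤ lo a ∧ lo a ≤ hi e)).image sl).card ≤ _ :=
        Finset.card_image_le
      rw [Finset.card_range]
      omega
    obtain ⟨c, hc, hcE⟩ := Finset.exists_mem_notMem_of_card_lt_card hlt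
    have hca : ∀ e ∈ E, ∀ x, lo e ≤ x → x ≤ hi e → lo a ≤ x → sl e ≠ c := by
      rintro e he x - hx' hx'' rfl
      exact hcE (Finset.mem_image_of_mem _ (Finset.mem_filter.2 ⟨he, hmax e he, hx''.trans hx'⟩))
    have hne : ∀ e ∈ E, e ≠ a := by rintro e he rfl; exact ha he
    refine ⟨Function.update sl a c, ?_, ?_⟩
    · intro e he
      rcases Finset.mem_insert.1 he with rfl | he
      · simpa using hc
      · simpa [hne e he] using h1 e he
    · intro e he e' he' x hx1 hx2 hx3 hx4 hee
      rcases Finset.mem_insert.1 he with rfl | he₁ <;> rcases Finset.mem_insert.1 he' with rfl | he₂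
      · rfl
      · rw [Function.update_self, Function.update_of_ne (hne e' he₂)] at hee
        exact absurd hee.symm (hca e' he₂ x hx3 hx4 hx1)
      · rw [Function.update_self, Function.update_of_ne (hne e he₁)] at hee
        exact absurd hee (hca e he₁ x hx1 hx2 hx3)
      · rw [Function.update_of_ne (hne e he₁), Function.update_of_ne (hne e' he₂)] at hee
        exact h2 e he₁ e' he₂ x hx1 hx2 hx3 hx4 hee

section CrossingBound

variable {n h : ℕ} {A : ℕ → ℕ → Prop} {R : ℕ → Prop} {φ : ℕ → ℕ} {lam : ℕ → ℕ → ℕ}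

/-- Summing the balance over the vertices before the cut cancels the arcs among them; the source
contributes at most one. -/
theorem IsFlow.forward_le (hF : IsFlow n h A R φ lam) {i l : ℕ} (hi : i ≤ n) (hl : l < h * h)
    (hR : R l) : ∑ x ∈ Finset.range i, ∑ b ∈ Finset.Ico i n, (if lam x b = l + 1 then 1 else 0) ≤
      ∑ x ∈ Finset.range i, ∑ b ∈ Finset.Ico i n, (if lam b x = l + 1 then 1 else 0) + 1 := by
  have h1 : ∑ x ∈ Finset.range i, (((Finset.range n).filter (fun a => lam a x = l + 1)).card +
      (if φ (l / h) = x then 1 else 0)) = ∑ x ∈ Finset.range i, (((Finset.range n).filter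
      (fun b => lam x b = l + 1)).card + (if φ (l % h) = x then 1 else 0)) :=
    Finset.sum_congr rfl fun x hx =>
      hF.balance x ((Finset.mem_range.1 hx).trans_le hi) l hl hR
  simp only [Finset.sum_add_distrib, Finset.card_filter, Finset.sum_ite_eq,
    ← Finset.sum_range_add_sum_Ico _ hi] at h1
  have h2 : ∑ x ∈ Finset.range i, ∑ a ∈ Finset.range i, (if lam a x = l + 1 then 1 else 0) =
      ∑ x ∈ Finset.range i, ∑ b ∈ Finset.range i, (if lam x b = l + 1 then 1 else 0) :=
    Finset.sum_comm
  have h3 : (if φ (l / h) ∈ Finset.range i then 1 else 0) ≤ 1 := by split <;> omega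
  omega

/-- The used arcs. -/
def usedArcs (n : ℕ) (lam : ℕ → ℕ → ℕ) : Finset (ℕ × ℕ) :=
  (Finset.range n ×ˢ Finset.range n).filter (fun p => lam p.1 p.2 ≠ 0)

/-- By `IsFlow.forward_le`, summed over the labels, the forward arcs outnumber the backward ones by
at most the number of labels. -/
theorem IsFlow.card_crossing_le (hF : IsFlow n h A R φ lam) [DecidableRel A] [DecidablePred R]
    {i m k : ℕ} (hi : i ≤ n)
    (hm : ((Finset.range i ×ˢ Finset.Ico i n).filter (fun p => A p.2 p.1)).card ≤ m)
    (hk : ((Finset.range (h * h)).filter R).card ≤ k) :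
    ((usedArcs n lam).filter (fun p => p.1 < i ∧ i ≤ p.2 ∨ p.2 < i ∧ i ≤ p.1)).card ≤
      2 * m + k := by
  set N := (Finset.range (h * h)).filter R with hN
  have hsum : ∀ (f : ℕ × ℕ → ℕ), (∀ p, f p ≠ 0 → ∃ l ∈ N, f p = l + 1) → ∀ S : Finset (ℕ × ℕ),
      (S.filter (fun p => f p ≠ 0)).card = ∑ l ∈ N, ∑ p ∈ S, (if f p = l + 1 then 1 else 0) := by
    intro f hf S
    rw [Finset.sum_comm, Finset.card_filter]
    refine Finset.sum_congr rfl fun p _ => ?_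
    by_cases hp : f p = 0
    · simp [hp]
    · obtain ⟨l, hl, hl'⟩ := hf p hp
      simp only [hl', Nat.add_right_cancel_iff, Finset.sum_ite_eq, hl]
      simp
  have hlam : ∀ a b, lam a b ≠ 0 → ∃ l ∈ N, lam a b = l + 1 := by
    intro a b hab
    obtain ⟨_, l, hl, hR, h1⟩ := hF.arc a b hab
    exact ⟨l, Finset.mem_filter.2 ⟨Finset.mem_range.2 hl, hR⟩, h1⟩
  set S := Finset.range i ×ˢ Finset.Ico i n with hS
  have hf := hsum (fun p => lam p.1 p.2) (fun p => hlam _ _) S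
  have hb := hsum (fun p => lam p.2 p.1) (fun p => hlam _ _) S
  have h1 : (S.filter (fun p => lam p.1 p.2 ≠ 0)).card ≤
      (S.filter (fun p => lam p.2 p.1 ≠ 0)).card + N.card := by
    rw [hf, hb, Finset.card_eq_sum_ones, ← Finset.sum_add_distrib]
    refine Finset.sum_le_sum fun l hl => ?_
    rw [hN, Finset.mem_filter, Finset.mem_range] at hl
    rw [hS, Finset.sum_product, Finset.sum_product]
    exact hF.forward_le hi hl.1 hl.2
  have h2 : (S.filter (fun p => lam p.2 p.1 ≠ 0)).card ≤ m := by
    refine (Finset.card_le_card ?_).trans hm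
    intro p hp
    rw [Finset.mem_filter] at hp ⊢
    exact ⟨hp.1, (hF.arc _ _ hp.2).1⟩
  have h3 : (usedArcs n lam).filter (fun p => p.1 < i ∧ i ≤ p.2 ∨ p.2 < i ∧ i ≤ p.1) ⊆
      S.filter (fun p => lam p.1 p.2 ≠ 0) ∪
        (S.filter (fun p => lam p.2 p.1 ≠ 0)).image Prod.swap := by
    rintro ⟨a, b⟩ hp
    simp only [usedArcs, Finset.mem_filter, Finset.mem_product, Finset.mem_range] at hp
    simp only [hS, Finset.mem_union, Finset.mem_filter, Finset.mem_product, Finset.mem_range,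
      Finset.mem_Ico, Finset.mem_image, Prod.exists, Prod.swap_prod_mk, Prod.mk.injEq]
    rcases hp.2 with h4 | h4
    · exact Or.inl ⟨⟨h4.1, h4.2, hp.1.1.2⟩, hp.1.2⟩
    · exact Or.inr ⟨b, a, ⟨⟨h4.1, h4.2, hp.1.1.1⟩, hp.1.2⟩, rfl, rfl⟩
  have h4 := (Finset.card_le_card h3).trans (Finset.card_union_le _ _)
  have h5 : ((S.filter (fun p => lam p.2 p.1 ≠ 0)).image Prod.swap).card ≤ _ :=
    Finset.card_image_le
  omega

/-- The used arcs can be put into slots such that arcs in the same slot do not meet. -/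
theorem IsFlow.exists_slots (hF : IsFlow n h A R φ lam) [DecidableRel A] [DecidablePred R]
    {m k : ℕ} (hirr : ∀ a, ¬ A a a)
    (hm : ∀ i ≤ n, ((Finset.range i ×ˢ Finset.Ico i n).filter (fun p => A p.2 p.1)).card ≤ m)
    (hk : ((Finset.range (h * h)).filter R).card ≤ k) :
    ∃ sl : ℕ × ℕ → ℕ, (∀ e ∈ usedArcs n lam, sl e < 4 * m + 2 * k) ∧
      ∀ e ∈ usedArcs n lam, ∀ e' ∈ usedArcs n lam, ∀ x, min e.1 e.2 ≤ x → x ≤ max e.1 e.2 →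
        min e'.1 e'.2 ≤ x → x ≤ max e'.1 e'.2 → sl e = sl e' → e = e' := by
  refine exists_interval_colouring (fun e : ℕ × ℕ => min e.1 e.2) (fun e => max e.1 e.2) _ _
    (fun e _ => min_le_max) ?_
  intro x
  -- The intervals are closed, so arcs sharing an end get different slots and no slot is emptied and
  -- refilled at the same vertex. An arc whose interval contains `x` crosses the cut before or after
  -- `x`; hence twice the crossing bound.
  have hsub : (usedArcs n lam).filter (fun e => min e.1 e.2 ≤ x ∧ x ≤ max e.1 e.2) ⊆
      (usedArcs n lam).filter (fun p => p.1 < x ∧ x ≤ p.2 ∨ p.2 < x ∧ x ≤ p.1) ∪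
      (usedArcs n lam).filter (fun p => p.1 < x + 1 ∧ x + 1 ≤ p.2 ∨ p.2 < x + 1 ∧ x + 1 ≤ p.1) := by
    rintro ⟨a, b⟩ hp
    rw [Finset.mem_filter] at hp
    have hne : a ≠ b := by
      rintro rfl
      exact hirr a (hF.arc a a (Finset.mem_filter.1 hp.1).2).1
    simp only [Finset.mem_union, Finset.mem_filter, hp.1, true_and]
    have := hp.2
    omega
  by_cases hx : x < n
  · have h1 := hF.card_crossing_le hx.le (hm x hx.le) hk
    have h2 := hF.card_crossing_le (i := x + 1) hx (hm (x + 1) hx) hk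
    have h3 := (Finset.card_le_card hsub).trans (Finset.card_union_le _ _)
    omega
  · have : (usedArcs n lam).filter (fun e => min e.1 e.2 ≤ x ∧ x ≤ max e.1 e.2) = ∅ := by
      rw [Finset.filter_eq_empty_iff]
      intro p hp
      simp only [usedArcs, Finset.mem_filter, Finset.mem_product, Finset.mem_range] at hp
      omega
    rw [this]
    simp

end CrossingBound

end DigraphImmersion

/-! ### From flows to sweeps -/

namespace DigraphImmersion

namespace SweepData

variable (D : SweepData) (φ : ℕ → ℕ) (lam : ℕ → ℕ → ℕ) (sl : ℕ × ℕ → ℕ) (rk g : ℕ → ℕ → ℕ)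

/-- The used arc `(a, b)` with slot `t` crosses the cut `i`. -/
def Occ (i t a b : ℕ) : Prop :=
  lam a b ≠ 0 ∧ sl (a, b) = t ∧ (a < i ∧ i ≤ b ∨ b < i ∧ i ≤ a)

open Classical in
/-- The name at cut `i` of the tail of the arc `p`. -/
noncomputable def tailName (i : ℕ) (p : ℕ × ℕ) : ℕ :=
  if p.1 < p.2 ∧ D.Generic i p.1 then D.M + g i p.1 else rk i p.1

open Classical in
/-- The state of the sweep at cut `i` for a given flow and slots. -/
noncomputable def flowState (i : ℕ) : SweepState where
  pl u := if u < D.h ∧ φ u < i then 1 else 0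
  kd t := if ∃ p : ℕ × ℕ, Occ lam sl i t p.1 p.2 then
    (if ∃ p : ℕ × ℕ, Occ lam sl i t p.1 p.2 ∧ p.1 < p.2 then 1 else 2) else 0
  lb t := if h : ∃ p : ℕ × ℕ, Occ lam sl i t p.1 p.2 then lam h.choose.1 h.choose.2 - 1 else 0
  nm t := if h : ∃ p : ℕ × ℕ, Occ lam sl i t p.1 p.2 then D.tailName rk g i h.choose else 0

/-- The slots and names for a flow are consistent. -/
structure Plan : Prop where
  flow : IsFlow D.n D.h D.A D.R φ lam
  lt : ∀ a b, D.A a b → a < D.n ∧ b < D.n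
  irr : ∀ a, ¬ D.A a a
  sl_lt : ∀ a b, lam a b ≠ 0 → sl (a, b) < D.K
  sl_inj : ∀ a b a' b' x, lam a b ≠ 0 → lam a' b' ≠ 0 → min a b ≤ x → x ≤ max a b →
    min a' b' ≤ x → x ≤ max a' b' → sl (a, b) = sl (a', b') → a = a' ∧ b = b'
  left : ∀ i ≤ D.n, ∀ v < i, ¬ D.Generic i v → rk i v < D.M ∧ D.SP i (rk i v) = v
  right : ∀ i ≤ D.n, ∀ v, i ≤ v → ∀ a < i, D.A v a → rk i v < D.M ∧ D.SP i (rk i v) = v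
  g_lt : ∀ i a b, lam a b ≠ 0 → a < i → i ≤ b → g i a < D.K
  g_inj : ∀ i a b a' b', lam a b ≠ 0 → a < i → i ≤ b → lam a' b' ≠ 0 → a' < i → i ≤ b' →
    g i a = g i a' → a = a'

variable {D φ lam sl rk g}

theorem Plan.ne (hp : D.Plan φ lam sl rk g) {a b : ℕ} (h : lam a b ≠ 0) : a ≠ b := by
  rintro rfl
  exact hp.irr a (hp.flow.arc a a h).1

theorem Plan.lam_lt (hp : D.Plan φ lam sl rk g) {a b : ℕ} (h : lam a b ≠ 0) :
    a < D.n ∧ b < D.n := hp.lt _ _ (hp.flow.arc a b h).1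

theorem Plan.occ_unique (hp : D.Plan φ lam sl rk g) {i t a b a' b' : ℕ}
    (h : Occ lam sl i t a b) (h' : Occ lam sl i t a' b') : a = a' ∧ b = b' :=
  hp.sl_inj a b a' b' i h.1 h'.1 (by have := h.2.2; omega) (by have := h.2.2; omega)
    (by have := h'.2.2; omega) (by have := h'.2.2; omega) (h.2.1.trans h'.2.1.symm)

/-- The closed intervals of both arcs contain the vertex `i` between the two cuts. -/
theorem Plan.occ_unique_succ (hp : D.Plan φ lam sl rk g) {i t a b a' b' : ℕ}
    (h : Occ lam sl i t a b) (h' : Occ lam sl (i + 1) t a' b') : a = a' ∧ b = b' :=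
  hp.sl_inj a b a' b' i h.1 h'.1 (by have := h.2.2; omega) (by have := h.2.2; omega)
    (by have := h'.2.2; omega) (by have := h'.2.2; omega) (h.2.1.trans h'.2.1.symm)

theorem Plan.state_of_occ (hp : D.Plan φ lam sl rk g) {i t a b : ℕ} (h : Occ lam sl i t a b) :
    (flowState D φ lam sl rk g i).kd t = (if a < b then 1 else 2) ∧
    (flowState D φ lam sl rk g i).lb t = lam a b - 1 ∧
    (flowState D φ lam sl rk g i).nm t = D.tailName rk g i (a, b) := by
  have hex : ∃ p : ℕ × ℕ, Occ lam sl i t p.1 p.2 := ⟨(a, b), h⟩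
  have hch : hex.choose = (a, b) := by
    obtain ⟨h1, h2⟩ := hp.occ_unique hex.choose_spec h
    exact Prod.ext h1 h2
  refine ⟨?_, ?_, ?_⟩
  · simp only [flowState, if_pos hex]
    have : (∃ p : ℕ × ℕ, Occ lam sl i t p.1 p.2 ∧ p.1 < p.2) ↔ a < b := by
      constructor
      · rintro ⟨p, h1, h2⟩
        obtain ⟨h3, h4⟩ := hp.occ_unique h1 h
        rwa [h3, h4] at h2
      · intro hab; exact ⟨(a, b), h, hab⟩
    simp only [this]
  · simp only [flowState, dif_pos hex, hch]
  · simp only [flowState, dif_pos hex, hch]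

theorem state_of_not_occ {i t : ℕ} (h : ¬ ∃ p : ℕ × ℕ, Occ lam sl i t p.1 p.2) :
    (flowState D φ lam sl rk g i).kd t = 0 ∧ (flowState D φ lam sl rk g i).lb t = 0 ∧
    (flowState D φ lam sl rk g i).nm t = 0 := by
  simp only [flowState, if_neg h, dif_neg h, and_self]

theorem Plan.kd_eq_one (hp : D.Plan φ lam sl rk g) {i t : ℕ} :
    (flowState D φ lam sl rk g i).kd t = 1 ↔ ∃ a b, Occ lam sl i t a b ∧ a < b := by
  constructor
  · intro h
    by_cases hex : ∃ p : ℕ × ℕ, Occ lam sl i t p.1 p.2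
    · obtain ⟨⟨a, b⟩, hab⟩ := hex
      refine ⟨a, b, hab, ?_⟩
      by_contra hcon
      rw [(hp.state_of_occ hab).1, if_neg hcon] at h
      omega
    · rw [(state_of_not_occ hex).1] at h; omega
  · rintro ⟨a, b, h, hab⟩
    rw [(hp.state_of_occ h).1, if_pos hab]

theorem Plan.kd_eq_two (hp : D.Plan φ lam sl rk g) {i t : ℕ} :
    (flowState D φ lam sl rk g i).kd t = 2 ↔ ∃ a b, Occ lam sl i t a b ∧ b < a := by
  constructor
  · intro h
    by_cases hex : ∃ p : ℕ × ℕ, Occ lam sl i t p.1 p.2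
    · obtain ⟨⟨a, b⟩, hab⟩ := hex
      refine ⟨a, b, hab, ?_⟩
      by_contra hcon
      have hne := hp.ne hab.1
      rw [(hp.state_of_occ hab).1, if_pos (show a < b by omega)] at h
      omega
    · rw [(state_of_not_occ hex).1] at h; omega
  · rintro ⟨a, b, h, hab⟩
    rw [(hp.state_of_occ h).1, if_neg (by omega)]

theorem Plan.kd_eq_zero (hp : D.Plan φ lam sl rk g) {i t : ℕ} :
    (flowState D φ lam sl rk g i).kd t = 0 ↔ ∀ a b, ¬ Occ lam sl i t a b := by
  constructor
  · intro h a b hab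
    rw [(hp.state_of_occ hab).1] at h
    split at h <;> omega
  · intro h
    exact (state_of_not_occ fun ⟨p, hp⟩ => h _ _ hp).1

theorem Plan.name_special (hp : D.Plan φ lam sl rk g) {i a b : ℕ} (hi : i ≤ D.n)
    (h : lam a b ≠ 0) (hc : a < i ∧ i ≤ b ∨ b < i ∧ i ≤ a) (hg : ¬ (a < b ∧ D.Generic i a)) :
    D.tailName rk g i (a, b) < D.M ∧ D.SP i (D.tailName rk g i (a, b)) = a := by
  simp only [tailName, if_neg hg]
  rcases hc with hc | hc
  · exact hp.left i hi a hc.1 fun h1 => hg ⟨by omega, h1⟩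
  · exact hp.right i hi a hc.2 b hc.1 (hp.flow.arc a b h).1

theorem name_generic {i a b : ℕ} (hg : a < b ∧ D.Generic i a) :
    D.tailName rk g i (a, b) = D.M + g i a := by
  simp only [tailName, if_pos hg]

/-- Names below and from `M` on are separated by genericity, which depends on the tail only; below
`M` the name determines the vertex through `SP`, above it through `g`. -/
theorem Plan.name_inj (hp : D.Plan φ lam sl rk g) {i a b a' b' : ℕ} (hi : i ≤ D.n)
    (h : lam a b ≠ 0) (ha : a < i) (hb : i ≤ b) (h' : lam a' b' ≠ 0) (ha' : a' < i) (hb' : i ≤ b') :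
    D.tailName rk g i (a, b) = D.tailName rk g i (a', b') ↔ a = a' := by
  have hlt : a < b := by omega
  have hlt' : a' < b' := by omega
  constructor
  · intro heq
    by_cases hg : a < b ∧ D.Generic i a <;> by_cases hg' : a' < b' ∧ D.Generic i a'
    · rw [name_generic hg, name_generic hg'] at heq
      exact hp.g_inj i a b a' b' h ha hb h' ha' hb' (by omega)
    · have := (hp.name_special hi h' (Or.inl ⟨ha', hb'⟩) hg').1
      rw [name_generic hg] at heq
      omega
    · have := (hp.name_special hi h (Or.inl ⟨ha, hb⟩) hg).1
      rw [name_generic hg'] at heq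
      omega
    · rw [← (hp.name_special hi h (Or.inl ⟨ha, hb⟩) hg).2,
        ← (hp.name_special hi h' (Or.inl ⟨ha', hb'⟩) hg').2, heq]
  · rintro rfl
    have : (a < b ∧ D.Generic i a) ↔ (a < b' ∧ D.Generic i a) := by simp [hlt, hlt']
    by_cases hg : a < b ∧ D.Generic i a
    · rw [name_generic hg, name_generic (this.1 hg)]
    · simp only [tailName, if_neg hg, if_neg (fun h1 => hg (this.2 h1))]

/-- The cases are whether the slot is occupied before and after `x`. If both, it holds the same arc,
and since genericity is monotone in the cut, the name of a forward tail can change only from special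
to generic. -/
theorem Plan.slotStep (hp : D.Plan φ lam sl rk g) {x : ℕ} (hx : x < D.n) (t : ℕ) :
    D.SlotStep x (flowState D φ lam sl rk g x) (flowState D φ lam sl rk g (x + 1)) t := by
  unfold SlotStep
  by_cases h1 : ∃ p : ℕ × ℕ, Occ lam sl x t p.1 p.2 <;>
    by_cases h2 : ∃ p : ℕ × ℕ, Occ lam sl (x + 1) t p.1 p.2
  · obtain ⟨⟨a, b⟩, h1⟩ := h1
    obtain ⟨⟨a', b'⟩, h2⟩ := h2
    obtain ⟨rfl, rfl⟩ := hp.occ_unique_succ h1 h2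
    have hlam := h1.1
    have hc := h1.2.2
    have hc' := h2.2.2
    simp only at hlam hc hc'
    obtain ⟨e1, e2, e3⟩ := hp.state_of_occ h1
    obtain ⟨f1, f2, f3⟩ := hp.state_of_occ h2
    rcases Nat.lt_or_ge a b with hab | hab
    · right; left
      rw [if_pos hab] at e1 f1
      refine ⟨e1, f1, f2.trans e2.symm, ?_⟩
      rw [e3, f3]
      by_cases hg : D.Generic x a
      · right; right
        rw [name_generic ⟨hab, hg⟩, name_generic ⟨hab, hg.mono (Nat.le_succ x)⟩]
        omega
      · obtain ⟨n1, n2⟩ := hp.name_special hx.le hlam hc (by simp [hg])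
        by_cases hg' : D.Generic (x + 1) a
        · right; left
          rw [n2]
          exact ⟨n1, by rw [name_generic ⟨hab, hg'⟩]; omega, hg'⟩
        · left
          obtain ⟨m1, m2⟩ := hp.name_special hx hlam hc' (by simp [hg'])
          exact ⟨n1, m1, by rw [n2, m2]⟩
    · right; right; left
      rw [if_neg (by omega)] at e1 f1
      obtain ⟨n1, n2⟩ := hp.name_special hx.le hlam hc (by omega)
      obtain ⟨m1, m2⟩ := hp.name_special hx hlam hc' (by omega)
      refine ⟨e1, f1, f2.trans e2.symm, ?_, ?_⟩
      · rw [e3, f3, n2, m2]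
      · rw [e3, n2]; omega
  · obtain ⟨⟨a, b⟩, h1⟩ := h1
    have hlam := h1.1
    have hc := h1.2.2
    simp only at hlam hc
    obtain ⟨e1, e2, e3⟩ := hp.state_of_occ h1
    have f1 := (state_of_not_occ (D := D) (φ := φ) (rk := rk) (g := g) h2).1
    have hc' : ¬ (a < x + 1 ∧ x + 1 ≤ b ∨ b < x + 1 ∧ x + 1 ≤ a) := fun h =>
      h2 ⟨(a, b), hlam, h1.2.1, h⟩
    rcases Nat.lt_or_ge a b with hab | hab
    · right; right; right; left
      rw [if_pos hab] at e1
      refine ⟨e1, f1, ?_⟩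
      rw [e3]
      by_cases hg : D.Generic x a
      · left; rw [name_generic ⟨hab, hg⟩]; omega
      · right
        rw [(hp.name_special hx.le hlam hc (by simp [hg])).2]
        obtain rfl : b = x := by omega
        exact (hp.flow.arc _ _ hlam).1
    · right; right; right; right; left
      rw [if_neg (by omega)] at e1
      refine ⟨e1, f1, ?_⟩
      rw [e3, (hp.name_special hx.le hlam hc (by omega)).2]
      have := hp.ne hlam
      omega
  · obtain ⟨⟨a, b⟩, h2⟩ := h2
    have hlam := h2.1
    have hc := h2.2.2
    simp only at hlam hc
    obtain ⟨e1, e2, e3⟩ := hp.state_of_occ h2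
    have f1 := (state_of_not_occ (D := D) (φ := φ) (rk := rk) (g := g) h1).1
    have hc' : ¬ (a < x ∧ x ≤ b ∨ b < x ∧ x ≤ a) := fun h => h1 ⟨(a, b), hlam, h2.2.1, h⟩
    obtain ⟨hA, l, hl, hR, hll⟩ := hp.flow.arc _ _ hlam
    have e2' : (flowState D φ lam sl rk g (x + 1)).lb t = l := by rw [e2, hll]; rfl
    rcases Nat.lt_or_ge a b with hab | hab
    · right; right; right; right; right; left
      rw [if_pos hab] at e1
      obtain rfl : a = x := by omega
      refine ⟨f1, e1, by rwa [e2'], by rwa [e2'], ?_⟩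
      rw [e3]
      by_cases hg : D.Generic (a + 1) a
      · right; exact ⟨by rw [name_generic ⟨hab, hg⟩]; omega, hg⟩
      · left; exact hp.name_special hx hlam hc (by simp [hg])
    · right; right; right; right; right; right
      rw [if_neg (by omega)] at e1
      have := hp.ne hlam
      obtain rfl : b = x := by omega
      refine ⟨f1, e1, by rwa [e2'], by rwa [e2'], ?_⟩
      rw [e3, (hp.name_special hx hlam hc (by omega)).2]
      exact ⟨hA, by omega⟩
  · exact Or.inl ⟨(state_of_not_occ h1).1, (state_of_not_occ h2).1⟩

/-- The arcs which end or start when the sweep passes the vertex `x`. -/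
theorem Plan.ended_forward (hp : D.Plan φ lam sl rk g) {x t : ℕ} :
    ((flowState D φ lam sl rk g x).kd t = 1 ∧ (flowState D φ lam sl rk g (x + 1)).kd t = 0) ↔
      ∃ a < x, lam a x ≠ 0 ∧ sl (a, x) = t := by
  rw [hp.kd_eq_one, hp.kd_eq_zero]
  constructor
  · rintro ⟨⟨a, b, h, hab⟩, h'⟩
    have h1 := h.2.2
    have h2 : ¬ (a < x + 1 ∧ x + 1 ≤ b ∨ b < x + 1 ∧ x + 1 ≤ a) := fun hc =>
      h' a b ⟨h.1, h.2.1, hc⟩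
    obtain rfl : b = x := by omega
    exact ⟨a, hab, h.1, h.2.1⟩
  · rintro ⟨a, ha, h1, h2⟩
    have ho : Occ lam sl x t a x := ⟨h1, h2, by omega⟩
    refine ⟨⟨a, x, ho, ha⟩, fun a' b' h' => ?_⟩
    obtain ⟨rfl, rfl⟩ := hp.occ_unique_succ ho h'
    have := h'.2.2
    omega

theorem Plan.ended_backward (hp : D.Plan φ lam sl rk g) {x t : ℕ} :
    ((flowState D φ lam sl rk g x).kd t = 2 ∧ (flowState D φ lam sl rk g (x + 1)).kd t = 0) ↔
      ∃ b < x, lam x b ≠ 0 ∧ sl (x, b) = t := by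
  rw [hp.kd_eq_two, hp.kd_eq_zero]
  constructor
  · rintro ⟨⟨a, b, h, hab⟩, h'⟩
    have h1 := h.2.2
    have h2 : ¬ (a < x + 1 ∧ x + 1 ≤ b ∨ b < x + 1 ∧ x + 1 ≤ a) := fun hc =>
      h' a b ⟨h.1, h.2.1, hc⟩
    obtain rfl : a = x := by omega
    exact ⟨b, hab, h.1, h.2.1⟩
  · rintro ⟨b, hb, h1, h2⟩
    have ho : Occ lam sl x t x b := ⟨h1, h2, by omega⟩
    refine ⟨⟨x, b, ho, hb⟩, fun a' b' h' => ?_⟩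
    obtain ⟨rfl, rfl⟩ := hp.occ_unique_succ ho h'
    have := h'.2.2
    omega

theorem Plan.started_forward (hp : D.Plan φ lam sl rk g) {x t : ℕ} :
    ((flowState D φ lam sl rk g x).kd t = 0 ∧ (flowState D φ lam sl rk g (x + 1)).kd t = 1) ↔
      ∃ b, x < b ∧ lam x b ≠ 0 ∧ sl (x, b) = t := by
  rw [hp.kd_eq_one, hp.kd_eq_zero]
  constructor
  · rintro ⟨h', a, b, h, hab⟩
    have h1 := h.2.2
    have h2 : ¬ (a < x ∧ x ≤ b ∨ b < x ∧ x ≤ a) := fun hc => h' a b ⟨h.1, h.2.1, hc⟩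
    obtain rfl : a = x := by omega
    exact ⟨b, hab, h.1, h.2.1⟩
  · rintro ⟨b, hb, h1, h2⟩
    have ho : Occ lam sl (x + 1) t x b := ⟨h1, h2, by omega⟩
    refine ⟨fun a' b' h' => ?_, x, b, ho, hb⟩
    obtain ⟨rfl, rfl⟩ := hp.occ_unique_succ h' ho
    have := h'.2.2
    omega

theorem Plan.started_backward (hp : D.Plan φ lam sl rk g) {x t : ℕ} :
    ((flowState D φ lam sl rk g x).kd t = 0 ∧ (flowState D φ lam sl rk g (x + 1)).kd t = 2) ↔
      ∃ a, x < a ∧ lam a x ≠ 0 ∧ sl (a, x) = t := by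
  rw [hp.kd_eq_two, hp.kd_eq_zero]
  constructor
  · rintro ⟨h', a, b, h, hab⟩
    have h1 := h.2.2
    have h2 : ¬ (a < x ∧ x ≤ b ∨ b < x ∧ x ≤ a) := fun hc => h' a b ⟨h.1, h.2.1, hc⟩
    obtain rfl : b = x := by omega
    exact ⟨a, hab, h.1, h.2.1⟩
  · rintro ⟨a, ha, h1, h2⟩
    have ho : Occ lam sl (x + 1) t a x := ⟨h1, h2, by omega⟩
    refine ⟨fun a' b' h' => ?_, a, x, ho, ha⟩
    obtain ⟨rfl, rfl⟩ := hp.occ_unique_succ h' ho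
    have := h'.2.2
    omega

end SweepData
end DigraphImmersion

namespace DigraphImmersion
namespace SweepData

variable {D : SweepData} {φ : ℕ → ℕ} {lam : ℕ → ℕ → ℕ} {sl : ℕ × ℕ → ℕ} {rk g : ℕ → ℕ → ℕ}

theorem Plan.pairStep (hp : D.Plan φ lam sl rk g) {x : ℕ} (hx : x < D.n) (t t' : ℕ) :
    D.PairStep x (flowState D φ lam sl rk g x) (flowState D φ lam sl rk g (x + 1)) t t' := by
  refine ⟨?_, ?_, ?_⟩
  · intro h h'
    obtain ⟨a, b, ho, hab⟩ := hp.kd_eq_one.1 h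
    obtain ⟨a', b', ho', hab'⟩ := hp.kd_eq_one.1 h'
    have hc := ho.2.2
    have hc' := ho'.2.2
    rw [(hp.state_of_occ ho).2.2, (hp.state_of_occ ho').2.2,
      hp.name_inj hx ho.1 (by omega) (by omega) ho'.1 (by omega) (by omega)]
    -- A forward arc pending after `x` either starts at `x` or was already pending before; mixed
    -- pairs have different tails.
    have key : ∀ {t a b : ℕ}, Occ lam sl (x + 1) t a b → a < b →
        ((flowState D φ lam sl rk g x).kd t = 0 ∧ a = x) ∨
        ((flowState D φ lam sl rk g x).kd t = 1 ∧ Occ lam sl x t a b ∧ a < x) := by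
      intro t a b ho hab
      have hc := ho.2.2
      by_cases hax : a = x
      · left
        subst hax
        exact ⟨(hp.started_forward.2 ⟨b, hab, ho.1, ho.2.1⟩).1, rfl⟩
      · right
        have ho₂ : Occ lam sl x t a b := ⟨ho.1, ho.2.1, by omega⟩
        exact ⟨hp.kd_eq_one.2 ⟨a, b, ho₂, hab⟩, ho₂, by omega⟩
    rcases key ho hab with ⟨h1, h2⟩ | ⟨h1, h2, h3⟩ <;>
      rcases key ho' hab' with ⟨h1', h2'⟩ | ⟨h1', h2', h3'⟩
    · simp [h1, h1', h2, h2']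
    · rw [h1, h1', h2]
      simp [h3'.ne']
    · rw [h1, h1', h2']
      simp [h3.ne]
    · rw [h1, h1', (hp.state_of_occ h2).2.2, (hp.state_of_occ h2').2.2,
        hp.name_inj hx.le ho.1 h3 (by omega) ho'.1 h3' (by omega)]
      simp
  · intro hne h1 h2 h1' h2' heq
    obtain ⟨a, ha, h3, h4⟩ := hp.ended_forward.1 ⟨h1, h2⟩
    obtain ⟨a', ha', h3', h4'⟩ := hp.ended_forward.1 ⟨h1', h2'⟩
    rw [(hp.state_of_occ (a := a) (b := x) ⟨h3, h4, by omega⟩).2.2,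
      (hp.state_of_occ (a := a') (b := x) ⟨h3', h4', by omega⟩).2.2,
      hp.name_inj hx.le h3 ha le_rfl h3' ha' le_rfl] at heq
    subst heq
    exact hne (h4.symm.trans h4')
  · intro hne h1 h2 h1' h2' heq
    obtain ⟨a, ha, h3, h4⟩ := hp.started_backward.1 ⟨h1, h2⟩
    obtain ⟨a', ha', h3', h4'⟩ := hp.started_backward.1 ⟨h1', h2'⟩
    rw [(hp.state_of_occ (a := a) (b := x) ⟨h3, h4, by omega⟩).2.2,
      (hp.state_of_occ (a := a') (b := x) ⟨h3', h4', by omega⟩).2.2,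
      (hp.name_special hx h3 (by omega) (by omega)).2,
      (hp.name_special hx h3' (by omega) (by omega)).2] at heq
    subst heq
    exact hne (h4.symm.trans h4')

/-- An arc into `x` comes from the left, and then its slot is emptied at `x`, or from the right, and
then its slot is filled there. -/
theorem Plan.card_in (hp : D.Plan φ lam sl rk g) {x l : ℕ} :
    ((Finset.range D.n).filter (fun a => lam a x = l + 1)).card =
    D.changes (flowState D φ lam sl rk g x) (flowState D φ lam sl rk g (x + 1)) 1 0
      (flowState D φ lam sl rk g x).lb l +
    D.changes (flowState D φ lam sl rk g x) (flowState D φ lam sl rk g (x + 1)) 0 2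
      (flowState D φ lam sl rk g (x + 1)).lb l := by
  unfold changes
  rw [← Finset.card_union_of_disjoint]
  swap
  · rw [Finset.disjoint_left]
    intro t h1 h2
    have h1 := (Finset.mem_filter.1 h1).2.1
    have h2 := (Finset.mem_filter.1 h2).2.1
    omega
  refine card_eq_of_rel (fun a t => lam a x = l + 1 ∧ sl (a, x) = t) ?_ ?_ ?_ ?_
  · intro a ha
    have ha := (Finset.mem_filter.1 ha).2
    have hl0 : lam a x ≠ 0 := by omega
    have hne := hp.ne hl0
    refine ⟨sl (a, x), ?_, ha, rfl⟩
    rw [Finset.mem_union, Finset.mem_filter, Finset.mem_filter, Finset.mem_range]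
    rcases Nat.lt_or_gt_of_ne hne with hlt | hlt
    · left
      have h1 := hp.ended_forward.2 ⟨a, hlt, hl0, rfl⟩
      have h2 := (hp.state_of_occ (i := x) (t := sl (a, x)) (a := a) (b := x)
        ⟨hl0, rfl, by omega⟩).2.1
      exact ⟨hp.sl_lt a x hl0, h1.1, h1.2, by rw [h2]; omega⟩
    · right
      have h1 := hp.started_backward.2 ⟨a, hlt, hl0, rfl⟩
      have h2 := (hp.state_of_occ (i := x + 1) (t := sl (a, x)) (a := a) (b := x)
        ⟨hl0, rfl, by omega⟩).2.1
      exact ⟨hp.sl_lt a x hl0, h1.1, h1.2, by rw [h2]; omega⟩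
  · intro t ht
    rw [Finset.mem_union, Finset.mem_filter, Finset.mem_filter, Finset.mem_range] at ht
    rcases ht with ⟨-, h1, h2, h3⟩ | ⟨-, h1, h2, h3⟩
    · obtain ⟨a, ha, h4, h5⟩ := hp.ended_forward.1 ⟨h1, h2⟩
      rw [(hp.state_of_occ (a := a) (b := x) ⟨h4, h5, by omega⟩).2.1] at h3
      have h6 : lam a x = l + 1 := by omega
      exact ⟨a, Finset.mem_filter.2 ⟨Finset.mem_range.2 (hp.lam_lt h4).1, h6⟩, h6, h5⟩
    · obtain ⟨a, ha, h4, h5⟩ := hp.started_backward.1 ⟨h1, h2⟩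
      rw [(hp.state_of_occ (a := a) (b := x) ⟨h4, h5, by omega⟩).2.1] at h3
      have h6 : lam a x = l + 1 := by omega
      exact ⟨a, Finset.mem_filter.2 ⟨Finset.mem_range.2 (hp.lam_lt h4).1, h6⟩, h6, h5⟩
  · rintro a - t t' ⟨_, h⟩ ⟨_, h'⟩
    exact h.symm.trans h'
  · rintro a - a' - t ⟨h1, h2⟩ ⟨h1', h2'⟩
    exact (hp.sl_inj a x a' x x (by omega) (by omega) (by omega) (by omega) (by omega) (by omega)
      (h2.trans h2'.symm)).1

theorem Plan.card_out (hp : D.Plan φ lam sl rk g) {x l : ℕ} :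
    ((Finset.range D.n).filter (fun b => lam x b = l + 1)).card =
    D.changes (flowState D φ lam sl rk g x) (flowState D φ lam sl rk g (x + 1)) 2 0
      (flowState D φ lam sl rk g x).lb l +
    D.changes (flowState D φ lam sl rk g x) (flowState D φ lam sl rk g (x + 1)) 0 1
      (flowState D φ lam sl rk g (x + 1)).lb l := by
  unfold changes
  rw [← Finset.card_union_of_disjoint]
  swap
  · rw [Finset.disjoint_left]
    intro t h1 h2
    have h1 := (Finset.mem_filter.1 h1).2.1
    have h2 := (Finset.mem_filter.1 h2).2.1
    omega
  refine card_eq_of_rel (fun b t => lam x b = l + 1 ∧ sl (x, b) = t) ?_ ?_ ?_ ?_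
  · intro b hb
    have hb := (Finset.mem_filter.1 hb).2
    have hl0 : lam x b ≠ 0 := by omega
    have hne := hp.ne hl0
    refine ⟨sl (x, b), ?_, hb, rfl⟩
    rw [Finset.mem_union, Finset.mem_filter, Finset.mem_filter, Finset.mem_range]
    rcases Nat.lt_or_gt_of_ne hne with hlt | hlt
    · right
      have h1 := hp.started_forward.2 ⟨b, hlt, hl0, rfl⟩
      have h2 := (hp.state_of_occ (i := x + 1) (t := sl (x, b)) (a := x) (b := b)
        ⟨hl0, rfl, by omega⟩).2.1
      exact ⟨hp.sl_lt x b hl0, h1.1, h1.2, by rw [h2]; omega⟩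
    · left
      have h1 := hp.ended_backward.2 ⟨b, hlt, hl0, rfl⟩
      have h2 := (hp.state_of_occ (i := x) (t := sl (x, b)) (a := x) (b := b)
        ⟨hl0, rfl, by omega⟩).2.1
      exact ⟨hp.sl_lt x b hl0, h1.1, h1.2, by rw [h2]; omega⟩
  · intro t ht
    rw [Finset.mem_union, Finset.mem_filter, Finset.mem_filter, Finset.mem_range] at ht
    rcases ht with ⟨-, h1, h2, h3⟩ | ⟨-, h1, h2, h3⟩
    · obtain ⟨b, hb, h4, h5⟩ := hp.ended_backward.1 ⟨h1, h2⟩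
      rw [(hp.state_of_occ (a := x) (b := b) ⟨h4, h5, by omega⟩).2.1] at h3
      have h6 : lam x b = l + 1 := by omega
      exact ⟨b, Finset.mem_filter.2 ⟨Finset.mem_range.2 (hp.lam_lt h4).2, h6⟩, h6, h5⟩
    · obtain ⟨b, hb, h4, h5⟩ := hp.started_forward.1 ⟨h1, h2⟩
      rw [(hp.state_of_occ (a := x) (b := b) ⟨h4, h5, by omega⟩).2.1] at h3
      have h6 : lam x b = l + 1 := by omega
      exact ⟨b, Finset.mem_filter.2 ⟨Finset.mem_range.2 (hp.lam_lt h4).2, h6⟩, h6, h5⟩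
  · rintro b - t t' ⟨_, h⟩ ⟨_, h'⟩
    exact h.symm.trans h'
  · rintro b - b' - t ⟨h1, h2⟩ ⟨h1', h2'⟩
    exact (hp.sl_inj x b x b' x (by omega) (by omega) (by omega) (by omega) (by omega) (by omega)
      (h2.trans h2'.symm)).2

theorem Plan.sweep (hp : D.Plan φ lam sl rk g) : D.Sweep (flowState D φ lam sl rk g) := by
  have hpl : ∀ i u, u < D.h → (flowState D φ lam sl rk g i).pl u = if φ u < i then 1 else 0 := by
    intro i u hu
    simp only [flowState, hu, true_and]
  have hne : ∀ x u, u < D.h → ((flowState D φ lam sl rk g x).pl u ≠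
      (flowState D φ lam sl rk g (x + 1)).pl u ↔ φ u = x) := by
    intro x u hu
    rw [hpl x u hu, hpl (x + 1) u hu]
    split <;> split <;> omega
  refine ⟨?_, ?_, ?_, ?_, ?_⟩
  · intro u hu
    rw [hpl 0 u hu, if_neg (by omega)]
  · intro t _
    exact hp.kd_eq_zero.2 fun a b h => by have := h.2.2; omega
  · intro x hx
    refine ⟨?_, ?_, fun t _ => hp.slotStep hx t, fun t _ t' _ => hp.pairStep hx t t', ?_⟩
    · intro u hu
      rw [hpl x u hu, hpl (x + 1) u hu]
      split <;> split <;> omega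
    · rw [Finset.card_le_one]
      intro u hu v hv
      rw [Finset.mem_filter, Finset.mem_range] at hu hv
      have h1 := (hne x u hu.1).1 hu.2
      have h2 := (hne x v hv.1).1 hv.2
      exact hp.flow.inj u hu.1 v hv.1 (h1.trans h2.symm)
    · intro l hl hR
      have hh : 0 < D.h := by
        rcases Nat.eq_zero_or_pos D.h with h0 | h0
        · simp [h0] at hl
        · exact h0
      have := hp.flow.balance x hx l hl hR
      rw [hp.card_in, hp.card_out] at this
      simp only [hne x _ (Nat.div_lt_of_lt_mul hl), hne x _ (Nat.mod_lt l hh)]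
      exact this
  · intro u hu
    rw [hpl D.n u hu, if_pos (hp.flow.lt u hu)]
  · intro t _
    refine hp.kd_eq_zero.2 fun a b h => ?_
    have h1 := h.2.2
    have h2 := hp.lam_lt h.1
    omega

/-- The states must fit into digits, and they must vanish outside the ranges where digits exist so
that decoding returns exactly these states. -/
theorem Plan.state_bounds (hp : D.Plan φ lam sl rk g) (i : ℕ) (hi : i ≤ D.n) :
    (∀ u, (flowState D φ lam sl rk g i).pl u ≤ 1) ∧
    (∀ u, D.h ≤ u → (flowState D φ lam sl rk g i).pl u = 0) ∧
    (∀ t, (flowState D φ lam sl rk g i).kd t ≤ 2 ∧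
      (flowState D φ lam sl rk g i).lb t ≤ D.h * D.h ∧
      (flowState D φ lam sl rk g i).nm t ≤ D.M + D.K) ∧
    ∀ t, D.K ≤ t → (flowState D φ lam sl rk g i).kd t = 0 ∧
      (flowState D φ lam sl rk g i).lb t = 0 ∧ (flowState D φ lam sl rk g i).nm t = 0 := by
  refine ⟨?_, ?_, ?_, ?_⟩
  · intro u
    simp only [flowState]
    split <;> omega
  · intro u hu
    simp only [flowState]
    rw [if_neg (by omega)]
  · intro t
    by_cases hex : ∃ p : ℕ × ℕ, Occ lam sl i t p.1 p.2
    · obtain ⟨⟨a, b⟩, h⟩ := hex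
      simp only at h
      have hl := h.1
      have hc := h.2.2
      obtain ⟨h1, h2, h3⟩ := hp.state_of_occ h
      obtain ⟨-, l, hl1, -, hl2⟩ := hp.flow.arc a b hl
      refine ⟨by rw [h1]; split <;> omega, by rw [h2]; omega, ?_⟩
      rw [h3]
      by_cases hg : a < b ∧ D.Generic i a
      · have := hp.g_lt i a b hl (by omega) (by omega)
        rw [name_generic hg]
        omega
      · have := (hp.name_special hi hl hc hg).1
        omega
    · obtain ⟨h1, h2, h3⟩ := state_of_not_occ (D := D) (φ := φ) (rk := rk) (g := g) hex
      rw [h1, h2, h3]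
      omega
  · intro t ht
    refine state_of_not_occ ?_
    rintro ⟨p, h⟩
    have := hp.sl_lt _ _ h.1
    have := h.2.1
    simp only [Prod.mk.eta] at *
    omega

/-- A flow gives rise to a sweep, if the backward arcs across each cut are few, and all vertices
at the left of a cut with a backward arc into them and all vertices at the right with a backward arc
from them have names. -/
theorem exists_plan (hF : IsFlow D.n D.h D.A D.R φ lam) {m k : ℕ} (hirr : ∀ a, ¬ D.A a a)
    (hlt : ∀ a b, D.A a b → a < D.n ∧ b < D.n) (hK : D.K = 4 * m + 2 * k)
    [DecidableRel D.A] [DecidablePred D.R]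
    (hm : ∀ i ≤ D.n, ((Finset.range i ×ˢ Finset.Ico i D.n).filter (fun p => D.A p.2 p.1)).card ≤ m)
    (hk : ((Finset.range (D.h * D.h)).filter D.R).card ≤ k)
    (hSP : ∀ i ≤ D.n, ∀ v, (v < i ∧ (∃ b, i ≤ b ∧ D.A b v)) ∨ (i ≤ v ∧ ∃ a < i, D.A v a) →
      ∃ r < D.M, D.SP i r = v) : ∃ sl rk g, D.Plan φ lam sl rk g := by
  classical
  obtain ⟨sl, h1, h2⟩ := hF.exists_slots hirr hm hk
  have hmem : ∀ a b, lam a b ≠ 0 → (a, b) ∈ usedArcs D.n lam := by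
    intro a b hab
    obtain ⟨h3, h4⟩ := hlt _ _ (hF.arc a b hab).1
    simp [usedArcs, h3, h4, hab]
  have hinj : ∀ a b a' b' x, lam a b ≠ 0 → lam a' b' ≠ 0 → min a b ≤ x → x ≤ max a b →
      min a' b' ≤ x → x ≤ max a' b' → sl (a, b) = sl (a', b') → a = a' ∧ b = b' := by
    intro a b a' b' x hab hab' h3 h4 h5 h6 h7
    exact Prod.mk_inj.1 (h2 _ (hmem a b hab) _ (hmem a' b' hab') x h3 h4 h5 h6 h7)
  -- A generic tail is named after the slot of one of its arcs over the cut: different tails have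
  -- different arcs, hence different slots. Without such an arc the value is irrelevant.
  have hg : ∀ i a, ∃ c, ∀ b, lam a b ≠ 0 → i ≤ b → ∃ b', lam a b' ≠ 0 ∧ i ≤ b' ∧
      c = sl (a, b') := by
    intro i a
    by_cases hex : ∃ b, lam a b ≠ 0 ∧ i ≤ b
    · obtain ⟨b, hb, hb'⟩ := hex
      exact ⟨sl (a, b), fun _ _ _ => ⟨b, hb, hb', rfl⟩⟩
    · exact ⟨0, fun b hb hb' => absurd ⟨b, hb, hb'⟩ hex⟩
  choose g hg using hg
  have hrk : ∀ i v, ∃ r, (∃ r < D.M, D.SP i r = v) → r < D.M ∧ D.SP i r = v := by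
    intro i v
    by_cases hex : ∃ r < D.M, D.SP i r = v
    · obtain ⟨r, hr⟩ := hex
      exact ⟨r, fun _ => hr⟩
    · exact ⟨0, fun h => absurd h hex⟩
  choose rk hrk using hrk
  refine ⟨sl, rk, g, hF, hlt, hirr, fun a b hab => hK ▸ h1 _ (hmem a b hab), hinj, ?_, ?_, ?_, ?_⟩
  · intro i hi v hv hgen
    unfold Generic at hgen
    push Not at hgen
    exact hrk i v (hSP i hi v (Or.inl ⟨hv, hgen⟩))
  · intro i hi v hv a ha hA
    exact hrk i v (hSP i hi v (Or.inr ⟨hv, a, ha, hA⟩))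
  · intro i a b hab _ hb
    obtain ⟨b', h3, _, h5⟩ := hg i a b hab hb
    rw [h5, hK]
    exact h1 _ (hmem a b' h3)
  · intro i a b a' b' hab ha hb hab' ha' hb' heq
    obtain ⟨c, h3, h4, h5⟩ := hg i a b hab hb
    obtain ⟨c', h3', h4', h5'⟩ := hg i a' b' hab' hb'
    exact (hinj a c a' c' i h3 h3' (by omega) (by omega) (by omega) (by omega)
      (by rw [← h5, ← h5', heq])).1

end SweepData
end DigraphImmersion

/-! ### Coding states by numbers, and reachability of codes -/

namespace DigraphImmersion

theorem exists_code (B : ℕ) : ∀ (L : ℕ) (f : ℕ → ℕ), (∀ j < L, f j < B) →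
    ∃ c < B ^ L, ∀ j < L, c / B ^ j % B = f j := by
  intro L
  induction L with
  | zero => intro f _; exact ⟨0, by simp⟩
  | succ L ih =>
    intro f hf
    obtain ⟨c, hc, hd⟩ := ih (fun j => f (j + 1)) (fun j hj => hf (j + 1) (by omega))
    have h0 : f 0 < B := hf 0 (by omega)
    have hB : 0 < B := by omega
    refine ⟨f 0 + B * c, ?_, ?_⟩
    · have : B * (c + 1) ≤ B * B ^ L := Nat.mul_le_mul_left _ hc
      rw [pow_succ']
      have h2 : B * (c + 1) = B * c + B := by ring
      omega
    · intro j hj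
      cases j with
      | zero => simp [Nat.mod_eq_of_lt h0]
      | succ j =>
        rw [pow_succ', ← Nat.div_div_eq_div_mul, Nat.add_mul_div_left _ _ hB,
          Nat.div_eq_of_lt h0, zero_add]
        exact hd j (by omega)

namespace SweepData

variable (D : SweepData)

/-- The base of the number system in which states are coded. -/
def base : ℕ := D.h * D.h + D.M + D.K + 3

/-- The number of codes of states. -/
def codes : ℕ := D.base ^ (D.h + 3 * D.K)

/-- The state with a given code. -/
def decode (c : ℕ) : SweepState where
  pl u := if u < D.h then c / D.base ^ u % D.base else 0
  kd t := if t < D.K then c / D.base ^ (D.h + t) % D.base else 0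
  lb t := if t < D.K then c / D.base ^ (D.h + D.K + t) % D.base else 0
  nm t := if t < D.K then c / D.base ^ (D.h + 2 * D.K + t) % D.base else 0

/-- The state with code `c` can be reached at the cut `i`. -/
def Mark : ℕ → ℕ → Prop
  | 0, c => c = 0
  | i + 1, c' => ∃ c < D.codes, Mark i c ∧ D.Step i (D.decode c) (D.decode c')

/-- The state belongs to the end of a complete sweep. -/
def Final (c : SweepState) : Prop := (∀ u < D.h, c.pl u = 1) ∧ ∀ t < D.K, c.kd t = 0

variable {D}

theorem decode_zero : D.decode 0 = ⟨fun _ => 0, fun _ => 0, fun _ => 0, fun _ => 0⟩ := by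
  simp [decode]

theorem exists_sweep_of_mark {c : ℕ} (hc : D.Mark D.n c) (hf : D.Final (D.decode c)) :
    ∃ s, D.Sweep s := by
  have key : ∀ i c, D.Mark i c → ∃ s : ℕ → SweepState, s 0 = D.decode 0 ∧ s i = D.decode c ∧
      ∀ x < i, D.Step x (s x) (s (x + 1)) := by
    intro i
    induction i with
    | zero => rintro c rfl; exact ⟨fun _ => D.decode 0, rfl, rfl, by simp⟩
    | succ i ih =>
      rintro c' ⟨c, -, h1, h2⟩
      obtain ⟨s, s0, si, hs⟩ := ih c h1
      refine ⟨Function.update s (i + 1) (D.decode c'), ?_, by simp, ?_⟩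
      · rw [Function.update_of_ne (by omega), s0]
      · intro x hx
        rw [Function.update_of_ne (show x ≠ i + 1 by omega)]
        by_cases hxi : x = i
        · subst hxi
          rw [Function.update_self, si]
          exact h2
        · rw [Function.update_of_ne (by omega)]
          exact hs x (by omega)
  obtain ⟨s, s0, sn, hs⟩ := key _ _ hc
  exact ⟨s, ⟨fun u _ => by simp [s0, decode_zero], fun t _ => by simp [s0, decode_zero], hs,
    fun u hu => by rw [sn]; exact hf.1 u hu, fun t ht => by rw [sn]; exact hf.2 t ht⟩⟩

/-- The digits come in four blocks: `h` bits for the placed vertices, then kinds, labels and names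
of the `K` slots. -/
theorem exists_decode_eq {s : SweepState} (h1 : ∀ u, s.pl u ≤ 1) (h2 : ∀ u, D.h ≤ u → s.pl u = 0)
    (h3 : ∀ t, s.kd t ≤ 2 ∧ s.lb t ≤ D.h * D.h ∧ s.nm t ≤ D.M + D.K)
    (h4 : ∀ t, D.K ≤ t → s.kd t = 0 ∧ s.lb t = 0 ∧ s.nm t = 0) :
    ∃ c < D.codes, D.decode c = s := by
  obtain ⟨c, hc, hd⟩ := exists_code D.base (D.h + 3 * D.K) (fun j =>
    if j < D.h then s.pl j else if j < D.h + D.K then s.kd (j - D.h) else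
    if j < D.h + 2 * D.K then s.lb (j - D.h - D.K) else s.nm (j - D.h - 2 * D.K)) (by
      intro j _
      have e1 := h1 j
      have e2 := h3 (j - D.h)
      have e3 := h3 (j - D.h - D.K)
      have e4 := h3 (j - D.h - 2 * D.K)
      unfold base
      split
      · omega
      split
      · omega
      split <;> omega)
  refine ⟨c, hc, ?_⟩
  ext t
  · simp only [decode]
    split
    · rw [hd t (by omega), if_pos (by omega)]
    · exact (h2 t (by omega)).symm
  · simp only [decode]
    split
    · rw [hd _ (by omega), if_neg (by omega), if_pos (by omega)]
      congr 1
      omega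
    · exact (h4 t (by omega)).1.symm
  · simp only [decode]
    split
    · rw [hd _ (by omega), if_neg (by omega), if_neg (by omega), if_pos (by omega)]
      congr 1
      omega
    · exact (h4 t (by omega)).2.1.symm
  · simp only [decode]
    split
    · rw [hd _ (by omega), if_neg (by omega), if_neg (by omega), if_neg (by omega)]
      congr 1
      omega
    · exact (h4 t (by omega)).2.2.symm

theorem Plan.exists_mark {φ : ℕ → ℕ} {lam : ℕ → ℕ → ℕ} {sl : ℕ × ℕ → ℕ} {rk g : ℕ → ℕ → ℕ}
    (hp : D.Plan φ lam sl rk g) : ∃ c < D.codes, D.Mark D.n c ∧ D.Final (D.decode c) := by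
  have key : ∀ i ≤ D.n, ∃ c < D.codes, D.Mark i c ∧ D.decode c = flowState D φ lam sl rk g i := by
    intro i
    induction i with
    | zero =>
      intro _
      -- Nothing is placed before cut 0 and no arc crosses it, so the state vanishes and has code 0.
      refine ⟨0, Nat.pow_pos (by unfold base; omega), rfl, ?_⟩
      rw [decode_zero]
      have hno : ∀ t, ¬ ∃ p : ℕ × ℕ, Occ lam sl 0 t p.1 p.2 := by
        rintro t ⟨p, h⟩
        have := h.2.2
        omega
      ext t
      · simp [flowState]
      · exact (state_of_not_occ (hno t)).1.symm
      · exact (state_of_not_occ (hno t)).2.1.symm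
      · exact (state_of_not_occ (hno t)).2.2.symm
    | succ i ih =>
      intro hi
      obtain ⟨c, hc, hm, hd⟩ := ih (by omega)
      obtain ⟨b1, b2, b3, b4⟩ := hp.state_bounds (i + 1) hi
      obtain ⟨c', hc', hd'⟩ := exists_decode_eq b1 b2 b3 b4
      exact ⟨c', hc', ⟨c, hc, hm, by rw [hd, hd']; exact hp.sweep.step i hi⟩, hd'⟩
  obtain ⟨c, hc, hm, hd⟩ := key D.n le_rfl
  exact ⟨c, hc, hm, by rw [hd]; exact ⟨hp.sweep.pl_end, hp.sweep.kd_end⟩⟩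

end SweepData
end DigraphImmersion

namespace WordRAM

/-! ### Terms as formulas -/

instance : Add Tm := ⟨.bin .add⟩
instance : Sub Tm := ⟨.bin .sub⟩
instance : Mul Tm := ⟨.bin .mul⟩
instance : Div Tm := ⟨.bin .div⟩
instance : Mod Tm := ⟨.bin .mod⟩
instance (n : ℕ) : OfNat Tm n := ⟨.const n⟩

namespace Tm

/-- A term is read as a formula: it holds if its value is not `0`. -/
def Holds (A : ℕ → ℕ → ℕ) (v : ℕ → ℕ) (e : Tm) : Prop := e.eval A v ≠ 0

def eq (a b : Tm) : Tm := .bin .eq a b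
def lt (a b : Tm) : Tm := .bin .lt a b
def not (a : Tm) : Tm := a.eq 0
def le (a b : Tm) : Tm := (b.lt a).not
def and (a b : Tm) : Tm := a * b
def or (a b : Tm) : Tm := a + b
def imp (a b : Tm) : Tm := a.not.or b
def bit (a : Tm) : Tm := Tm.lt 0 a
def iff (a b : Tm) : Tm := a.bit.eq b.bit
def all (x y : ℕ) (e : Tm) : Tm := (Tm.sum x y e.not).eq 0
def ex (x y : ℕ) (e : Tm) : Tm := .sum x y e

section Eval

variable {A : ℕ → ℕ → ℕ} {v : ℕ → ℕ} {a b e : Tm} {x y : ℕ}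

@[simp] theorem eval_var : (Tm.var x).eval A v = v x := rfl
@[simp] theorem eval_const : (Tm.const x).eval A v = x := rfl
@[simp] theorem eval_cell : (Tm.cell x a).eval A v = A x (a.eval A v) := rfl
@[simp] theorem eval_zero : (0 : Tm).eval A v = 0 := rfl
@[simp] theorem eval_one : (1 : Tm).eval A v = 1 := rfl
@[simp] theorem eval_two : (2 : Tm).eval A v = 2 := rfl
@[simp] theorem eval_add : (a + b).eval A v = a.eval A v + b.eval A v := rfl
@[simp] theorem eval_sub : (a - b).eval A v = a.eval A v - b.eval A v := rfl
@[simp] theorem eval_mul : (a * b).eval A v = a.eval A v * b.eval A v := rfl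
@[simp] theorem eval_div : (a / b).eval A v = a.eval A v / b.eval A v := rfl
@[simp] theorem eval_mod : (a % b).eval A v = a.eval A v % b.eval A v := rfl
@[simp] theorem eval_eq : (a.eq b).eval A v = if a.eval A v = b.eval A v then 1 else 0 := rfl
@[simp] theorem eval_lt : (a.lt b).eval A v = if a.eval A v < b.eval A v then 1 else 0 := rfl
@[simp] theorem eval_sum : (Tm.sum x y e).eval A v =
    ∑ j ∈ Finset.range (v y), e.eval A (Function.update v x j) := rfl

@[simp] theorem holds_eq : (a.eq b).Holds A v ↔ a.eval A v = b.eval A v := by simp [Holds]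
@[simp] theorem holds_lt : (a.lt b).Holds A v ↔ a.eval A v < b.eval A v := by simp [Holds]
@[simp] theorem holds_not : a.not.Holds A v ↔ ¬ a.Holds A v := by
  by_cases h : a.eval A v = 0 <;> simp [Holds, not, h]
@[simp] theorem holds_le : (a.le b).Holds A v ↔ a.eval A v ≤ b.eval A v := by simp [le]
@[simp] theorem holds_and : (a.and b).Holds A v ↔ a.Holds A v ∧ b.Holds A v := by
  simp [Holds, and]
@[simp] theorem holds_or : (a.or b).Holds A v ↔ a.Holds A v ∨ b.Holds A v := by
  simp only [Holds, or, eval_add]; omega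
@[simp] theorem holds_imp : (a.imp b).Holds A v ↔ (a.Holds A v → b.Holds A v) := by
  simp [imp, imp_iff_not_or]
open Classical in
theorem eval_bit : a.bit.eval A v = if a.Holds A v then 1 else 0 := by
  by_cases h : a.eval A v = 0 <;> simp [bit, Holds, h, Nat.pos_iff_ne_zero]
@[simp] theorem holds_iff : (a.iff b).Holds A v ↔ (a.Holds A v ↔ b.Holds A v) := by
  by_cases ha : a.Holds A v <;> by_cases hb : b.Holds A v <;> simp [iff, eval_bit, ha, hb]
@[simp] theorem holds_all : (Tm.all x y e).Holds A v ↔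
    ∀ j < v y, e.Holds A (Function.update v x j) := by
  simp only [all, holds_eq, eval_sum, eval_zero, Finset.sum_eq_zero_iff, Finset.mem_range]
  refine forall₂_congr fun j _ => ?_
  by_cases h : e.eval A (Function.update v x j) = 0 <;> simp [Holds, not, h]
@[simp] theorem holds_ex : (Tm.ex x y e).Holds A v ↔
    ∃ j < v y, e.Holds A (Function.update v x j) := by
  simp [ex, Holds, Finset.sum_eq_zero_iff]
open Classical in
theorem eval_sum_bit : (Tm.sum x y e.bit).eval A v =
    ((Finset.range (v y)).filter (fun j => e.Holds A (Function.update v x j))).card := by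
  simp only [eval_sum, eval_bit, Finset.card_filter]

end Eval

end Tm

/-! ### The transition condition of the sweep as a term -/

open DigraphImmersion

namespace SweepTm

/-- The variable `63` contains `i * S + c'` for a cut `i` and the code `c'` of a state. -/
def cut : Tm := .var 63 / .var 14
def new : Tm := .var 63 % .var 14
-- The vertex passed on the way from the previous cut to this one; at cut 0 the value is not used.
def vtx : Tm := cut - 1
def old : Tm := .var 50

def dig (c j : Tm) : Tm := (c / .cell 11 j) % .var 7
def pl (c u : Tm) : Tm := dig c u
def kd (c t : Tm) : Tm := dig c (.var 1 + t)
def lb (c t : Tm) : Tm := dig c (.var 1 + .var 6 + t)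
def nm (c t : Tm) : Tm := dig c (.var 1 + 2 * .var 6 + t)
def sp (i r : Tm) : Tm := .cell 10 (i * .var 5 + r)
def arc (a x : Tm) : Tm := .cell 5 (a * .var 0 + x)
-- Array 7 contains prefix sums of the columns. If the whole column sum of `w` equals the prefix up
-- to `i`, then no arc from a vertex from `i` on enters `w`.
def gen (i w : Tm) : Tm :=
  Tm.eq (.cell 7 (w * (.var 0 + 1) + .var 0)) (.cell 7 (w * (.var 0 + 1) + i))

/-- The alternatives are those of `SlotStep`, in this order: the slot stays empty; a forward arc
goes on, its tail staying special, becoming generic or being generic; a backward arc goes on; a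
forward arc ends at its head `x`; a backward arc ends at its tail `x`; a forward arc starts at its
tail `x`; a backward arc starts at its head `x`. -/
def slot (x c c' t : Tm) : Tm :=
  (((kd c t).eq 0).and ((kd c' t).eq 0)).or <|
  (((kd c t).eq 1).and <| ((kd c' t).eq 1).and <| ((lb c' t).eq (lb c t)).and <|
    (((nm c t).lt (.var 5)).and <| ((nm c' t).lt (.var 5)).and <|
      (sp x (nm c t)).eq (sp (x + 1) (nm c' t))).or <|
    (((nm c t).lt (.var 5)).and <| (Tm.le (.var 5) (nm c' t)).and <|
      gen (x + 1) (sp x (nm c t))).or <|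
    (Tm.le (.var 5) (nm c t)).and <| Tm.le (.var 5) (nm c' t)).or <|
  (((kd c t).eq 2).and <| ((kd c' t).eq 2).and <| ((lb c' t).eq (lb c t)).and <|
    ((sp x (nm c t)).eq (sp (x + 1) (nm c' t))).and <| ((sp x (nm c t)).eq x).not).or <|
  (((kd c t).eq 1).and <| ((kd c' t).eq 0).and <|
    (Tm.le (.var 5) (nm c t)).or (arc (sp x (nm c t)) x)).or <|
  (((kd c t).eq 2).and <| ((kd c' t).eq 0).and <| (sp x (nm c t)).eq x).or <|
  (((kd c t).eq 0).and <| ((kd c' t).eq 1).and <| ((lb c' t).lt (.var 2)).and <|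
    (Tm.cell 1 (lb c' t)).and <|
    (((nm c' t).lt (.var 5)).and <| (sp (x + 1) (nm c' t)).eq x).or <|
    (Tm.le (.var 5) (nm c' t)).and <| gen (x + 1) x).or <|
  ((kd c t).eq 0).and <| ((kd c' t).eq 2).and <| ((lb c' t).lt (.var 2)).and <|
    (Tm.cell 1 (lb c' t)).and <| (arc (sp (x + 1) (nm c' t)) x).and <|
    x.lt (sp (x + 1) (nm c' t))

/-- The first clause carries equality of tails from cut to cut. The other two keep one arc out of
two slots: forward arcs are compared where they end, backward arcs where they start. -/
def pair (x c c' t t' : Tm) : Tm :=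
  (((kd c' t).eq 1).imp <| ((kd c' t').eq 1).imp <| ((nm c' t).eq (nm c' t')).iff <|
    (((kd c t).eq 1).and <| ((kd c t').eq 1).and <| (nm c t).eq (nm c t')).or <|
    ((kd c t).eq 0).and <| (kd c t').eq 0).and <|
  ((t.eq t').not.imp <| ((kd c t).eq 1).imp <| ((kd c' t).eq 0).imp <| ((kd c t').eq 1).imp <|
    ((kd c' t').eq 0).imp ((nm c t).eq (nm c t')).not).and <|
  (t.eq t').not.imp <| ((kd c t).eq 0).imp <| ((kd c' t).eq 2).imp <| ((kd c t').eq 0).imp <|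
    ((kd c' t').eq 2).imp ((sp (x + 1) (nm c' t)).eq (sp (x + 1) (nm c' t'))).not

def changes (c c' : Tm) (k k' : ℕ) (lab : Tm) (l : Tm) : Tm :=
  .sum 52 6 (((kd c (.var 52)).eq (.const k)).and <| ((kd c' (.var 52)).eq (.const k')).and <|
    lab.eq l).bit

def balance (c c' l : Tm) : Tm :=
  Tm.eq (changes c c' 1 0 (lb c (.var 52)) l + changes c c' 0 2 (lb c' (.var 52)) l +
      ((pl c (l / .var 1)).eq (pl c' (l / .var 1))).not)
    (changes c c' 2 0 (lb c (.var 52)) l + changes c c' 0 1 (lb c' (.var 52)) l +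
      ((pl c (l % .var 1)).eq (pl c' (l % .var 1))).not)

def step : Tm :=
  (Tm.all 51 1 (((pl old (.var 51)).le (pl new (.var 51))).and ((pl new (.var 51)).le 1))).and <|
  ((Tm.sum 51 1 ((pl old (.var 51)).eq (pl new (.var 51))).not.bit).le 1).and <|
  (Tm.all 51 6 (slot vtx old new (.var 51))).and <|
  (Tm.all 51 6 (Tm.all 52 6 (pair vtx old new (.var 51) (.var 52)))).and <|
  Tm.all 51 2 ((Tm.cell 1 (.var 51)).imp (balance old new (.var 51)))

/-- The arrays and variables contain the data of the sweep. -/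
structure Env (D : SweepData) (A : ℕ → ℕ → ℕ) (v : ℕ → ℕ) : Prop where
  n : v 0 = D.n
  h : v 1 = D.h
  hh : v 2 = D.h * D.h
  M : v 5 = D.M
  K : v 6 = D.K
  B : v 7 = D.base
  S : v 14 = D.codes
  R : ∀ l < D.h * D.h, A 1 l ≠ 0 ↔ D.R l
  T : ∀ a x, x < D.n → (A 5 (a * D.n + x) ≠ 0 ↔ D.A a x)
  C : ∀ w i, i ≤ D.n → (A 7 (w * (D.n + 1) + D.n) = A 7 (w * (D.n + 1) + i) ↔ D.Generic i w)
  SP : ∀ i r, A 10 (i * D.M + r) = D.SP i r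
  pw : ∀ j ≤ D.h + 3 * D.K, A 11 j = D.base ^ j

section

variable {D : SweepData} {A : ℕ → ℕ → ℕ} {v : ℕ → ℕ}

/-- All bound variables of the terms have numbers from 50 on, while the data are in variables below
50. -/
theorem Env.update (hE : Env D A v) {x : ℕ} (hx : 50 ≤ x) (j : ℕ) :
    Env D A (Function.update v x j) := by
  have h : ∀ y < 50, Function.update v x j y = v y := fun y hy =>
    Function.update_of_ne (by omega) _ _
  exact ⟨by rw [h _ (by omega), hE.n], by rw [h _ (by omega), hE.h], by rw [h _ (by omega), hE.hh],
    by rw [h _ (by omega), hE.M], by rw [h _ (by omega), hE.K], by rw [h _ (by omega), hE.B],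
    by rw [h _ (by omega), hE.S], hE.R, hE.T, hE.C, hE.SP, hE.pw⟩

theorem Env.eval_pl (hE : Env D A v) {c u : Tm} (hu : u.eval A v < D.h) :
    (pl c u).eval A v = (D.decode (c.eval A v)).pl (u.eval A v) := by
  simp [pl, dig, SweepData.decode, hu, hE.B, hE.pw _ (show u.eval A v ≤ D.h + 3 * D.K by omega)]

variable {x c c' t t' : Tm}

theorem Env.eval_kd (hE : Env D A v) (ht : t.eval A v < D.K) :
    (kd c t).eval A v = (D.decode (c.eval A v)).kd (t.eval A v) := by
  simp [kd, dig, SweepData.decode, ht, hE.B, hE.h,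
    hE.pw _ (show D.h + t.eval A v ≤ D.h + 3 * D.K by omega)]

theorem Env.eval_lb (hE : Env D A v) (ht : t.eval A v < D.K) :
    (lb c t).eval A v = (D.decode (c.eval A v)).lb (t.eval A v) := by
  simp [lb, dig, SweepData.decode, ht, hE.B, hE.h, hE.K,
    hE.pw _ (show D.h + D.K + t.eval A v ≤ D.h + 3 * D.K by omega)]

theorem Env.eval_nm (hE : Env D A v) (ht : t.eval A v < D.K) :
    (nm c t).eval A v = (D.decode (c.eval A v)).nm (t.eval A v) := by
  simp [nm, dig, SweepData.decode, ht, hE.B, hE.h, hE.K,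
    hE.pw _ (show D.h + 2 * D.K + t.eval A v ≤ D.h + 3 * D.K by omega)]

theorem Env.eval_sp (hE : Env D A v) (i r : Tm) :
    (sp i r).eval A v = D.SP (i.eval A v) (r.eval A v) := by
  simp [sp, hE.M, hE.SP]

theorem Env.holds_arc (hE : Env D A v) {a : Tm} (hx : x.eval A v < D.n) :
    (arc a x).Holds A v ↔ D.A (a.eval A v) (x.eval A v) := by
  simp only [arc, Tm.Holds, Tm.eval_cell, Tm.eval_add, Tm.eval_mul, Tm.eval_var, hE.n]
  exact hE.T _ _ hx

theorem Env.holds_gen (hE : Env D A v) {w i : Tm} (hi : i.eval A v ≤ D.n) :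
    (gen i w).Holds A v ↔ D.Generic (i.eval A v) (w.eval A v) := by
  simp only [gen, Tm.holds_eq, Tm.eval_cell, Tm.eval_add, Tm.eval_mul, Tm.eval_var, hE.n,
    Tm.eval_one]
  exact hE.C _ _ hi

theorem Env.holds_label (hE : Env D A v) {l : Tm} :
    (l.eval A v < D.h * D.h ∧ (Tm.cell 1 l).Holds A v ↔
      l.eval A v < D.h * D.h ∧ D.R (l.eval A v)) :=
  and_congr_right fun h => hE.R _ h

theorem Env.holds_slot (hE : Env D A v) (ht : t.eval A v < D.K) (hx : x.eval A v < D.n) :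
    (slot x c c' t).Holds A v ↔ D.SlotStep (x.eval A v) (D.decode (c.eval A v))
      (D.decode (c'.eval A v)) (t.eval A v) := by
  have hl : ∀ (l : Tm) (q : Prop), (l.eval A v < D.h * D.h ∧ (Tm.cell 1 l).Holds A v ∧ q ↔
      l.eval A v < D.h * D.h ∧ D.R (l.eval A v) ∧ q) := by
    intro l q
    rw [← and_assoc, ← and_assoc, hE.holds_label]
  have hx1 : (x + 1).eval A v ≤ D.n := hx
  simp only [slot, Tm.holds_or, Tm.holds_and, Tm.holds_eq, Tm.holds_lt, Tm.holds_le, Tm.holds_not,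
    Tm.eval_var, hE.hh, hE.M, hl]
  simp only [hE.holds_arc hx, hE.holds_gen hx1, hE.eval_kd ht, hE.eval_lb ht, hE.eval_nm ht,
    hE.eval_sp, Tm.eval_zero, Tm.eval_one, Tm.eval_two, Tm.eval_add, SweepData.SlotStep, ne_eq]

theorem Env.holds_pair (hE : Env D A v) (ht : t.eval A v < D.K) (ht' : t'.eval A v < D.K) :
    (pair x c c' t t').Holds A v ↔ D.PairStep (x.eval A v) (D.decode (c.eval A v))
      (D.decode (c'.eval A v)) (t.eval A v) (t'.eval A v) := by
  simp only [pair, Tm.holds_or, Tm.holds_and, Tm.holds_eq, Tm.holds_imp, Tm.holds_iff, Tm.holds_not,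
    hE.eval_kd ht, hE.eval_nm ht, hE.eval_kd ht', hE.eval_nm ht', hE.eval_sp, Tm.eval_zero,
    Tm.eval_one, Tm.eval_two, Tm.eval_add, SweepData.PairStep, ne_eq]

open Classical in
theorem Env.eval_changes (hE : Env D A v) {c c' l : Tm} {k k' : ℕ} {lab : Tm} {f : ℕ → ℕ}
    (hc : ∀ j, c.eval A (Function.update v 52 j) = c.eval A v)
    (hc' : ∀ j, c'.eval A (Function.update v 52 j) = c'.eval A v)
    (hl : ∀ j, l.eval A (Function.update v 52 j) = l.eval A v)
    (hlab : ∀ j < D.K, lab.eval A (Function.update v 52 j) = f j) :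
    (changes c c' k k' lab l).eval A v =
      D.changes (D.decode (c.eval A v)) (D.decode (c'.eval A v)) k k' f (l.eval A v) := by
  rw [changes, Tm.eval_sum_bit, SweepData.changes, hE.K]
  congr 1
  refine Finset.filter_congr fun j hj => ?_
  have hj := Finset.mem_range.1 hj
  have hE' := hE.update (x := 52) (by omega) j
  have ht : (Tm.var 52).eval A (Function.update v 52 j) < D.K := by simpa using hj
  simp only [Tm.holds_and, Tm.holds_eq, hE'.eval_kd ht, hc, hc', hl, hlab j hj, Tm.eval_const,
    Tm.eval_var, Function.update_self]

theorem Env.holds_balance (hE : Env D A v) {c c' l : Tm}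
    (hc : ∀ j, c.eval A (Function.update v 52 j) = c.eval A v)
    (hc' : ∀ j, c'.eval A (Function.update v 52 j) = c'.eval A v)
    (hl : ∀ j, l.eval A (Function.update v 52 j) = l.eval A v) (hlt : l.eval A v < D.h * D.h) :
    (balance c c' l).Holds A v ↔
    D.changes (D.decode (c.eval A v)) (D.decode (c'.eval A v)) 1 0 (D.decode (c.eval A v)).lb
        (l.eval A v) +
      D.changes (D.decode (c.eval A v)) (D.decode (c'.eval A v)) 0 2 (D.decode (c'.eval A v)).lb
        (l.eval A v) +
      (if (D.decode (c.eval A v)).pl (l.eval A v / D.h) ≠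
        (D.decode (c'.eval A v)).pl (l.eval A v / D.h) then 1 else 0) =
    D.changes (D.decode (c.eval A v)) (D.decode (c'.eval A v)) 2 0 (D.decode (c.eval A v)).lb
        (l.eval A v) +
      D.changes (D.decode (c.eval A v)) (D.decode (c'.eval A v)) 0 1 (D.decode (c'.eval A v)).lb
        (l.eval A v) +
      (if (D.decode (c.eval A v)).pl (l.eval A v % D.h) ≠
        (D.decode (c'.eval A v)).pl (l.eval A v % D.h) then 1 else 0) := by
  have hh : 0 < D.h := by
    rcases Nat.eq_zero_or_pos D.h with h0 | h0
    · simp [h0] at hlt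
    · exact h0
  have hd : (l / .var 1).eval A v < D.h := by
    simpa [hE.h] using Nat.div_lt_of_lt_mul hlt
  have hm : (l % .var 1).eval A v < D.h := by
    simpa [hE.h] using Nat.mod_lt _ hh
  have hlab : ∀ d : Tm, (∀ j, d.eval A (Function.update v 52 j) = d.eval A v) → ∀ j < D.K,
      (lb d (.var 52)).eval A (Function.update v 52 j) = (D.decode (d.eval A v)).lb j := by
    intro d hd j hj
    have ht : (Tm.var 52).eval A (Function.update v 52 j) < D.K := by simpa using hj
    rw [(hE.update (x := 52) (by omega) j).eval_lb ht, hd]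
    simp
  have hnot : ∀ a b : Tm, ((a.eq b).not).eval A v =
      if a.eval A v ≠ b.eval A v then 1 else 0 := by
    intro a b
    by_cases h : a.eval A v = b.eval A v <;> simp [Tm.not, h]
  rw [balance, Tm.holds_eq]
  simp only [Tm.eval_add, hE.eval_changes hc hc' hl (hlab c hc),
    hE.eval_changes hc hc' hl (hlab c' hc'), hnot, hE.eval_pl hd, hE.eval_pl hm, Tm.eval_div,
    Tm.eval_mod, Tm.eval_var, hE.h]

theorem eval_new_update {y j : ℕ} (hy : y ≠ 63) (hy14 : y ≠ 14) :
    new.eval A (Function.update v y j) = new.eval A v := by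
  simp [new, hy.symm, hy14.symm]

theorem eval_vtx_update {y j : ℕ} (hy : y ≠ 63) (hy14 : y ≠ 14) :
    vtx.eval A (Function.update v y j) = vtx.eval A v := by
  simp [vtx, cut, hy.symm, hy14.symm]

theorem eval_old_update {y j : ℕ} (hy : y ≠ 50) :
    old.eval A (Function.update v y j) = old.eval A v := by
  simp [old, hy.symm]

theorem Env.holds_step (hE : Env D A v) (hx : vtx.eval A v < D.n) :
    step.Holds A v ↔
      D.Step (vtx.eval A v) (D.decode (old.eval A v)) (D.decode (new.eval A v)) := by
  classical
  have hE1 : ∀ j, Env D A (Function.update v 51 j) := fun j => hE.update (by omega) j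
  have hE2 : ∀ j j', Env D A (Function.update (Function.update v 51 j) 52 j') :=
    fun j j' => (hE1 j).update (by omega) j'
  have o1 : ∀ j, old.eval A (Function.update v 51 j) = old.eval A v :=
    fun j => eval_old_update (by omega)
  have n1 : ∀ j, new.eval A (Function.update v 51 j) = new.eval A v :=
    fun j => eval_new_update (by omega) (by omega)
  have x1 : ∀ j, vtx.eval A (Function.update v 51 j) = vtx.eval A v :=
    fun j => eval_vtx_update (by omega) (by omega)
  have o2 : ∀ j j', old.eval A (Function.update (Function.update v 51 j) 52 j') = old.eval A v :=
    fun j j' => (eval_old_update (by omega)).trans (o1 j)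
  have n2 : ∀ j j', new.eval A (Function.update (Function.update v 51 j) 52 j') = new.eval A v :=
    fun j j' => (eval_new_update (by omega) (by omega)).trans (n1 j)
  have x2 : ∀ j j', vtx.eval A (Function.update (Function.update v 51 j) 52 j') = vtx.eval A v :=
    fun j j' => (eval_vtx_update (by omega) (by omega)).trans (x1 j)
  have h1 : (∀ j < D.h, ((((pl old (.var 51)).le (pl new (.var 51))).and
      ((pl new (.var 51)).le 1)).Holds A (Function.update v 51 j))) ↔ ∀ u < D.h,
      (D.decode (old.eval A v)).pl u ≤ (D.decode (new.eval A v)).pl u ∧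
      (D.decode (new.eval A v)).pl u ≤ 1 := by
    refine forall₂_congr fun j hj => ?_
    have ht : (Tm.var 51).eval A (Function.update v 51 j) < D.h := by simpa using hj
    simp only [Tm.holds_and, Tm.holds_le, (hE1 j).eval_pl ht, o1, n1, Tm.eval_one, Tm.eval_var,
      Function.update_self]
  have h2 : (Tm.sum 51 1 ((pl old (.var 51)).eq (pl new (.var 51))).not.bit).eval A v =
      ((Finset.range D.h).filter (fun u => (D.decode (old.eval A v)).pl u ≠
        (D.decode (new.eval A v)).pl u)).card := by
    rw [Tm.eval_sum_bit, hE.h]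
    congr 1
    refine Finset.filter_congr fun j hj => ?_
    have hj := Finset.mem_range.1 hj
    have ht : (Tm.var 51).eval A (Function.update v 51 j) < D.h := by simpa using hj
    simp only [Tm.holds_not, Tm.holds_eq, (hE1 j).eval_pl ht, o1, n1, Tm.eval_var,
      Function.update_self, ne_eq]
  have h3 : (∀ j < D.K, (slot vtx old new (.var 51)).Holds A (Function.update v 51 j)) ↔
      ∀ t < D.K, D.SlotStep (vtx.eval A v) (D.decode (old.eval A v)) (D.decode (new.eval A v)) t := by
    refine forall₂_congr fun j hj => ?_
    rw [(hE1 j).holds_slot (by simpa using hj) (by rwa [x1]), o1, n1, x1]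
    simp
  have h4 : (∀ j < D.K, ∀ j' < D.K, (pair vtx old new (.var 51) (.var 52)).Holds A
      (Function.update (Function.update v 51 j) 52 j')) ↔ ∀ t < D.K, ∀ t' < D.K,
      D.PairStep (vtx.eval A v) (D.decode (old.eval A v)) (D.decode (new.eval A v)) t t' := by
    refine forall₂_congr fun j hj => forall₂_congr fun j' hj' => ?_
    rw [(hE2 j j').holds_pair (by simpa using hj) (by simpa using hj'), o2, n2, x2]
    simp
  have h5 : (∀ j < D.h * D.h, (Tm.cell 1 (.var 51)).Holds A (Function.update v 51 j) →
      (balance old new (.var 51)).Holds A (Function.update v 51 j)) ↔ ∀ l < D.h * D.h, D.R l →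
      D.changes (D.decode (old.eval A v)) (D.decode (new.eval A v)) 1 0
        (D.decode (old.eval A v)).lb l +
      D.changes (D.decode (old.eval A v)) (D.decode (new.eval A v)) 0 2
        (D.decode (new.eval A v)).lb l +
      (if (D.decode (old.eval A v)).pl (l / D.h) ≠ (D.decode (new.eval A v)).pl (l / D.h)
        then 1 else 0) =
      D.changes (D.decode (old.eval A v)) (D.decode (new.eval A v)) 2 0
        (D.decode (old.eval A v)).lb l +
      D.changes (D.decode (old.eval A v)) (D.decode (new.eval A v)) 0 1
        (D.decode (new.eval A v)).lb l +
      (if (D.decode (old.eval A v)).pl (l % D.h) ≠ (D.decode (new.eval A v)).pl (l % D.h)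
        then 1 else 0) := by
    refine forall₂_congr fun j hj => ?_
    refine imp_congr ?_ ?_
    · rw [← hE.R j hj]
      simp [Tm.Holds]
    · rw [(hE1 j).holds_balance (fun j' => by rw [o2, o1]) (fun j' => by rw [n2, n1])
        (fun j' => by simp) (by simpa using hj), o1, n1]
      simp only [Tm.eval_var, Function.update_self]
  have hupd6 : ∀ j, Function.update v 51 j 6 = D.K := fun j => by simp [hE.K]
  rw [step, Tm.holds_and, Tm.holds_and, Tm.holds_and, Tm.holds_and, Tm.holds_all, Tm.holds_all,
    Tm.holds_all, Tm.holds_all, Tm.holds_le, hE.h, hE.K, hE.hh, Tm.eval_one, h2, h3]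
  simp only [Tm.holds_all, hupd6, Tm.holds_imp]
  rw [h1, h4, h5]
  exact ⟨fun ⟨a, b, c, d, e⟩ => ⟨a, b, c, d, e⟩, fun h => ⟨h.1, h.2, h.3, h.4, h.5⟩⟩

/-- The table of the reachable states. -/
def mark : Tm :=
  (((cut.eq 0).and (new.eq 0)).or <| (Tm.lt 0 cut).and <|
    Tm.ex 50 14 ((Tm.cell 12 (vtx * .var 14 + old)).and step)).bit

-- The entry for the cut `i` refers only to the row of the cut `i - 1` of the same array, which
-- precedes it; hence `h12` is available when the cell is filled.
open Classical in
theorem Env.eval_mark (hE : Env D A v) {i c' : ℕ} (hi : i ≤ D.n) (hc' : c' < D.codes)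
    (h63 : v 63 = i * D.codes + c')
    (h12 : ∀ j < i, ∀ c < D.codes, A 12 (j * D.codes + c) = bit (D.Mark j c)) :
    mark.eval A v = bit (D.Mark i c') := by
  have hS : 0 < D.codes := by omega
  have hcut : cut.eval A v = i := by
    simp only [cut, Tm.eval_div, Tm.eval_var, h63, hE.S]
    rw [mul_comm, Nat.mul_add_div hS, Nat.div_eq_of_lt hc', add_zero]
  have hnew : new.eval A v = c' := by
    simp only [new, Tm.eval_mod, Tm.eval_var, h63, hE.S]
    rw [mul_comm, Nat.mul_add_mod, Nat.mod_eq_of_lt hc']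
  have hvtx : vtx.eval A v = i - 1 := by simp [vtx, hcut]
  unfold mark
  rw [Tm.eval_bit]
  unfold bit
  congr 1
  rw [Tm.holds_or, Tm.holds_and, Tm.holds_and, Tm.holds_eq, Tm.holds_eq, Tm.holds_lt, Tm.holds_ex,
    hcut, hnew, hE.S, Tm.eval_zero]
  refine propext ?_
  cases i with
  | zero => simp [SweepData.Mark]
  | succ i =>
    have hx : ∀ c, vtx.eval A (Function.update v 50 c) = i := by
      intro c
      rw [eval_vtx_update (by omega) (by omega), hvtx]
      rfl
    have key : ∀ c < D.codes, (((Tm.cell 12 (vtx * .var 14 + old)).and step).Holds A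
        (Function.update v 50 c) ↔
        D.Mark i c ∧ D.Step i (D.decode c) (D.decode c')) := by
      intro c hc
      have ho : old.eval A (Function.update v 50 c) = c := by simp [old]
      rw [Tm.holds_and, (hE.update (by omega) c).holds_step (by rw [hx]; omega), hx, ho,
        eval_new_update (by omega) (by omega), hnew]
      refine and_congr_left fun _ => ?_
      simp only [Tm.Holds, Tm.eval_cell, Tm.eval_add, Tm.eval_mul, hx, ho, Tm.eval_var,
        Function.update_of_ne (show (14 : ℕ) ≠ 50 by omega), hE.S, h12 i (by omega) c hc, bit]
      simp
    simp only [SweepData.Mark]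
    constructor
    · rintro (h | ⟨_, c, hc, h⟩)
      · omega
      · exact ⟨c, hc, (key c hc).1 h⟩
    · rintro ⟨c, hc, h⟩
      exact Or.inr ⟨by omega, c, hc, (key c hc).2 h⟩

end

end SweepTm

end WordRAM

namespace WordRAM

open DigraphImmersion

/-! ### The tables of the algorithm -/

/-- An input of the algorithm: two numbers and two arrays of bits. -/
structure Input where
  n : ℕ
  h : ℕ
  a : ℕ → ℕ
  b : ℕ → ℕ
  a_le : ∀ i, a i ≤ 1
  b_le : ∀ i, b i ≤ 1

/-- A table with `N` entries. -/
def tab (N : ℕ) (f : ℕ → ℕ) (j : ℕ) : ℕ := if j < N then f j else 0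

theorem tab_of_lt {N j : ℕ} {f : ℕ → ℕ} (hj : j < N) : tab N f j = f j := if_pos hj

theorem tab_of_le {N j : ℕ} {f : ℕ → ℕ} (hj : N ≤ j) : tab N f j = 0 := if_neg (by omega)

theorem tab_le {N X : ℕ} {f : ℕ → ℕ} (hf : ∀ j < N, f j ≤ X) (j : ℕ) : tab N f j ≤ X := by
  unfold tab
  split
  · exact hf j ‹_›
  · omega

theorem sum_range_le {n c : ℕ} {f : ℕ → ℕ} (hf : ∀ j < n, f j ≤ c) :
    ∑ j ∈ Finset.range n, f j ≤ n * c := by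
  simpa using Finset.sum_le_card_nsmul (Finset.range n) f c (fun j hj => hf j (Finset.mem_range.1 hj))

namespace Input

variable (I : Input)

/-- The size of the second digraph. -/
def k : ℕ := I.h + ∑ l ∈ Finset.range (I.h * I.h), I.b l

/-- The largest admissible number of backward arcs over a cut. -/
def m : ℕ := 40000 * I.k * I.k

/-- The base and the number of the digits of a code. -/
def B : ℕ := I.h * I.h + 2 * I.m + (4 * I.m + 2 * I.k) + 3

def L : ℕ := I.h + 3 * (4 * I.m + 2 * I.k)

def S : ℕ := I.B ^ I.L

def outdeg (u : ℕ) : ℕ := ∑ v ∈ Finset.range I.n, I.a (u * I.n + v)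

/-- The position of a vertex in an order with decreasing outdegrees. -/
def pos (u : ℕ) : ℕ := ∑ v ∈ Finset.range I.n,
  ((if I.outdeg u < I.outdeg v then 1 else 0) +
    (if I.outdeg v = I.outdeg u then 1 else 0) * (if v < u then 1 else 0))

/-- The vertex at a position. -/
def vert (p : ℕ) : ℕ := ∑ u ∈ Finset.range I.n, u * (if I.pos u = p then 1 else 0)

/-- The adjacency matrix with respect to positions. -/
def arc (x y : ℕ) : ℕ := I.a (I.vert x * I.n + I.vert y)

def rowSum (v i : ℕ) : ℕ := ∑ x ∈ Finset.range i, I.arc v x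

def colSum (v i : ℕ) : ℕ := ∑ x ∈ Finset.range i, I.arc x v

/-- The number of backward arcs over a cut. -/
def width (i : ℕ) : ℕ := ∑ v ∈ Finset.range I.n,
  (if v < i then 1 else 0) * (I.colSum v I.n - I.colSum v i)

/-- Whether a vertex is incident with a backward arc over a cut. -/
def special (i v : ℕ) : ℕ :=
  (if v < i then 1 else 0) * (if I.colSum v i < I.colSum v I.n then 1 else 0) +
    (if v < i then 0 else 1) * (if 0 < I.rowSum v i then 1 else 0)

def rank (i v : ℕ) : ℕ := ∑ u ∈ Finset.range v, I.special i u

/-- The special vertex of given rank at a cut. -/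
def nth (i r : ℕ) : ℕ := ∑ v ∈ Finset.range I.n,
  v * I.special i v * (if I.rank i v = r then 1 else 0)

def nthCell : ℕ → ℕ :=
  tab ((I.n + 1) * (2 * I.m)) (fun j => I.nth (j / (2 * I.m)) (j % (2 * I.m)))

/-- The data of the sweep. -/
def D : SweepData where
  n := I.n
  h := I.h
  K := 4 * I.m + 2 * I.k
  M := 2 * I.m
  A x y := x < I.n ∧ y < I.n ∧ I.arc x y ≠ 0
  R l := I.b l ≠ 0
  SP i r := I.nthCell (i * (2 * I.m) + r)

theorem codes_D : I.D.codes = I.S := rfl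

/-- The final values of the variables. -/
def val : ℕ → ℕ
  | 0 => I.n
  | 1 => I.h
  | 2 => I.h * I.h
  | 3 => I.k
  | 4 => I.m
  | 5 => 2 * I.m
  | 6 => 4 * I.m + 2 * I.k
  | 7 => I.B
  | 8 => I.L + 1
  | 9 => I.n * I.n
  | 10 => I.n + 1
  | 11 => I.n * (I.n + 1)
  | 12 => (I.n + 1) * (I.n + 1)
  | 13 => (I.n + 1) * (2 * I.m)
  | 14 => I.S
  | 15 => (I.n + 1) * I.S
  | _ => 0

/-- The final contents of the arrays. -/
noncomputable def cells : ℕ → ℕ → ℕ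
  | 0 => I.a
  | 1 => I.b
  | 2 => tab I.n I.outdeg
  | 3 => tab I.n I.pos
  | 4 => tab I.n I.vert
  | 5 => tab (I.n * I.n) (fun j => I.arc (j / I.n) (j % I.n))
  | 6 => tab (I.n * (I.n + 1)) (fun j => I.rowSum (j / (I.n + 1)) (j % (I.n + 1)))
  | 7 => tab (I.n * (I.n + 1)) (fun j => I.colSum (j / (I.n + 1)) (j % (I.n + 1)))
  | 8 => tab (I.n + 1) I.width
  | 9 => tab ((I.n + 1) * (I.n + 1)) (fun j => I.rank (j / (I.n + 1)) (j % (I.n + 1)))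
  | 10 => I.nthCell
  | 11 => tab (I.L + 1) (fun j => I.B ^ j)
  | 12 => tab ((I.n + 1) * I.S) (fun j => bit (I.D.Mark (j / I.S) (j % I.S)))
  | _ => fun _ => 0

/-- A bound for all values that do not depend on the first digraph. -/
def Y : ℕ := I.B ^ (I.L + 1)

/-- A bound for all variables, array cells and constants. -/
def X : ℕ := 40000 * I.Y * (I.n + 2) ^ 2

theorem B_le_Y : I.B ≤ I.Y := Nat.le_self_pow (by omega) _

theorem three_le_B : 3 ≤ I.B := by unfold B; omega

theorem S_le_Y : I.S ≤ I.Y := Nat.pow_le_pow_right (by have := I.three_le_B; omega) (by omega)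

theorem L_lt_S : I.L < I.S := Nat.lt_pow_self (by have := I.three_le_B; omega)

theorem h_le_k : I.h ≤ I.k := Nat.le_add_right _ _

theorem le_X {t : ℕ} (c : ℕ) (hc : c ≤ 40000) (ht : t ≤ c * (I.n + 2) ^ 2) : t ≤ I.X := by
  have h1 : 1 ≤ I.Y := by have := I.B_le_Y; have := I.three_le_B; omega
  calc t ≤ c * (I.n + 2) ^ 2 := ht
    _ ≤ 40000 * I.Y * (I.n + 2) ^ 2 := Nat.mul_le_mul_right _ (by nlinarith)

theorem le_X_of_le_Y {t : ℕ} (ht : t ≤ I.Y * (I.n + 2)) : t ≤ I.X := by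
  unfold X
  calc t ≤ I.Y * (I.n + 2) := ht
    _ ≤ (40000 * I.Y) * (I.n + 2) ^ 2 :=
      Nat.mul_le_mul (by omega) (Nat.le_self_pow (by omega) _)

/-- These are variables that do not depend on `n`. The limits of all sums in the transition
condition are among them, so its evaluation time is bounded in terms of `H` alone. -/
theorem val_le_Y {x : ℕ} (hx : x ∈ [1, 2, 3, 4, 5, 6, 7, 8, 14]) : I.val x ≤ I.Y := by
  have h1 := I.B_le_Y
  have h2 := I.S_le_Y
  have h3 := I.L_lt_S
  have h4 := I.h_le_k
  have h5 : I.B = I.h * I.h + 2 * I.m + (4 * I.m + 2 * I.k) + 3 := rfl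
  simp only [List.mem_cons, List.not_mem_nil, or_false] at hx
  rcases hx with rfl | rfl | rfl | rfl | rfl | rfl | rfl | rfl | rfl <;> simp only [val] <;> omega

theorem val_le (x : ℕ) : I.val x ≤ I.X := by
  have hy : ∀ z, z ≤ I.Y → z ≤ I.X := fun z hz => I.le_X_of_le_Y (hz.trans
    (Nat.le_mul_of_pos_right _ (by omega)))
  by_cases hx : x ∈ [1, 2, 3, 4, 5, 6, 7, 8, 14]
  · exact hy _ (I.val_le_Y hx)
  · have hM : 2 * I.m ≤ I.Y := I.val_le_Y (x := 5) (by simp)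
    have hS := I.S_le_Y
    unfold val
    split
    case h_1 => exact I.le_X 1 (by omega) (by nlinarith)
    case h_10 => exact I.le_X 1 (by omega) (by nlinarith)
    case h_11 => exact I.le_X 1 (by omega) (by nlinarith)
    case h_12 => exact I.le_X 1 (by omega) (by nlinarith)
    case h_13 => exact I.le_X 1 (by omega) (by nlinarith)
    case h_14 => exact I.le_X_of_le_Y (by nlinarith)
    case h_16 => exact I.le_X_of_le_Y (by nlinarith)
    case h_17 => exact Nat.zero_le _
    all_goals simp at hx

theorem arc_le (x y : ℕ) : I.arc x y ≤ 1 := I.a_le _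

theorem outdeg_le (u : ℕ) : I.outdeg u ≤ I.n :=
  (sum_range_le fun _ _ => I.a_le _).trans (by simp)

theorem pos_le (u : ℕ) : I.pos u ≤ I.n * 2 :=
  sum_range_le fun _ _ => by split_ifs <;> simp

theorem vert_le (p : ℕ) : I.vert p ≤ I.n * I.n :=
  sum_range_le fun j hj => by split_ifs <;> omega

theorem rowSum_le (v i : ℕ) : I.rowSum v i ≤ i :=
  (sum_range_le fun _ _ => I.arc_le _ _).trans (by simp)

theorem colSum_le (v i : ℕ) : I.colSum v i ≤ i :=
  (sum_range_le fun _ _ => I.arc_le _ _).trans (by simp)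

theorem width_le (i : ℕ) : I.width i ≤ I.n * I.n :=
  sum_range_le fun v _ => by
    have := I.colSum_le v I.n
    split_ifs <;> omega

theorem special_le (i v : ℕ) : I.special i v ≤ 1 := by
  unfold special
  split_ifs <;> simp

theorem rank_le (i v : ℕ) : I.rank i v ≤ v :=
  (sum_range_le fun _ _ => I.special_le _ _).trans (by simp)

theorem nth_le (i r : ℕ) : I.nth i r ≤ I.n * I.n :=
  sum_range_le fun v hv => by
    have := Nat.mul_le_mul_left v (I.special_le i v)
    split_ifs <;> omega

theorem bit_le (p : Prop) : bit p ≤ 1 := by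
  unfold bit
  split <;> omega

theorem cells_le (q j : ℕ) : I.cells q j ≤ I.X := by
  have hn : I.n * I.n ≤ I.X := I.le_X 1 (by omega) (by nlinarith)
  have hn1 : I.n * 2 ≤ I.X := I.le_X 1 (by omega) (by nlinarith)
  have h1 : 1 ≤ I.X := I.le_X 1 (by omega) (by nlinarith)
  have hmod : ∀ j, j % (I.n + 1) ≤ I.n := fun j => by
    have := Nat.mod_lt j (show 0 < I.n + 1 by omega); omega
  unfold cells
  split
  · exact (I.a_le _).trans h1
  · exact (I.b_le _).trans h1
  · exact tab_le (fun j _ => by have := I.outdeg_le j; omega) j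
  · exact tab_le (fun j _ => (I.pos_le j).trans hn1) j
  · exact tab_le (fun j _ => (I.vert_le j).trans hn) j
  · exact tab_le (fun j _ => (I.arc_le _ _).trans h1) j
  · exact tab_le (fun j _ => by
      have := I.rowSum_le (j / (I.n + 1)) (j % (I.n + 1)); have := hmod j; omega) j
  · exact tab_le (fun j _ => by
      have := I.colSum_le (j / (I.n + 1)) (j % (I.n + 1)); have := hmod j; omega) j
  · exact tab_le (fun j _ => (I.width_le j).trans hn) j
  · exact tab_le (fun j _ => by
      have := I.rank_le (j / (I.n + 1)) (j % (I.n + 1)); have := hmod j; omega) j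
  · exact tab_le (fun j _ => (I.nth_le _ _).trans hn) j
  · refine tab_le (fun j hj => I.le_X_of_le_Y ?_) j
    have : I.B ^ j ≤ I.Y := Nat.pow_le_pow_right (by have := I.three_le_B; omega) (by omega)
    exact this.trans (Nat.le_mul_of_pos_right _ (by omega))
  · exact tab_le (fun j _ => (bit_le _).trans h1) j
  · exact Nat.zero_le _

/-- The variables after the first `p` of them have been computed. -/
def V (p x : ℕ) : ℕ := if x < p then I.val x else if x < 64 then 0 else I.val 0

/-- The arrays after the first `q` of them have been computed. -/
noncomputable def A (q a : ℕ) : ℕ → ℕ := if a < q then I.cells a else fun _ => 0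

theorem V_le (p x : ℕ) : I.V p x ≤ I.X := by
  unfold V
  split_ifs
  · exact I.val_le _
  · omega
  · exact I.val_le _

theorem A_le (q a j : ℕ) : I.A q a j ≤ I.X := by
  unfold A
  split_ifs
  · exact I.cells_le _ _
  · simp

theorem V_succ {p : ℕ} (hp : p < 64) : Function.update (I.V p) p (I.val p) = I.V (p + 1) := by
  funext x
  by_cases hx : x = p
  · subst hx; simp [V]
  · rw [Function.update_of_ne hx]
    have : x < p ↔ x < p + 1 := by omega
    simp [V, this]

theorem A_succ (q : ℕ) : Function.update (I.A q) q (I.cells q) = I.A (q + 1) := by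
  funext x
  by_cases hx : x = q
  · subst hx; simp [A]
  · rw [Function.update_of_ne hx]
    have : x < q ↔ x < q + 1 := by omega
    simp [A, this]

/-- The unit in which the running time is measured. -/
def Q : ℕ := I.Y ^ 10 * (I.n + 2) ^ 2

theorem two_le_X : 2 ≤ I.X :=
  I.le_X 2 (by omega) (Nat.le_mul_of_pos_right _ (by positivity))

end Input

/-- The program leads from one stage of the computation to another one. -/
def Computes (p : Prog) (i j i' j' : ℕ) : Prop :=
  ∃ c d, ∀ (I : Input) (w : ℕ), I.X ^ d < 2 ^ w →
    Reach w p (I.V i) (I.A j) (c * I.Q) (I.V i') (I.A j')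

theorem Computes.seq {p p' : Prog} {i j i' j' i'' j'' : ℕ} (h : Computes p i j i' j')
    (h' : Computes p' i' j' i'' j'') : Computes (.seq p p') i j i'' j'' := by
  obtain ⟨c, d, h⟩ := h
  obtain ⟨c', d', h'⟩ := h'
  refine ⟨c + c', d + d', fun I w hw => ?_⟩
  have h2 := I.two_le_X
  rw [add_mul]
  exact (h I w (lt_of_le_of_lt (Nat.pow_le_pow_right (by omega) (by omega)) hw)).seq
    (h' I w (lt_of_le_of_lt (Nat.pow_le_pow_right (by omega) (by omega)) hw))

theorem Reach.mono {w : ℕ} {p : Prog} {v v' : ℕ → ℕ} {A A' : ℕ → ℕ → ℕ} {T T' : ℕ}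
    (h : Reach w p v A T v' A') (hT : T ≤ T') : Reach w p v A T' v' A' := by
  intro s hs
  obtain ⟨t, ht, r⟩ := h s hs
  exact ⟨t, ht.trans hT, r⟩

theorem computes_setVar {i j : ℕ} {G : List ℕ} {e : Tm} (M : Input → ℕ) (hi : i ≠ 0) (hi' : i < 64)
    (hc : e.cmax ≤ 40000) (hb : e.bounds G = true) (hM : ∀ I : Input, ∀ y ∈ G, I.V i y ≤ M I)
    (hQ : ∀ I : Input, (M I + 1) ^ e.depth ≤ I.Q) (he : ∀ I : Input, e.eval (I.A j) (I.V i) = I.val i) :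
    Computes (setVar i e) i j (i + 1) j := by
  refine ⟨e.size + 2, e.deg, fun I w hw => ?_⟩
  have h := reach_setVar (M := M I) (G := G) (e := e) I.two_le_X
    ⟨hc.trans (I.le_X 40000 le_rfl (Nat.le_mul_of_pos_right _ (by positivity))), hw, hb⟩
    (I.A_le j) (I.V_le i) (hM I) hi hi'
  rw [he, I.V_succ hi'] at h
  refine h.mono ?_
  have h1 := Nat.mul_le_mul_left e.size (hQ I)
  have h2 : 1 ≤ (M I + 1) ^ e.depth := Nat.one_le_pow _ _ (by omega)
  have h3 := hQ I
  unfold Tm.cost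
  rw [add_mul]
  omega

/-- The time is the number of cells times the time of one cell, which `hQ` compares with the unit
`Q`. The number of cells must be in a variable already computed, hence `y < i`. -/
theorem computes_fill {i j y : ℕ} {G : List ℕ} {e : Tm} (M : Input → ℕ) (hi : i ≤ 63) (hy : y < i)
    (hc : e.cmax ≤ 40000) (hb : e.bounds G = true) (hG : 63 ∉ G)
    (hM : ∀ I : Input, ∀ y ∈ G, I.V i y ≤ M I)
    (hQ : ∀ I : Input, I.val y * (M I + 1) ^ e.depth ≤ I.Q) (h0 : ∀ (I : Input) l, I.val y ≤ l → I.cells j l = 0)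
    (he : ∀ I : Input, ∀ l < I.val y, e.eval (Function.update (I.A j) j
      (fun x => if x < l then I.cells j x else 0)) (Function.update (I.V i) 63 l) = I.cells j l) :
    Computes (fill j y e) i j i (j + 1) := by
  refine ⟨e.size + 18, e.deg, fun I w hw => ?_⟩
  have hVy : I.V i y = I.val y := if_pos hy
  have h := reach_fill (M := M I) (G := G) (e := e) (v := I.V i) (A := I.A j) (a := j) (y := y)
    (f := I.cells j) (w := w) I.two_le_X
    ⟨hc.trans (I.le_X 40000 le_rfl (Nat.le_mul_of_pos_right _ (by positivity))), hw, hb⟩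
    (I.A_le j) (I.V_le i) (hM I) hG (by omega) (by simp [Input.V, show ¬ 63 < i by omega])
    (by simp [Input.A]) (I.cells_le j) (by rw [hVy]; exact h0 I) (by rw [hVy]; exact he I)
  rw [I.A_succ, hVy] at h
  refine h.mono ?_
  have h1 := Nat.mul_le_mul_left e.size (hQ I)
  have h2 : I.val y * 1 ≤ I.val y * (M I + 1) ^ e.depth :=
    Nat.mul_le_mul_left _ (Nat.one_le_pow _ _ (by omega))
  have h3 := hQ I
  have h4 : 1 ≤ I.Q := by
    have : 3 ≤ I.Y := I.three_le_B.trans I.B_le_Y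
    exact Nat.mul_pos (Nat.pow_pos (by omega)) (Nat.pow_pos (by omega))
  unfold Tm.cost
  have h5 : I.val y * (e.size * (M I + 1) ^ e.depth + 12) =
    e.size * (I.val y * (M I + 1) ^ e.depth) + 12 * I.val y := by ring
  rw [add_mul]
  omega

end WordRAM

namespace WordRAM

open DigraphImmersion

/-! ### The program -/

namespace Input

variable (I : Input)

theorem one_le_Y : 1 ≤ I.Y := by have := I.three_le_B.trans I.B_le_Y; omega

theorem le_Q {a t : ℕ} (ht : t ≤ I.Y ^ a * (I.n + 2) ^ 2) (ha : a ≤ 10) : t ≤ I.Q :=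
  ht.trans (Nat.mul_le_mul_right _ (Nat.pow_le_pow_right I.one_le_Y ha))

theorem le_Q_of_le {t : ℕ} (ht : t ≤ (I.n + 2) ^ 2) : t ≤ I.Q :=
  I.le_Q (a := 0) (by simpa using ht) (by omega)

theorem le_Q_of_le_Y {t : ℕ} (ht : t ≤ I.Y) : t ≤ I.Q :=
  I.le_Q (a := 1) (by rw [pow_one]; exact ht.trans (Nat.le_mul_of_pos_right _ (by positivity)))
    (by omega)

theorem one_le_Q : 1 ≤ I.Q := I.le_Q_of_le_Y I.one_le_Y

end Input

namespace Program

/-- A variable that does not depend on sums. -/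
theorem computes_scalar {i j : ℕ} {e : Tm} (hi : i ≠ 0) (hi' : i < 64) (hc : e.cmax ≤ 40000)
    (hb : e.bounds [] = true)
    (he : ∀ I : Input, e.eval (I.A j) (I.V i) = I.val i) :
    Computes (setVar i e) i j (i + 1) j :=
  computes_setVar (G := []) (fun _ => 0) hi hi' hc hb (by simp) (fun I => by simpa using I.one_le_Q)
    he

def hh : Tm := .var 1 * .var 1
def k : Tm := .var 1 + .sum 50 2 (.cell 1 (.var 50))
def m : Tm := .const 40000 * .var 3 * .var 3
def M : Tm := 2 * .var 4
def K : Tm := .const 4 * .var 4 + 2 * .var 3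
def B : Tm := .var 2 + .var 5 + .var 6 + .const 3
def L1 : Tm := .var 1 + .const 3 * .var 6 + 1
def nn : Tm := .var 0 * .var 0
def n1 : Tm := .var 0 + 1
def nn1 : Tm := .var 0 * .var 10
def n1n1 : Tm := .var 10 * .var 10
def n1M : Tm := .var 10 * .var 5

theorem hh_ok : Computes (setVar 2 hh) 2 2 3 2 :=
  computes_scalar (by omega) (by omega) (by decide) rfl fun I => by
    simp [hh, Input.V, Input.val]

theorem k_ok : Computes (setVar 3 k) 3 2 4 2 :=
  computes_setVar (G := [2]) (fun I => I.Y) (by omega) (by omega) (by decide) rfl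
    (fun I y hy => by
      simp only [List.mem_singleton] at hy
      subst hy
      simpa [Input.V] using I.val_le_Y (x := 2) (by simp))
    (fun I => I.le_Q (a := 1) (by
      have h1 := I.one_le_Y
      have h2 : 2 ^ 2 ≤ (I.n + 2) ^ 2 := Nat.pow_le_pow_left (by omega) 2
      simp only [k, Tm.depth]
      show (I.Y + 1) ^ 1 ≤ _
      nlinarith) (by omega)) fun I => by
    simp [k, Input.V, Input.val, Input.A, Input.cells, Input.k]

theorem m_ok : Computes (setVar 4 m) 4 2 5 2 :=
  computes_scalar (by omega) (by omega) (by decide) rfl fun I => by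
    simp [m, Input.V, Input.val, Input.m]

theorem M_ok : Computes (setVar 5 M) 5 2 6 2 :=
  computes_scalar (by omega) (by omega) (by decide) rfl fun I => by
    simp [M, Input.V, Input.val]

theorem K_ok : Computes (setVar 6 K) 6 2 7 2 :=
  computes_scalar (by omega) (by omega) (by decide) rfl fun I => by
    simp [K, Input.V, Input.val]

theorem B_ok : Computes (setVar 7 B) 7 2 8 2 :=
  computes_scalar (by omega) (by omega) (by decide) rfl fun I => by
    simp [B, Input.V, Input.val, Input.B]

theorem L1_ok : Computes (setVar 8 L1) 8 2 9 2 :=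
  computes_scalar (by omega) (by omega) (by decide) rfl fun I => by
    simp [L1, Input.V, Input.val, Input.L]

theorem nn_ok : Computes (setVar 9 nn) 9 2 10 2 :=
  computes_scalar (by omega) (by omega) (by decide) rfl fun I => by
    simp [nn, Input.V, Input.val]

theorem n1_ok : Computes (setVar 10 n1) 10 2 11 2 :=
  computes_scalar (by omega) (by omega) (by decide) rfl fun I => by
    simp [n1, Input.V, Input.val]

theorem nn1_ok : Computes (setVar 11 nn1) 11 2 12 2 :=
  computes_scalar (by omega) (by omega) (by decide) rfl fun I => by
    simp [nn1, Input.V, Input.val]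

theorem n1n1_ok : Computes (setVar 12 n1n1) 12 2 13 2 :=
  computes_scalar (by omega) (by omega) (by decide) rfl fun I => by
    simp [n1n1, Input.V, Input.val]

theorem n1M_ok : Computes (setVar 13 n1M) 13 2 14 2 :=
  computes_scalar (by omega) (by omega) (by decide) rfl fun I => by
    simp [n1M, Input.V, Input.val]

/-- The index of the cell that is computed. -/
def x : Tm := .var 63
def u : Tm := .var 50
/-- The row and the column of a cell in a table with `n + 1` columns. -/
def row : Tm := x / .var 10
def col : Tm := x % .var 10

def outdeg : Tm := .sum 50 0 (.cell 0 (x * .var 0 + u))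
def pos : Tm := .sum 50 0 ((Tm.cell 2 x).lt (.cell 2 u) +
  (Tm.cell 2 u).eq (.cell 2 x) * u.lt x)
-- The order is inverted by a sum with a single relevant summand, as positions are distinct.
def vert : Tm := .sum 50 0 (u * (Tm.cell 3 u).eq x)
def arc : Tm := .cell 0 (.cell 4 (x / .var 0) * .var 0 + .cell 4 (x % .var 0))
-- Each prefix sum is obtained from the preceding cell in constant time; summing afresh would make
-- the table cubic in `n`. The factor `0 < col` restarts the sum in each row and makes the truncated
-- subtractions harmless.
def rowSum : Tm := (Tm.lt 0 col) * (.cell 6 (x - 1) + .cell 5 (row * .var 0 + (col - 1)))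
def colSum : Tm := (Tm.lt 0 col) * (.cell 7 (x - 1) + .cell 5 ((col - 1) * .var 0 + row))
def width : Tm := .sum 50 0 (u.lt x *
  (.cell 7 (u * .var 10 + .var 0) - .cell 7 (u * .var 10 + x)))
def special (i v : Tm) : Tm :=
  v.lt i * (Tm.cell 7 (v * .var 10 + i)).lt (.cell 7 (v * .var 10 + .var 0)) +
    (v.lt i).not * Tm.lt 0 (.cell 6 (v * .var 10 + i))
def rank : Tm := (Tm.lt 0 col) * (.cell 9 (x - 1) + special row (col - 1))
def nth : Tm := .sum 50 0 (u * special (x / .var 5) u *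
  (Tm.cell 9 (x / .var 5 * .var 10 + u)).eq (x % .var 5))
def pw : Tm := x.eq 0 + Tm.lt 0 x * (.cell 11 (x - 1) * .var 7)
-- Variable 8 contains `L + 1`, the length of the table of powers, so this is its last entry.
def S : Tm := .cell 11 (.var 8 - 1)
def n1S : Tm := .var 10 * .var 14

/-- A table whose entries are sums over all vertices. -/
theorem computes_fill_sum {j y : ℕ} {e : Tm} (hy : y < 14)
    (hc : e.cmax ≤ 40000) (hb : e.bounds [0] = true) (hd : e.depth ≤ 1)
    (hQ : ∀ I : Input, I.val y ≤ I.Y * (I.n + 2))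
    (h0 : ∀ (I : Input) l, I.val y ≤ l → I.cells j l = 0)
    (he : ∀ I : Input, ∀ l < I.val y, e.eval (Function.update (I.A j) j
      (fun x => if x < l then I.cells j x else 0)) (Function.update (I.V 14) 63 l) = I.cells j l) :
    Computes (fill j y e) 14 j 14 (j + 1) := by
  refine computes_fill (G := [0]) (fun I => I.n) (by omega) hy hc hb (by simp) (fun I y hy => ?_)
    (fun I => I.le_Q (a := 1) ?_ (by omega)) h0 he
  · simp only [List.mem_singleton] at hy
    subst hy
    simp [Input.V, Input.val]
  · have h1 : (I.n + 1) ^ e.depth ≤ (I.n + 1) ^ 1 := Nat.pow_le_pow_right (by omega) hd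
    calc _ ≤ (I.Y * (I.n + 2)) * (I.n + 1) ^ 1 := Nat.mul_le_mul (hQ I) h1
      _ ≤ (I.Y * (I.n + 2)) * (I.n + 2) ^ 1 :=
        Nat.mul_le_mul_left _ (Nat.pow_le_pow_left (by omega) _)
      _ = _ := by ring

/-- A table whose entries do not depend on sums. -/
theorem computes_fill_zero {j y : ℕ} {e : Tm} (hy : y < 14)
    (hc : e.cmax ≤ 40000) (hb : e.bounds [] = true) (hd : e.depth = 0)
    (hQ : ∀ I : Input, I.val y ≤ I.Q)
    (h0 : ∀ (I : Input) l, I.val y ≤ l → I.cells j l = 0)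
    (he : ∀ I : Input, ∀ l < I.val y, e.eval (Function.update (I.A j) j
      (fun x => if x < l then I.cells j x else 0)) (Function.update (I.V 14) 63 l) = I.cells j l) :
    Computes (fill j y e) 14 j 14 (j + 1) :=
  computes_fill (G := []) (fun I => 0) (by omega) hy hc hb (by simp) (by simp)
    (fun I => by simpa [hd] using hQ I) h0 he

theorem n_le (I : Input) : I.n + 1 ≤ I.Y * (I.n + 2) := by
  have := I.one_le_Y
  nlinarith

theorem outdeg_ok : Computes (fill 2 0 outdeg) 14 2 14 3 :=
  computes_fill_sum (by omega) (by decide) rfl le_rfl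
    (fun I => (Nat.le_succ _).trans (n_le I)) (by
      intro I l hl
      simp only [Input.cells]
      exact tab_of_le hl) fun I l hl => by
    rw [Input.cells, tab_of_lt (show l < I.n from hl)]
    simp [outdeg, x, u, Input.V, Input.val, Input.A, Input.cells, Input.outdeg]

theorem pos_ok : Computes (fill 3 0 pos) 14 3 14 4 :=
  computes_fill_sum (by omega) (by decide) rfl le_rfl
    (fun I => (Nat.le_succ _).trans (n_le I)) (by
      intro I l hl
      simp only [Input.cells]
      exact tab_of_le hl) fun I l hl => by
    rw [Input.cells, tab_of_lt (show l < I.n from hl)]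
    simp only [pos, Tm.eval_sum, Input.pos]
    refine Finset.sum_congr (by simp [Input.V, Input.val]) fun j hj => ?_
    have hj : j < I.n := by simpa [Input.V, Input.val] using hj
    replace hl : l < I.n := hl
    simp [x, u, Input.A, Input.cells, tab, hj, hl]

theorem vert_ok : Computes (fill 4 0 vert) 14 4 14 5 :=
  computes_fill_sum (by omega) (by decide) rfl le_rfl
    (fun I => (Nat.le_succ _).trans (n_le I)) (by
      intro I l hl
      simp only [Input.cells]
      exact tab_of_le hl) fun I l hl => by
    rw [Input.cells, tab_of_lt (show l < I.n from hl)]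
    simp only [vert, Tm.eval_sum, Input.vert]
    refine Finset.sum_congr (by simp [Input.V, Input.val]) fun j hj => ?_
    have hj : j < I.n := by simpa [Input.V, Input.val] using hj
    simp [x, u, Input.A, Input.cells, tab, hj]

theorem arc_ok : Computes (fill 5 9 arc) 14 5 14 6 :=
  computes_fill_zero (by omega) (by decide) rfl rfl
    (fun I => I.le_Q_of_le (by simp only [Input.val]; nlinarith)) (by
      intro I l hl
      simp only [Input.cells]
      exact tab_of_le hl)
    fun I l hl => by
    rw [Input.cells, tab_of_lt (show l < I.n * I.n from hl)]
    replace hl : l < I.n * I.n := hl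
    have h1 : l / I.n < I.n := Nat.div_lt_of_lt_mul hl
    have h2 : l % I.n < I.n := Nat.mod_lt _ (Nat.pos_of_ne_zero fun h => by simp [h] at hl)
    simp [arc, x, Input.A, Input.V, Input.val, Input.cells, tab, h1, h2, Input.arc]

theorem nn1_le (I : Input) : I.n * (I.n + 1) ≤ I.Q := I.le_Q_of_le (by nlinarith)

/-- Cells of a table with rows of length `N`. -/
theorem div_mod_cases {n N l : ℕ} (hl : l < n * N) :
    ∃ v < n, ∃ i < N, l = v * N + i ∧ l / N = v ∧ l % N = i :=
  ⟨l / N, Nat.div_lt_of_lt_mul (by rwa [mul_comm]), l % N,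
    Nat.mod_lt _ (Nat.pos_of_ne_zero (by rintro rfl; simp at hl)), (Nat.div_add_mod' l N).symm, rfl,
    rfl⟩

theorem cell_div {N v i : ℕ} (hi : i < N) : (v * N + i) / N = v := by
  rw [mul_comm, Nat.mul_add_div (by omega), Nat.div_eq_of_lt hi, add_zero]

theorem cell_mod {N v i : ℕ} (hi : i < N) : (v * N + i) % N = i := by
  rw [mul_comm, Nat.mul_add_mod, Nat.mod_eq_of_lt hi]

theorem cell_lt {n N v i : ℕ} (hv : v < n) (hi : i < N) : v * N + i < n * N := by
  calc v * N + i < v * N + N := by omega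
    _ = (v + 1) * N := by ring
    _ ≤ n * N := Nat.mul_le_mul_right _ hv

/-- The value of a cell of a table with rows of length `N`. -/
theorem tab_cell {n N v i : ℕ} {f : ℕ → ℕ → ℕ} (hv : v < n) (hi : i < N) :
    tab (n * N) (fun j => f (j / N) (j % N)) (v * N + i) = f v i := by
  rw [tab_of_lt (cell_lt hv hi), cell_div hi, cell_mod hi]

theorem rowSum_ok : Computes (fill 6 11 rowSum) 14 6 14 7 :=
  computes_fill_zero (by omega) (by decide) rfl rfl nn1_le (by
      intro I l hl
      simp only [Input.cells]
      exact tab_of_le hl)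
    fun I l hl => by
    obtain ⟨v, hv, i, hi, rfl, h1, h2⟩ := div_mod_cases (show l < I.n * (I.n + 1) from hl)
    cases i with
    | zero => simp [rowSum, col, x, Input.V, Input.val, Input.cells, tab, Input.rowSum]
    | succ i =>
      have hs : I.rowSum v (i + 1) = I.rowSum v i + I.arc v i := Finset.sum_range_succ _ _
      simp only [Input.cells, tab_cell hv hi]
      have h3 : v * (I.n + 1) + (i + 1) - 1 = v * (I.n + 1) + i := by omega
      -- The preceding cell has a smaller index and is already filled.
      have h4 : v * (I.n + 1) + i < v * (I.n + 1) + (i + 1) := by omega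
      simp [rowSum, col, row, x, Input.V, Input.val, Input.cells, Input.A, cell_div hi, cell_mod hi,
        h3, h4, tab_cell hv (show i < I.n + 1 by omega), tab_cell hv (show i < I.n by omega),
        hs]

theorem colSum_ok : Computes (fill 7 11 colSum) 14 7 14 8 :=
  computes_fill_zero (by omega) (by decide) rfl rfl nn1_le (by
      intro I l hl
      simp only [Input.cells]
      exact tab_of_le hl)
    fun I l hl => by
    obtain ⟨v, hv, i, hi, rfl, h1, h2⟩ := div_mod_cases (show l < I.n * (I.n + 1) from hl)
    cases i with
    | zero => simp [colSum, col, x, Input.V, Input.val, Input.cells, tab, Input.colSum]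
    | succ i =>
      have hs : I.colSum v (i + 1) = I.colSum v i + I.arc i v := Finset.sum_range_succ _ _
      simp only [Input.cells, tab_cell hv hi]
      have h3 : v * (I.n + 1) + (i + 1) - 1 = v * (I.n + 1) + i := by omega
      have h4 : v * (I.n + 1) + i < v * (I.n + 1) + (i + 1) := by omega
      simp [colSum, col, row, x, Input.V, Input.val, Input.cells, Input.A, cell_div hi, cell_mod hi,
        h3, h4, tab_cell hv (show i < I.n + 1 by omega), tab_cell (show i < I.n by omega) hv,
        hs]

theorem width_ok : Computes (fill 8 10 width) 14 8 14 9 :=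
  computes_fill_sum (by omega) (by decide) rfl le_rfl n_le (by
      intro I l hl
      simp only [Input.cells]
      exact tab_of_le hl)
    fun I l hl => by
    rw [Input.cells, tab_of_lt (show l < I.n + 1 from hl)]
    simp only [width, Tm.eval_sum, Input.width]
    refine Finset.sum_congr (by simp [Input.V, Input.val]) fun j hj => ?_
    have hj : j < I.n := by simpa [Input.V, Input.val] using hj
    replace hl : l < I.n + 1 := hl
    simp [x, u, Input.A, Input.V, Input.val, Input.cells, tab_cell hj hl,
      tab_cell hj (show I.n < I.n + 1 by omega)]

theorem eval_special {I : Input} {A : ℕ → ℕ → ℕ} {v : ℕ → ℕ} {i w : Tm} (h6 : A 6 = I.cells 6)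
    (h7 : A 7 = I.cells 7) (v0 : v 0 = I.n) (v10 : v 10 = I.n + 1) (hi : i.eval A v ≤ I.n)
    (hw : w.eval A v < I.n) :
    (special i w).eval A v = I.special (i.eval A v) (w.eval A v) := by
  have hi' : i.eval A v < I.n + 1 := by omega
  simp only [special, Tm.eval_add, Tm.eval_mul, Tm.eval_lt, Tm.eval_cell, Tm.eval_var, v0, v10, h6,
    h7, Tm.not, Tm.eval_eq, Tm.eval_zero, Input.cells, tab_cell hw hi',
    tab_cell hw (show I.n < I.n + 1 by omega), Input.special]
  congr 2
  split_ifs <;> simp_all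

theorem rank_ok : Computes (fill 9 12 rank) 14 9 14 10 :=
  computes_fill_zero (by omega) (by decide) rfl rfl
    (fun I => I.le_Q_of_le (by simp only [Input.val]; nlinarith)) (by
      intro I l hl
      simp only [Input.cells]
      exact tab_of_le hl)
    fun I l hl => by
    obtain ⟨i, hi, v, hv, rfl, h1, h2⟩ := div_mod_cases (show l < (I.n + 1) * (I.n + 1) from hl)
    cases v with
    | zero => simp [rank, col, x, Input.V, Input.val, Input.cells, tab, Input.rank]
    | succ v =>
      have hs : I.rank i (v + 1) = I.rank i v + I.special i v := Finset.sum_range_succ _ _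
      simp only [Input.cells, tab_cell hi hv]
      have h3 : i * (I.n + 1) + (v + 1) - 1 = i * (I.n + 1) + v := by omega
      have h4 : i * (I.n + 1) + v < i * (I.n + 1) + (v + 1) := by omega
      simp only [rank, Tm.eval_mul, Tm.eval_add]
      rw [eval_special (I := I) (by simp [Input.A]) (by simp [Input.A])
        (by simp [Input.V, Input.val]) (by simp [Input.V, Input.val])
        (by simp [row, x, Input.V, Input.val, cell_div hv]; omega)
        (by simp [col, x, Input.V, Input.val, cell_mod hv]; omega)]
      simp [col, row, x, Input.V, Input.val, cell_div hv, cell_mod hv, h3, h4,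
        tab_cell hi (show v < I.n + 1 by omega), hs]

theorem nth_ok : Computes (fill 10 13 nth) 14 10 14 11 :=
  computes_fill_sum (by omega) (by decide) rfl le_rfl
    (fun I => by
      have h1 : 2 * I.m ≤ I.Y := I.val_le_Y (x := 5) (by simp)
      calc (I.n + 1) * (2 * I.m) ≤ (I.n + 2) * I.Y := Nat.mul_le_mul (by omega) h1
        _ = _ := by ring)
    (by
      intro I l hl
      simp only [Input.cells, Input.nthCell]
      exact tab_of_le hl) fun I l hl => by
    obtain ⟨i, hi, r, hr, rfl, h1, h2⟩ := div_mod_cases (show l < (I.n + 1) * (2 * I.m) from hl)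
    simp only [Input.cells, Input.nthCell, tab_cell hi hr]
    simp only [nth, Tm.eval_sum, Input.nth]
    refine Finset.sum_congr (by simp [Input.V, Input.val]) fun j hj => ?_
    have hj : j < I.n := by simpa [Input.V, Input.val] using hj
    simp only [Tm.eval_mul]
    rw [eval_special (I := I) (by simp [Input.A]) (by simp [Input.A])
      (by simp [Input.V, Input.val]) (by simp [Input.V, Input.val])
      (by simp [x, Input.V, Input.val, cell_div hr]; omega)
      (by simpa [u] using hj)]
    simp [u, x, Input.V, Input.val, Input.A, Input.cells, cell_div hr, cell_mod hr,
      tab_cell hi (show j < I.n + 1 by omega)]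

theorem pw_ok : Computes (fill 11 8 pw) 14 11 14 12 :=
  computes_fill_zero (by omega) (by decide) rfl rfl
    (fun I => I.le_Q_of_le_Y (I.val_le_Y (by simp))) (by
      intro I l hl
      simp only [Input.cells]
      exact tab_of_le hl)
    fun I l hl => by
    rw [Input.cells, tab_of_lt (show l < I.L + 1 from hl)]
    replace hl : l < I.L + 1 := hl
    cases l with
    | zero => simp [pw, x]
    | succ l => simp [pw, x, Input.V, Input.val, tab, show l ≤ I.L by omega, pow_succ]

theorem S_ok : Computes (setVar 14 S) 14 12 15 12 :=
  computes_scalar (by omega) (by omega) (by decide) rfl fun I => by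
    simp [S, Input.V, Input.A, Input.val, Input.cells, tab, Input.S]

theorem n1S_ok : Computes (setVar 15 n1S) 15 12 16 12 :=
  computes_scalar (by omega) (by omega) (by decide) rfl fun I => by
    simp [n1S, Input.V, Input.val]

end Program
end WordRAM

/-! ### The table of reachable states, the answer, and the whole program -/

namespace WordRAM

open DigraphImmersion

namespace Program

/-- Only the column has to be in range: for `a ≥ n` the cell lies behind the table and both sides
are false. -/
theorem arc_ne_zero {I : Input} {a y : ℕ} (hy : y < I.n) :
    I.cells 5 (a * I.n + y) ≠ 0 ↔ I.D.A a y := by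
  simp only [Input.cells]
  by_cases ha : a < I.n
  · rw [tab_cell ha hy]
    exact ⟨fun h => ⟨ha, hy, h⟩, fun h => h.2.2⟩
  · rw [tab_of_le (by nlinarith)]
    exact iff_of_false (by simp) fun h => ha h.1

/-- The difference of the two prefix sums counts the arcs into `v` from the vertices from `i` on. -/
theorem colSum_eq_iff {I : Input} {v i : ℕ} (hi : i ≤ I.n) (hv : v < I.n) :
    I.colSum v I.n = I.colSum v i ↔ I.D.Generic i v := by
  have h1 := Finset.sum_range_add_sum_Ico (fun x => I.arc x v) hi
  have h2 : I.colSum v I.n = I.colSum v i + ∑ x ∈ Finset.Ico i I.n, I.arc x v := h1.symm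
  have h3 : I.colSum v I.n = I.colSum v i ↔ ∑ x ∈ Finset.Ico i I.n, I.arc x v = 0 := by omega
  rw [h3, Finset.sum_eq_zero_iff]
  constructor
  · rintro h b hb ⟨hb', -, hbv⟩
    exact hbv (h b (Finset.mem_Ico.2 ⟨hb, hb'⟩))
  · intro h b hb
    rw [Finset.mem_Ico] at hb
    by_contra hne
    exact h b hb.1 ⟨hb.2, hv, hne⟩

theorem colSum_cell_eq_iff {I : Input} (v i : ℕ) (hi : i ≤ I.n) :
    I.cells 7 (v * (I.n + 1) + I.n) = I.cells 7 (v * (I.n + 1) + i) ↔ I.D.Generic i v := by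
  simp only [Input.cells]
  by_cases hv : v < I.n
  · rw [tab_cell hv (by omega), tab_cell hv (by omega), colSum_eq_iff hi hv]
  · rw [tab_of_le (by nlinarith), tab_of_le (by nlinarith)]
    exact iff_of_true rfl fun b _ h => hv h.2.1

theorem env {I : Input} {A : ℕ → ℕ → ℕ} {v : ℕ → ℕ} (hv : ∀ z < 15, v z = I.val z)
    (hA : ∀ a < 12, A a = I.cells a) : SweepTm.Env I.D A v where
  n := hv 0 (by omega)
  h := hv 1 (by omega)
  hh := hv 2 (by omega)
  M := hv 5 (by omega)
  K := hv 6 (by omega)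
  B := hv 7 (by omega)
  S := hv 14 (by omega)
  R l _ := by rw [hA 1 (by omega)]; rfl
  T a y hy := by rw [hA 5 (by omega)]; exact arc_ne_zero hy
  C w i hi := by rw [hA 7 (by omega)]; exact colSum_cell_eq_iff w i hi
  SP i r := by rw [hA 10 (by omega)]; rfl
  pw j hj := by
    rw [hA 11 (by omega)]
    simp only [Input.cells]
    rw [tab_of_lt]
    · rfl
    · exact Nat.lt_succ_of_le hj

theorem add_one_le_sq (I : Input) : I.Y + 1 ≤ I.Y ^ 2 := by
  have := I.three_le_B.trans I.B_le_Y
  nlinarith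

theorem mark_ok : Computes (fill 12 15 SweepTm.mark) 16 12 16 13 :=
  computes_fill (G := [1, 2, 6, 14]) (fun I => I.Y) (by omega) (by omega) (by decide) (by rfl)
    (by decide) (fun I y hy => by
      have hy' : y < 16 := by
        simp only [List.mem_cons, List.not_mem_nil, or_false] at hy
        omega
      rw [Input.V, if_pos hy']
      refine I.val_le_Y ?_
      simp only [List.mem_cons, List.not_mem_nil, or_false] at hy ⊢
      omega)
    -- Sums are nested at most four deep, and `Y + 1 ≤ Y ^ 2`, which gives `Y ^ 8` per cell; the `S
    -- ≤ Y` cells per cut give one more factor.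
    (fun I => I.le_Q (a := 9) (by
      have h1 : (I.Y + 1) ^ SweepTm.mark.depth ≤ (I.Y ^ 2) ^ 4 :=
        (Nat.pow_le_pow_right (by omega) (by decide)).trans
          (Nat.pow_le_pow_left (add_one_le_sq I) 4)
      calc (I.n + 1) * I.S * (I.Y + 1) ^ SweepTm.mark.depth ≤ (I.n + 2) ^ 2 * I.Y * (I.Y ^ 2) ^ 4 :=
            Nat.mul_le_mul (Nat.mul_le_mul (by nlinarith) I.S_le_Y) h1
        _ = _ := by ring) (by omega))
    (by
      intro I l hl
      simp only [Input.cells]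
      exact tab_of_le hl)
    fun I l hl => by
    obtain ⟨i, hi, c, hc, rfl, h1, h2⟩ := div_mod_cases (show l < (I.n + 1) * I.S from hl)
    simp only [Input.cells]
    rw [tab_cell (f := fun i c => bit (I.D.Mark i c)) hi hc]
    have hE : SweepTm.Env I.D (Function.update (I.A 12) 12 (fun x =>
        if x < i * I.S + c then tab ((I.n + 1) * I.S) (fun j => bit (I.D.Mark (j / I.S) (j % I.S))) x
          else 0)) (Function.update (I.V 16) 63 (i * I.S + c)) :=
      (env (I := I) (v := I.V 16) (fun z hz => if_pos (by omega)) (fun a ha => by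
        rw [Function.update_of_ne (by omega)]
        exact if_pos ha)).update (by omega) _
    refine hE.eval_mark (i := i) (c' := c) (Nat.lt_succ_iff.1 hi) hc ?_ ?_
    · simp [I.codes_D]
    · intro j hj c₁ hc₁
      replace hc₁ : c₁ < I.S := hc₁
      have h3 : j * I.S + c₁ < i * I.S := cell_lt hj hc₁
      rw [I.codes_D, Function.update_self, if_pos (by omega),
        tab_cell (f := fun i c => bit (I.D.Mark i c)) (by omega) hc₁]

def final : Tm :=
  (Tm.all 51 1 ((SweepTm.pl u (.var 51)).eq 1)).and (Tm.all 51 6 ((SweepTm.kd u (.var 51)).eq 0))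

def answer : Tm :=
  ((Tm.ex 50 10 ((Tm.var 4).lt (.cell 8 u))).or
    (Tm.ex 50 14 ((Tm.cell 12 (.var 0 * .var 14 + u)).and final))).bit

theorem holds_final {D : SweepData} {A : ℕ → ℕ → ℕ} {v : ℕ → ℕ} (hE : SweepTm.Env D A v) :
    final.Holds A v ↔ D.Final (D.decode (v 50)) := by
  rw [final, Tm.holds_and, Tm.holds_all, Tm.holds_all, hE.h, hE.K, SweepData.Final]
  refine and_congr (forall₂_congr fun j hj => ?_) (forall₂_congr fun j hj => ?_)
  · rw [Tm.holds_eq, (hE.update (by omega) j).eval_pl (by simpa using hj)]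
    simp [u]
  · rw [Tm.holds_eq, (hE.update (by omega) j).eval_kd (by simpa using hj)]
    simp [u]

/-- What the program decides. -/
def Accepts (I : Input) : Prop :=
  (∃ i ≤ I.n, I.m < I.width i) ∨ ∃ c < I.S, I.D.Mark I.n c ∧ I.D.Final (I.D.decode c)

theorem eval_answer (I : Input) : answer.eval (I.A 13) (I.V 16) = bit (Accepts I) := by
  classical
  have hE : SweepTm.Env I.D (I.A 13) (I.V 16) :=
    env (fun z hz => if_pos (by omega)) (fun a ha => if_pos (by omega))
  rw [answer, Tm.eval_bit, bit]
  congr 1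
  refine propext ?_
  rw [Tm.holds_or, Tm.holds_ex, Tm.holds_ex]
  refine or_congr ?_ ?_
  · constructor
    · rintro ⟨i, hi, h⟩
      replace hi : i < I.n + 1 := hi
      refine ⟨i, by omega, ?_⟩
      simpa [u, Input.V, Input.A, Input.val, Input.cells, tab, hi] using h
    · rintro ⟨i, hi, h⟩
      have hi' : i < I.n + 1 := by omega
      refine ⟨i, hi', ?_⟩
      simpa [u, Input.V, Input.A, Input.val, Input.cells, tab, hi'] using h
  · refine exists_congr fun c => and_congr_right fun hc => ?_
    rw [Tm.holds_and, holds_final (hE.update (by omega) c), Function.update_self]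
    refine and_congr_left fun _ => ?_
    have hc : c < I.S := hc
    simp [Tm.Holds, u, Input.V, Input.A, Input.val, Input.cells,
      tab_cell (n := I.n + 1) (f := fun i c => bit (I.D.Mark i c)) (Nat.lt_succ_self I.n) hc]
    simp [bit]

def program : Prog :=
  .seq (setVar 2 hh) <| .seq (setVar 3 k) <| .seq (setVar 4 m) <| .seq (setVar 5 M) <|
  .seq (setVar 6 K) <| .seq (setVar 7 B) <| .seq (setVar 8 L1) <| .seq (setVar 9 nn) <|
  .seq (setVar 10 n1) <| .seq (setVar 11 nn1) <| .seq (setVar 12 n1n1) <| .seq (setVar 13 n1M) <|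
  .seq (fill 2 0 outdeg) <| .seq (fill 3 0 pos) <| .seq (fill 4 0 vert) <| .seq (fill 5 9 arc) <|
  .seq (fill 6 11 rowSum) <| .seq (fill 7 11 colSum) <| .seq (fill 8 10 width) <|
  .seq (fill 9 12 rank) <| .seq (fill 10 13 nth) <| .seq (fill 11 8 pw) <| .seq (setVar 14 S) <|
  .seq (setVar 15 n1S) <| fill 12 15 SweepTm.mark

theorem program_ok : Computes program 2 2 16 13 :=
  hh_ok.seq <| k_ok.seq <| m_ok.seq <| M_ok.seq <| K_ok.seq <| B_ok.seq <| L1_ok.seq <|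
  nn_ok.seq <| n1_ok.seq <| nn1_ok.seq <| n1n1_ok.seq <| n1M_ok.seq <| outdeg_ok.seq <|
  pos_ok.seq <| vert_ok.seq <| arc_ok.seq <| rowSum_ok.seq <| colSum_ok.seq <| width_ok.seq <|
  rank_ok.seq <| nth_ok.seq <| pw_ok.seq <| S_ok.seq <| n1S_ok.seq mark_ok

/-- The program decides `Accepts` within the expected time. -/
theorem exec_program : ∃ c d, ∀ (I : Input) (w : ℕ), I.X ^ d < 2 ^ w → ∀ s,
    Agrees s (I.V 2) (I.A 2) → ∃ t ≤ c * I.Q, ∃ s',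
      Exec w (.seq program (setVar 0 answer)) s t s' ∧ s'.reg 0 = bit (Accepts I) := by
  obtain ⟨c, d, h⟩ := program_ok
  refine ⟨c + (answer.size + 2), d + answer.deg, fun I w hw s hs => ?_⟩
  have h2 := I.two_le_X
  obtain ⟨t, ht, s₁, h1, hs₁⟩ :=
    h I w (lt_of_le_of_lt (Nat.pow_le_pow_right (by omega) (by omega)) hw) s hs
  have hY := I.three_le_B.trans I.B_le_Y
  have hG : ∀ y ∈ [1, 6, 10, 14], I.V 16 y + 1 ≤ I.Y * (I.n + 2) := by
    intro y hy
    have h3 : ∀ z, z ≤ I.Y → z + 1 ≤ I.Y * (I.n + 2) := fun z hz => by nlinarith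
    simp only [List.mem_cons, List.not_mem_nil, or_false] at hy
    rcases hy with rfl | rfl | rfl | rfl
    · exact h3 _ (I.val_le_Y (x := 1) (by simp))
    · exact h3 _ (I.val_le_Y (x := 6) (by simp))
    · show I.n + 1 + 1 ≤ _
      nlinarith
    · exact h3 _ (I.val_le_Y (x := 14) (by simp))
  -- Here one sum runs over all `n + 1` cuts, so the limits involve `n`; with depth at most two this
  -- still stays within `Q`.
  obtain ⟨t', ht', s₂, h3, h4⟩ := exec_answer (w := w) (X := I.X) (G := [1, 6, 10, 14])
    (M := I.Y * (I.n + 2) - 1) (e := answer) h2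
    ⟨le_trans (by decide) (I.le_X 40000 le_rfl (Nat.le_mul_of_pos_right _ (by positivity))),
      lt_of_le_of_lt (Nat.pow_le_pow_right (by omega) (by omega)) hw, by rfl⟩
    (I.A_le 13) (I.V_le 16) (fun y hy => by have := hG y hy; omega) hs₁
  refine ⟨t + t', ?_, s₂, .seq h1 h3, by rw [h4, eval_answer]⟩
  have h5 : 1 ≤ I.Y * (I.n + 2) := Nat.mul_pos (by omega) (by omega)
  have h6 : (I.Y * (I.n + 2) - 1 + 1) ^ answer.depth ≤ I.Q := by
    rw [Nat.sub_add_cancel h5]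
    refine I.le_Q (a := 2) ?_ (by omega)
    calc _ ≤ (I.Y * (I.n + 2)) ^ 2 := Nat.pow_le_pow_right h5 (by decide)
      _ = _ := by ring
  have h7 := Nat.mul_le_mul_left answer.size h6
  have h8 := I.one_le_Q
  unfold Tm.cost at ht'
  rw [add_mul, add_mul]
  omega

end Program
end WordRAM

namespace WordRAM

open DigraphImmersion

/-! ### Correctness of the program -/

namespace Input

section Tables

variable {I : Input}

open Classical in
theorem arc_eq_ite {x y : ℕ} (hx : x < I.n) (hy : y < I.n) :
    I.arc x y = if I.D.A x y then 1 else 0 := by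
  have h1 := I.arc_le x y
  have h2 : I.D.A x y ↔ I.arc x y ≠ 0 := ⟨fun h => h.2.2, fun h => ⟨hx, hy, h⟩⟩
  split_ifs with h
  · have := h2.1 h
    omega
  · by_contra h3
    exact h (h2.2 h3)

open Classical in
/-- The pairs of a first vertex before and a second one after a cut joined by a backward arc. -/
noncomputable def backward (I : Input) (i : ℕ) : Finset (ℕ × ℕ) :=
  (Finset.range i ×ˢ Finset.Ico i I.n).filter (fun p => I.D.A p.2 p.1)

theorem width_eq {i : ℕ} (hi : i ≤ I.n) : I.width i = (I.backward i).card := by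
  classical
  rw [backward, Finset.card_filter, Finset.sum_product, width]
  have h1 : ∀ v, I.colSum v I.n - I.colSum v i = ∑ x ∈ Finset.Ico i I.n, I.arc x v := by
    intro v
    have : _ = I.colSum v I.n := Finset.sum_range_add_sum_Ico (fun x => I.arc x v) hi
    rw [← this]
    exact Nat.add_sub_cancel_left _ _
  simp only [h1]
  rw [← Finset.sum_subset (Finset.range_mono hi) (by
    intro v _ hv
    rw [Finset.mem_range] at hv
    simp [hv])]
  refine Finset.sum_congr rfl fun v hv => ?_
  rw [Finset.mem_range] at hv
  rw [if_pos hv, one_mul]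
  refine Finset.sum_congr rfl fun x hx => ?_
  rw [Finset.mem_Ico] at hx
  rw [arc_eq_ite hx.2 (by omega)]

/-- The vertex `v` is incident with a backward arc over the cut `i`. -/
def IsSpecial (I : Input) (i v : ℕ) : Prop :=
  (v < i ∧ ∃ b, i ≤ b ∧ I.D.A b v) ∨ (i ≤ v ∧ ∃ a < i, I.D.A v a)

theorem IsSpecial.lt {i v : ℕ} (h : I.IsSpecial i v) : v < I.n := by
  rcases h with ⟨_, _, _, h⟩ | ⟨_, _, _, h⟩
  · exact h.2.1
  · exact h.1

open Classical in
theorem special_eq {i v : ℕ} (hi : i ≤ I.n) (hv : v < I.n) :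
    I.special i v = if I.IsSpecial i v then 1 else 0 := by
  have h1 : I.colSum v i < I.colSum v I.n ↔ ∃ b, i ≤ b ∧ I.D.A b v := by
    have h2 := Program.colSum_eq_iff hi hv
    have h3 : I.colSum v i ≤ I.colSum v I.n :=
      Finset.sum_le_sum_of_subset (Finset.range_mono hi)
    have h4 : I.colSum v i < I.colSum v I.n ↔ ¬ I.colSum v I.n = I.colSum v i := by omega
    rw [h4, h2, SweepData.Generic]
    push Not
    rfl
  have h2 : 0 < I.rowSum v i ↔ ∃ a < i, I.D.A v a := by
    rw [Nat.pos_iff_ne_zero, rowSum, Ne, Finset.sum_eq_zero_iff]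
    push Not
    refine exists_congr fun a => ?_
    rw [Finset.mem_range]
    exact and_congr_right fun ha => ⟨fun h => ⟨hv, by omega, h⟩, fun h => h.2.2⟩
  unfold special IsSpecial
  by_cases h : v < i <;> simp [h, h1, h2, Nat.not_le.2, Nat.not_lt.1]

open Classical in
theorem rank_eq {i v : ℕ} (hi : i ≤ I.n) (hv : v ≤ I.n) :
    I.rank i v = ((Finset.range v).filter (I.IsSpecial i)).card := by
  rw [Finset.card_filter, rank]
  refine Finset.sum_congr rfl fun u hu => ?_
  rw [Finset.mem_range] at hu
  exact special_eq hi (by omega)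

theorem rank_lt_rank {i u v : ℕ} (hi : i ≤ I.n) (hv : v ≤ I.n) (huv : u < v)
    (hu : I.IsSpecial i u) : I.rank i u < I.rank i v := by
  classical
  rw [rank_eq hi (by omega), rank_eq hi hv]
  refine Finset.card_lt_card ⟨?_, fun h => ?_⟩
  · exact Finset.filter_subset_filter _ (Finset.range_mono huv.le)
  · have := h (Finset.mem_filter.2 ⟨Finset.mem_range.2 huv, hu⟩)
    exact absurd (Finset.mem_range.1 (Finset.mem_filter.1 this).1) (lt_irrefl _)

/-- Every special vertex is an end of a backward arc over the cut, and each arc has two ends. This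
is why `2 * m` names suffice. -/
theorem rank_le_width {i : ℕ} (hi : i ≤ I.n) : I.rank i I.n ≤ 2 * I.width i := by
  classical
  rw [rank_eq hi le_rfl, width_eq hi]
  calc _ ≤ ((I.backward i).image Prod.fst ∪ (I.backward i).image Prod.snd).card := by
        refine Finset.card_le_card fun v hv => ?_
        obtain ⟨h1, h2⟩ := Finset.mem_filter.1 hv
        rw [Finset.mem_union, Finset.mem_image, Finset.mem_image]
        rcases h2 with ⟨h3, b, h4, h5⟩ | ⟨h3, a, h4, h5⟩
        · exact Or.inl ⟨(v, b), by simp [backward, h3, h4, h5, h5.1], rfl⟩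
        · exact Or.inr ⟨(a, v), by simp [backward, h3, h4, h5, h5.1], rfl⟩
    _ ≤ _ := (Finset.card_union_le _ _).trans
      (by rw [two_mul]; exact Nat.add_le_add Finset.card_image_le Finset.card_image_le)

/-- Ranks are strictly increasing on special vertices, so only one summand survives. -/
theorem nth_rank {i v : ℕ} (hi : i ≤ I.n) (hv : I.IsSpecial i v) : I.nth i (I.rank i v) = v := by
  classical
  have hvn := hv.lt
  rw [nth, Finset.sum_eq_single v]
  · rw [special_eq hi hvn, if_pos hv]
    simp
  · intro u hu huv
    rw [Finset.mem_range] at hu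
    rw [special_eq hi hu]
    split_ifs with h1 h2
    · rcases Nat.lt_or_gt_of_ne huv with h | h
      · have := rank_lt_rank hi (by omega) h h1
        omega
      · have := rank_lt_rank hi (by omega) h hv
        omega
    all_goals simp
  · intro h
    exact absurd (Finset.mem_range.2 hvn) h

theorem exists_SP_eq {i v : ℕ} (hi : i ≤ I.n) (hm : I.width i ≤ I.m) (hv : I.IsSpecial i v) :
    ∃ r < I.D.M, I.D.SP i r = v := by
  have h1 := rank_lt_rank hi le_rfl hv.lt hv
  have h2 := rank_le_width hi
  have h3 : I.rank i v < 2 * I.m := by omega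
  refine ⟨I.rank i v, h3, ?_⟩
  simp only [D, nthCell]
  rw [Program.tab_cell (by omega) h3, nth_rank hi hv]

/-- The order of the vertices. -/
def Before (I : Input) (v u : ℕ) : Prop :=
  I.outdeg u < I.outdeg v ∨ (I.outdeg v = I.outdeg u ∧ v < u)

open Classical in
theorem pos_eq (u : ℕ) :
    I.pos u = ((Finset.range I.n).filter (fun v => I.Before v u)).card := by
  rw [Finset.card_filter, pos]
  refine Finset.sum_congr rfl fun v _ => ?_
  unfold Before
  by_cases h1 : I.outdeg u < I.outdeg v
  · simp [h1, h1.ne']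
  · by_cases h2 : I.outdeg v = I.outdeg u <;> simp [h1, h2]

theorem pos_lt_pos {u v : ℕ} (hv : v < I.n) (h : I.Before v u) : I.pos v < I.pos u := by
  classical
  rw [pos_eq, pos_eq]
  unfold Before at h
  refine Finset.card_lt_card ⟨fun z hz => ?_, fun hs => ?_⟩
  · obtain ⟨h1, h2⟩ := Finset.mem_filter.1 hz
    refine Finset.mem_filter.2 ⟨h1, ?_⟩
    unfold Before at *
    omega
  · have h1 := hs (Finset.mem_filter.2 ⟨Finset.mem_range.2 hv, h⟩)
    have h2 := (Finset.mem_filter.1 h1).2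
    unfold Before at h2
    omega

theorem pos_lt {u : ℕ} (hu : u < I.n) : I.pos u < I.n := by
  classical
  rw [pos_eq]
  conv_rhs => rw [← Finset.card_range I.n]
  refine Finset.card_lt_card ⟨Finset.filter_subset _ _, fun hs => ?_⟩
  have h2 := (Finset.mem_filter.1 (hs (Finset.mem_range.2 hu))).2
  unfold Before at h2
  omega

theorem pos_inj {u v : ℕ} (hu : u < I.n) (hv : v < I.n) (h : I.pos u = I.pos v) : u = v := by
  have h1 : ¬ I.Before u v := fun h1 => by have := pos_lt_pos hu h1; omega
  have h2 : ¬ I.Before v u := fun h2 => by have := pos_lt_pos hv h2; omega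
  unfold Before at h1 h2
  omega

/-- Positions count the predecessors in a strict linear order: they are distinct and below `n`, so
finiteness makes them a permutation. -/
theorem exists_equiv (I : Input) : ∃ σ : Fin I.n ≃ Fin I.n, ∀ p, I.pos (σ p) = p := by
  let f : Fin I.n → Fin I.n := fun u => ⟨I.pos u, pos_lt u.2⟩
  have hf : Function.Injective f := fun u v h =>
    Fin.ext (pos_inj u.2 v.2 (Fin.mk.inj_iff.1 h))
  let τ := Equiv.ofBijective f (Finite.injective_iff_bijective.1 hf)
  exact ⟨τ.symm, fun p => congrArg Fin.val (τ.apply_symm_apply p)⟩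

theorem vert_eq {σ : Fin I.n ≃ Fin I.n} (hσ : ∀ p, I.pos (σ p) = p) (p : Fin I.n) :
    I.vert p = σ p := by
  rw [vert, Finset.sum_eq_single ((σ p : Fin I.n) : ℕ)]
  · simp [hσ p]
  · intro u hu hne
    rw [Finset.mem_range] at hu
    rw [if_neg, mul_zero]
    intro h
    exact hne (pos_inj hu (σ p).2 (h.trans (hσ p).symm))
  · intro h
    exact absurd (Finset.mem_range.2 (σ p).2) h

end Tables

variable {n h : ℕ}

/-- The input that consists of two digraphs. -/
noncomputable def ofDigraphs (T : Digraph (Fin n)) (H : Digraph (Fin h)) : Input where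
  n := n
  h := h
  a := adjacencyArray T
  b := adjacencyArray H
  a_le _ := bit_le _
  b_le _ := bit_le _

theorem adjacencyArray_apply (T : Digraph (Fin n)) (u v : Fin n) :
    adjacencyArray T ((u : ℕ) * n + v) = bit (T.Adj u v) := by
  unfold adjacencyArray
  congr 1
  refine propext ⟨?_, fun h => ⟨u, v, h, rfl⟩⟩
  rintro ⟨u', v', h1, h2⟩
  obtain ⟨rfl, rfl⟩ := code_inj h2
  exact h1

theorem bit_ne_zero {p : Prop} : bit p ≠ 0 ↔ p := by
  unfold bit
  split_ifs with h <;> simp [h]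

variable {T : Digraph (Fin n)} {H : Digraph (Fin h)}

open Classical in
theorem outdeg_eq (u : Fin n) : (ofDigraphs T H).outdeg u = (outNbr T u).card := by
  rw [outNbr, Finset.card_filter, outdeg]
  show ∑ v ∈ Finset.range n, adjacencyArray T ((u : ℕ) * n + v) = _
  rw [Finset.sum_range]
  exact Finset.sum_congr rfl fun v _ => adjacencyArray_apply T u v

theorem A_eq {σ : Fin n ≃ Fin n} (hσ : ∀ p, (ofDigraphs T H).pos (σ p) = p) :
    (ofDigraphs T H).D.A = natAdj T σ := by
  funext x y
  refine propext ?_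
  have key : ∀ (hx : x < n) (hy : y < n), (ofDigraphs T H).arc x y ≠ 0 ↔
      T.Adj (σ ⟨x, hx⟩) (σ ⟨y, hy⟩) := by
    intro hx hy
    have h1 := vert_eq (I := ofDigraphs T H) hσ ⟨x, hx⟩
    have h2 := vert_eq (I := ofDigraphs T H) hσ ⟨y, hy⟩
    have h3 : (ofDigraphs T H).arc x y = adjacencyArray T ((σ ⟨x, hx⟩ : ℕ) * n + σ ⟨y, hy⟩) := by
      rw [arc, show (ofDigraphs T H).vert x = _ from h1, show (ofDigraphs T H).vert y = _ from h2]
      rfl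
    rw [h3, adjacencyArray_apply, bit_ne_zero]
  constructor
  · rintro ⟨hx, hy, h⟩
    exact ⟨hx, hy, (key hx hy).1 h⟩
  · rintro ⟨hx, hy, h⟩
    exact ⟨hx, hy, (key hx hy).2 h⟩

theorem R_eq : (ofDigraphs T H).D.R = arcCode H := by
  funext l
  exact propext bit_ne_zero

open Classical in
theorem sum_b_eq : ∑ l ∈ Finset.range (h * h), adjacencyArray H l =
    ((Finset.range (h * h)).filter (arcCode H)).card := by
  rw [Finset.card_filter]
  rfl

theorem k_eq : (ofDigraphs T H).k = size H := by
  classical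
  have h1 : (ofDigraphs T H).k = h + ∑ l ∈ Finset.range (h * h), adjacencyArray H l := rfl
  rw [h1, sum_b_eq, size, Nat.card_eq_fintype_card, Fintype.card_fin, Nat.card_eq_fintype_card,
    Fintype.card_subtype]
  congr 1
  symm
  refine Finset.card_bij (fun e _ => (e.1 : ℕ) * h + e.2) ?_ ?_ ?_
  · intro e he
    exact Finset.mem_filter.2 ⟨Finset.mem_range.2 (code_lt _ _), e.1, e.2,
      (Finset.mem_filter.1 he).2, rfl⟩
  · intro e _ e' _ hee
    obtain ⟨h2, h3⟩ := code_inj hee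
    exact Prod.ext h2 h3
  · intro l hl
    obtain ⟨-, u, v, h2, rfl⟩ := Finset.mem_filter.1 hl
    exact ⟨(u, v), by simpa using h2, rfl⟩

/-- The initial segment is the set `X` of `immersesInto_of_backward_arcs`; a smaller position
implies an outdegree at least as large. -/
theorem immersesInto_of_width {i : ℕ} (hT : IsSemicomplete T) (hH : IsSimple H) (hi : i ≤ n)
    (hw : (ofDigraphs T H).m < (ofDigraphs T H).width i) : ImmersesInto H T := by
  classical
  obtain ⟨σ, hσ⟩ := exists_equiv (ofDigraphs T H)
  change Fin n ≃ Fin n at σ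
  refine immersesInto_of_backward_arcs (k := size H) hT hH le_rfl
    (Finset.univ.filter (fun v : Fin n => (ofDigraphs T H).pos v < i)) ?_ ?_
  · intro x hx y hy
    rw [← outdeg_eq (H := H), ← outdeg_eq (H := H)]
    by_contra hlt
    have := pos_lt_pos (I := ofDigraphs T H) y.2 (Or.inl (Nat.lt_of_not_le hlt))
    simp only [Finset.mem_filter, Finset.mem_univ, true_and] at hx hy
    omega
  · rw [width_eq (I := ofDigraphs T H) hi] at hw
    have hm : (ofDigraphs T H).m = 40000 * size H * size H := by rw [m, k_eq]
    rw [hm] at hw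
    refine hw.trans_le ?_
    refine le_trans (Finset.card_le_card fun p hp => ?_) (Finset.card_image_le
      (f := fun e : Fin n × Fin n => ((ofDigraphs T H).pos e.2, (ofDigraphs T H).pos e.1)))
    obtain ⟨h1, h2⟩ := Finset.mem_filter.1 hp
    obtain ⟨h3, h4⟩ := Finset.mem_product.1 h1
    rw [Finset.mem_range] at h3
    rw [Finset.mem_Ico] at h4
    have hA : (ofDigraphs T H).D.A = natAdj T σ := A_eq hσ
    obtain ⟨hy, hx, hadj⟩ := (iff_of_eq (congrFun (congrFun hA p.2) p.1)).1 h2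
    have ex : (ofDigraphs T H).pos (σ ⟨p.1, hx⟩) = p.1 := hσ ⟨p.1, hx⟩
    have ey : (ofDigraphs T H).pos (σ ⟨p.2, hy⟩) = p.2 := hσ ⟨p.2, hy⟩
    refine Finset.mem_image.2 ⟨(σ ⟨p.2, hy⟩, σ ⟨p.1, hx⟩), ?_, Prod.ext ex ey⟩
    simp only [Finset.mem_filter, Finset.mem_univ, true_and, ex, ey]
    exact ⟨by omega, h3, hadj⟩

/-- A complete sweep yields an immersion whatever the widths of the cuts are. The bound on the
widths matters only for the converse, where it limits the numbers of slots and of names. -/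
theorem accepts_iff (hT : IsSemicomplete T) (hH : IsSimple H) :
    Program.Accepts (ofDigraphs T H) ↔ ImmersesInto H T := by
  classical
  set I := ofDigraphs T H with hI
  obtain ⟨σ, hσ⟩ := exists_equiv I
  change Fin n ≃ Fin n at σ
  have hA : I.D.A = natAdj T σ := A_eq hσ
  have hR : I.D.R = arcCode H := R_eq
  constructor
  · rintro (⟨i, hi, hw⟩ | ⟨c, -, hc, hf⟩)
    · exact immersesInto_of_width hT hH hi hw
    · obtain ⟨s, hs⟩ := SweepData.exists_sweep_of_mark hc hf
      obtain ⟨φ, lam, hF⟩ := hs.exists_isFlow (by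
        intro a ha b hb hab
        rw [hA]
        rcases hT.2 (σ ⟨a, ha⟩) (σ ⟨b, hb⟩) (fun h => hab (Fin.mk.inj_iff.1 (σ.injective h))) with h | h
        · exact Or.inl ⟨ha, hb, h⟩
        · exact Or.inr ⟨hb, ha, h⟩)
      rw [hA, hR] at hF
      exact immersesInto_of_isFlow hF
  · intro hImm
    by_cases hw : ∃ i ≤ I.n, I.m < I.width i
    · exact Or.inl hw
    right
    push Not at hw
    obtain ⟨φ, lam, hF⟩ := exists_isFlow σ hImm
    rw [← hA, ← hR] at hF
    obtain ⟨sl, rk, g, hp⟩ := SweepData.exists_plan (D := I.D) hF (m := I.m) (k := I.k)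
      (by
        intro a
        rw [hA]
        rintro ⟨_, _, h⟩
        exact hT.1 _ h)
      (fun a b h => ⟨h.1, h.2.1⟩) rfl
      (fun i hi => by
        have := hw i hi
        rw [width_eq hi, backward] at this
        exact (le_of_eq (by congr)).trans this)
      (by
        have h1 : I.k = h + ∑ l ∈ Finset.range (h * h), adjacencyArray H l := rfl
        rw [h1, sum_b_eq]
        refine (le_of_eq ?_).trans (Nat.le_add_left _ _)
        simp only [hR]
        congr)
      (fun i hi v hv => exists_SP_eq hi (hw i hi) hv)
    obtain ⟨c, hc, h1, h2⟩ := hp.exists_mark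
    exact ⟨c, hc, h1, h2⟩

end Input
end WordRAM

/-! ### Bounds for the running time and the word length -/

namespace WordRAM

open DigraphImmersion

namespace Input

theorem agrees_inputState {n h : ℕ} (T : Digraph (Fin n)) (H : Digraph (Fin h)) :
    Agrees (inputState T H) ((ofDigraphs T H).V 2) ((ofDigraphs T H).A 2) := by
  refine ⟨fun x => ?_, funext fun a => ?_⟩
  · rcases (show x = 0 ∨ x = 1 ∨ 2 ≤ x by omega) with rfl | rfl | hx
    · rfl
    · rfl
    · unfold homeReg V
      split_ifs with h1
      · omega
      · simp [inputState, show ¬ x = 0 by omega, show ¬ x = 1 by omega]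
      · omega
      · rfl
  · rcases (show a = 0 ∨ a = 1 ∨ 2 ≤ a by omega) with rfl | rfl | ha
    · rfl
    · rfl
    · simp [A, inputState, show ¬ a < 2 by omega, show ¬ a = 0 by omega, show ¬ a = 1 by omega]

/-- The exponent `k² log k`. -/
noncomputable def expo (k : ℕ) : ℝ := (k : ℝ) ^ 2 * Real.logb 2 k

theorem logb_nonneg (k : ℕ) : 0 ≤ Real.logb 2 (k : ℝ) := by
  rcases Nat.eq_zero_or_pos k with rfl | hk
  · simp
  · exact Real.logb_nonneg (by norm_num) (by exact_mod_cast hk)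

theorem expo_nonneg (k : ℕ) : 0 ≤ expo k := mul_nonneg (by positivity) (logb_nonneg k)

theorem two_rpow_logb {k : ℕ} (hk : 1 ≤ k) : (2 : ℝ) ^ Real.logb 2 (k : ℝ) = k :=
  Real.rpow_logb (by norm_num) (by norm_num) (by exact_mod_cast hk)

/-- The base is at most `240001 k² + 2 k + 3`, hence at most `2 ^ 18 * k ^ 4` for `k ≥ 2`. For `k ≤
1` the logarithm is 0 and the constant alone suffices. -/
theorem B_le (I : Input) : (I.B : ℝ) ≤ 2 ^ (18 + 4 * Real.logb 2 (I.k : ℝ)) := by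
  have h1 : I.B ≤ 240001 * I.k ^ 2 + 2 * I.k + 3 := by
    have := Nat.mul_le_mul I.h_le_k I.h_le_k
    unfold B m
    nlinarith
  have h18 : (2 : ℝ) ^ (18 : ℝ) = 262144 := by
    rw [show (18 : ℝ) = (18 : ℕ) by norm_num, Real.rpow_natCast]
    norm_num
  rcases (show I.k = 0 ∨ I.k = 1 ∨ 2 ≤ I.k by omega) with h | h | h
  · rw [h] at h1 ⊢
    have : (I.B : ℝ) ≤ 3 := by exact_mod_cast h1
    simp only [Nat.cast_zero, Real.logb_zero, mul_zero, add_zero, h18]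
    linarith
  · rw [h] at h1 ⊢
    have : (I.B : ℝ) ≤ 240006 := by exact_mod_cast h1
    simp only [Nat.cast_one, Real.logb_one, mul_zero, add_zero, h18]
    linarith
  · rw [Real.rpow_add (by norm_num), h18, mul_comm (4 : ℝ), Real.rpow_mul (by norm_num),
      two_rpow_logb (by omega), show (4 : ℝ) = (4 : ℕ) by norm_num, Real.rpow_natCast]
    have h2 : I.B ≤ 262144 * I.k ^ 4 := by
      have h3 : I.k ^ 2 ≤ I.k ^ 4 := Nat.pow_le_pow_right (by omega) (by omega)
      nlinarith
    exact_mod_cast h2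

theorem L_le (I : Input) : I.L + 1 ≤ 480007 * I.k ^ 2 + 1 := by
  have h1 := I.h_le_k
  have h2 : I.k ≤ I.k ^ 2 := Nat.le_self_pow (by omega) _
  unfold L m
  nlinarith

theorem exists_Y_le : ∃ a b : ℕ, ∀ I : Input, (I.Y : ℝ) ≤ 2 ^ ((a : ℝ) * expo I.k + b) := by
  -- The exponent is at most `(18 + 4 l) (480007 q + 1)` with `l = log k` and `q = k²`. For `k ≥ 2`
  -- both `l` and `q` are at least 1, and the first constant `(18 + 4) (480007 + 1)` suffices; the
  -- second one covers `k ≤ 1`, where `l = 0`.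
  refine ⟨22 * 480008, 18 * 480008, fun I => ?_⟩
  have hl := logb_nonneg I.k
  have hB := I.B_le
  have hL : ((I.L + 1 : ℕ) : ℝ) ≤ 480007 * (I.k : ℝ) ^ 2 + 1 := by exact_mod_cast I.L_le
  have h1 : (I.Y : ℝ) ≤ 2 ^ ((18 + 4 * Real.logb 2 (I.k : ℝ)) * ((I.L + 1 : ℕ) : ℝ)) := by
    rw [Real.rpow_mul_natCast (by norm_num), Y, Nat.cast_pow]
    exact pow_le_pow_left₀ (by positivity) hB _
  refine h1.trans (Real.rpow_le_rpow_of_exponent_le (by norm_num) ?_)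
  refine (mul_le_mul_of_nonneg_left hL (by positivity)).trans ?_
  unfold expo
  rcases (show I.k = 0 ∨ I.k = 1 ∨ 2 ≤ I.k by omega) with h | h | h
  · rw [h]; norm_num
  · rw [h]; norm_num
  · have hl1 : 1 ≤ Real.logb 2 (I.k : ℝ) := by
      rw [Real.le_logb_iff_rpow_le (by norm_num) (by exact_mod_cast (by omega : 0 < I.k))]
      simpa using (by exact_mod_cast h : (2 : ℝ) ≤ I.k)
    have hk : (1 : ℝ) ≤ (I.k : ℝ) ^ 2 := by
      have : (1 : ℝ) ≤ I.k := by exact_mod_cast (by omega : 1 ≤ I.k)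
      nlinarith
    generalize Real.logb 2 (I.k : ℝ) = l at *
    generalize (I.k : ℝ) ^ 2 = q at *
    push_cast
    nlinarith [mul_nonneg (sub_nonneg.2 hl1) (sub_nonneg.2 hk)]

theorem n_add_two_le (n : ℕ) : ((n : ℝ) + 2) ≤ 2 ^ (2 + Real.logb 2 (n : ℝ)) := by
  have h2 : (2 : ℝ) ^ (2 : ℝ) = 4 := by
    rw [show (2 : ℝ) = (2 : ℕ) by norm_num, Real.rpow_natCast]
    norm_num
  rw [Real.rpow_add (by norm_num), h2]
  rcases Nat.eq_zero_or_pos n with rfl | hn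
  · simp
    norm_num
  · rw [two_rpow_logb hn]
    have : (1 : ℝ) ≤ n := by exact_mod_cast hn
    linarith

/-- The values that occur in the computation fit into words of logarithmic length. -/
theorem X_pow_lt {a b d w : ℕ} {I : Input} (hY : (I.Y : ℝ) ≤ 2 ^ ((a : ℝ) * expo I.k + b))
    (hw : (((d + 1) * (a + b + 22) : ℕ) : ℝ) * (expo I.k + Real.logb 2 I.n + 1) ≤ w) :
    I.X ^ d < 2 ^ w := by
  have hl := logb_nonneg I.n
  have he := expo_nonneg I.k
  have h16 : (40000 : ℝ) ≤ 2 ^ (16 : ℝ) := by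
    rw [show (16 : ℝ) = (16 : ℕ) by norm_num, Real.rpow_natCast]
    norm_num
  have h1 : (I.X : ℝ) ≤ 2 ^ (16 + (a * expo I.k + b) + (2 + Real.logb 2 (I.n : ℝ)) * (2 : ℕ)) := by
    rw [Real.rpow_add (by norm_num), Real.rpow_add (by norm_num),
      Real.rpow_mul_natCast (by norm_num), X]
    push_cast
    exact mul_le_mul (mul_le_mul h16 hY (by positivity) (by positivity))
      (pow_le_pow_left₀ (by positivity) (n_add_two_le I.n) 2) (by positivity) (by positivity)
  have h2 : (I.X : ℝ) ^ d ≤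
      2 ^ ((16 + (a * expo I.k + b) + (2 + Real.logb 2 (I.n : ℝ)) * (2 : ℕ)) * d) := by
    rw [Real.rpow_mul_natCast (by norm_num)]
    exact pow_le_pow_left₀ (by positivity) h1 d
  have h3 : (16 + (a * expo I.k + b) + (2 + Real.logb 2 (I.n : ℝ)) * (2 : ℕ)) * d < (w : ℝ) := by
    refine lt_of_lt_of_le ?_ hw
    push_cast
    generalize expo I.k = e at *
    generalize Real.logb 2 (I.n : ℝ) = l at *
    have ha : (0 : ℝ) ≤ a := by positivity
    have hb : (0 : ℝ) ≤ b := by positivity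
    have hd : (0 : ℝ) ≤ d := by positivity
    -- The constant terms `16 + b + 4` are below `a + b + 22`. The word length has the factor `d +
    -- 1` in place of `d`, so that the inequality is strict even for `d = 0`.
    have h4 : 16 + (a * e + b) + (2 + l) * 2 ≤ (a + b + 22) * (e + l + 1) - 2 := by
      nlinarith [mul_nonneg ha hl, mul_nonneg hb hl, mul_nonneg hb he]
    nlinarith [mul_le_mul_of_nonneg_right h4 hd, mul_nonneg ha hl, mul_nonneg ha he,
      mul_nonneg hb hl, mul_nonneg hb he]
  have h5 : (I.X : ℝ) ^ d < 2 ^ (w : ℝ) :=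
    h2.trans_lt (Real.rpow_lt_rpow_of_exponent_lt (by norm_num) h3)
  rw [Real.rpow_natCast] at h5
  exact_mod_cast h5

theorem Q_le {a b : ℕ} {I : Input} (hY : (I.Y : ℝ) ≤ 2 ^ ((a : ℝ) * expo I.k + b))
    (hn : 1 ≤ I.n) :
    (I.Q : ℝ) ≤ (9 * 2 ^ (b * 10) : ℕ) * 2 ^ (((a * 10 : ℕ) : ℝ) * expo I.k) * (I.n : ℝ) ^ 2 := by
  have h1 : (I.Y : ℝ) ^ 10 ≤ 2 ^ (((a * 10 : ℕ) : ℝ) * expo I.k) * 2 ^ (b * 10) := by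
    refine (pow_le_pow_left₀ (by positivity) hY 10).trans (le_of_eq ?_)
    rw [← Real.rpow_mul_natCast (by norm_num), ← Real.rpow_natCast, ← Real.rpow_add (by norm_num)]
    congr 1
    push_cast
    ring
  have hn' : (1 : ℝ) ≤ I.n := by exact_mod_cast hn
  -- This needs `n ≥ 1` and is the reason why the time bound excludes the empty digraph.
  have h2 : ((I.n : ℝ) + 2) ^ 2 ≤ 9 * (I.n : ℝ) ^ 2 := by nlinarith
  have h3 := mul_le_mul h1 h2 (by positivity) (by positivity)
  unfold Q
  push_cast at h3 ⊢
  refine h3.trans (le_of_eq ?_)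
  ring

end Input

end WordRAM

theorem mainTheorem7 :
    ∃ (P : WordRAM.Prog) (c₁ c₂ C : ℕ),
      ∀ (n h : ℕ) (T : Digraph (Fin n)) (H : Digraph (Fin h)) (k w : ℕ),
        DigraphImmersion.IsSemicomplete T →
        DigraphImmersion.IsSimple H →
        k = DigraphImmersion.size H →
        (c₁ : ℝ) * ((k : ℝ) ^ 2 * Real.logb 2 k + Real.logb 2 n + 1) ≤ (w : ℝ) →
        ∃ (t : ℕ) (s : WordRAM.State),
          WordRAM.Exec w P (WordRAM.inputState T H) t s ∧
          s.reg 0 = WordRAM.bit (DigraphImmersion.ImmersesInto H T) ∧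
          (1 ≤ n →
            (t : ℝ) ≤ C * (2 : ℝ) ^ ((c₂ : ℝ) * ((k : ℝ) ^ 2 * Real.logb 2 k)) * (n : ℝ) ^ 2) := by
  obtain ⟨c, d, hP⟩ := WordRAM.Program.exec_program
  obtain ⟨a, b, hY⟩ := WordRAM.Input.exists_Y_le
  -- The exponent `10 * a` stems from the factor `Y ^ 10` of `Q`, and `9 * 2 ^ (10 * b)` from `(n +
  -- 2)² ≤ 9 n²` and the constant in the bound for `Y`.
  refine ⟨.seq WordRAM.Program.program (WordRAM.setVar 0 WordRAM.Program.answer),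
    (d + 1) * (a + b + 22), a * 10, c * (9 * 2 ^ (b * 10)), ?_⟩
  intro n h T H k w hT hH hk hw
  have hk' : (WordRAM.Input.ofDigraphs T H).k = k := WordRAM.Input.k_eq.trans hk.symm
  have hY' := hY (WordRAM.Input.ofDigraphs T H)
  rw [← hk'] at hw
  obtain ⟨t, ht, s, hs, hr⟩ := hP (WordRAM.Input.ofDigraphs T H) w
    (WordRAM.Input.X_pow_lt (d := d) hY' hw) _ (WordRAM.Input.agrees_inputState T H)
  refine ⟨t, s, hs, ?_, fun hn => ?_⟩
  · rw [hr]
    exact congrArg WordRAM.bit (propext (WordRAM.Input.accepts_iff hT hH))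
  · have h1 := WordRAM.Input.Q_le hY' (show 1 ≤ (WordRAM.Input.ofDigraphs T H).n from hn)
    rw [hk'] at h1
    have h2 : (t : ℝ) ≤ c * ((WordRAM.Input.ofDigraphs T H).Q : ℝ) := by exact_mod_cast ht
    refine h2.trans ((mul_le_mul_of_nonneg_left h1 (by positivity)).trans (le_of_eq ?_))
    rw [Nat.cast_mul c]
    simp only [WordRAM.Input.expo, mul_assoc]
    rfl
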